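/- **Setting and definitions.** Let $Q>1$. Let $(X,\mu)$ and $(Y,\nu)$ be separable metric spaces equipped with locally finite Borel measures that are positive on non-empty open sets, and let $f\colon X\to Y$ be a homeomorphism. $B_r(y)$ denotes the closed ball. A curve is a continuous map $\gamma\colon[a,b]\to X$; it is rectifiable if its length $\ell(\gamma)$ is finite, and then $\int_\gamma\rho\,ds=\int_0^{\ell(\gamma)}\rho(\gamma_s(t))\,dt$ with $\gamma_s$ the arc-length parametrization. For a family $\Gamma$ of curves, $\mathrm{Mod}_Q(\Gamma)=\inf_\rho\int\rho^Q$, over all Borel $\rho\ge 0$ (with values in $[0,\infty]$) such that $\int_\gamma\rho\,ds\ge1$ for every rectifiable $\gamma\in\Gamma$. Write $f(\Gamma)=\{f\circ\gamma:\gamma\in\Gamma\}$ and $f^{-1}(\Gamma)=\{\gamma: f\circ\gamma\in\Gamma\}$. A Borel function $g\colon X\to[0,\infty]$ is an upper gradient of $f$ if $d(f(\gamma(a)),f(\gamma(b)))\le\int_\gamma g\,ds$ for every rectifiable curve $\gamma\colon[a,b]\to X$, and a weak upper gradient if the rectifiable curves for which this fails form a family of $Q$-modulus $0$. A function is in $L^Q_{loc}$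 if every point has a neighbourhood on which it is $Q$-integrable, and $f\in L^Q_{loc}(X,Y)$ if every point has a neighbourhood of finite measure on which the distance from $f$ to some point of $Y$ is $Q$-integrable. $f\in N^{1,Q}_{loc}(X,Y)$ means that $f\in L^Q_{loc}(X,Y)$ and $f$ has an upper gradient in $L^Q_{loc}(X)$; then $g_f$ denotes its minimal weak upper gradient, the $\mu$-a.e. smallest among the weak upper gradients of $f$ in $L^Q_{loc}(X)$. $J_f$ is the Radon–Nikodym derivative with respect to $\mu$ of the measure $A\mapsto\nu(f(A))$. Finally $A(y,r,s)$ is the family of all curves in $Y$ that meet both $B_r(y)$ and $Y\setminus B_s(y)$. Consider the conditions * (I) with constant $K\ge0$: $f\in N^{1,Q}_{loc}(X,Y)$, and $g_f^Q\le K J_f$ $\mu$-almost everywhere; * (II) with constant $K\ge0$: $\mathrm{Mod}_Q(\Gamma)\le K\,\mathrm{Mod}_Q(f(\Gamma))$ for every family $\Gamma$ of curves in $X$ (with $0\cdot\infty=0$); * (III) with parameters $\lambda>1$ and $K'\ge1$: for every $y\in Y$, $$\liminf_{r\to0}\frac{r^Q\,\mathrm{Mod}_Q\bigl(f^{-1}(A(y,r,\lambda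 r))\bigr)}{\nu(B_r(y))}\le K'.$$ **Theorem.** Suppose that $\nu$ is doubling: $\nu(B_{2r}(y))\le C\,\nu(B_r(y))$ for all $y\in Y$ and $r>0$. Then (I) and (II) are quantitatively equivalent to (III): 1. If (I) holds with constant $K$, or (II) holds with constant $K$, then for every $\lambda>1$ condition (III) holds with $\lambda$ and some $K'\ge1$ that depends only on $Q$, $C$, $K$ and $\lambda$. 2. If (III) holds for some $\lambda>1$ and $K'\ge1$, then (I) and (II) both hold with a constant $K$ that depends only on $Q$, $C$, $\lambda$ and $K'$. **Consequence (Tyson).** Let $X$ and $Y$ be Ahlfors $Q$-regular, that is, $A_1^{-1}r^Q\le\mu(B_r(x))\le A_1r^Q$ for all $x\in X$ and $0<r\le\operatorname{diam}X$, and likewise for $\nu$ and $Y$ with a constant $A_2$ (here no doubling is assumed). Let $f$ be quasisymmetric: there is a homeomorphism $\eta\colon[0,\infty)\to[0,\infty)$ with $$\frac{d(f(x_3),f(x_2))}{d(f(x_3),f(x_1))}\le\eta\left(\frac{d(x_3,x_2)}{d(x_3,x_1)}\right)$$ for all distinct $x_1,x_2,x_3\in X$. Then $f$ is geometrically quasiconformal,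 quantitatively: there is $K$ depending only on $Q$, $A_1$, $A_2$ and $\eta$ such that $\mathrm{Mod}_Q(\Gamma)\le K\,\mathrm{Mod}_Q(f(\Gamma))$ and $\mathrm{Mod}_Q(f(\Gamma))\le K\,\mathrm{Mod}_Q(\Gamma)$ for every family $\Gamma$ of curves in $X$. -/

import Mathlib

open MeasureTheory Set Filter Topology
open scoped NNReal ENNReal

noncomputable section

namespace GeomQC

/-- A curve in `X`: a continuous map from a compact interval `[left, right] ⊂ ℝ` to `X`. -/
structure Curve (X : Type*) [TopologicalSpace X] where
  left : ℝ
  right : ℝ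
  left_le_right : left ≤ right
  toMap : C(Icc left right, X)

namespace Curve

variable {X Y : Type*} [MetricSpace X] [MetricSpace Y]

/-- The initial parameter, as a point of the parameter interval. -/
def start (γ : Curve X) : Icc γ.left γ.right := ⟨γ.left, left_mem_Icc.2 γ.left_le_right⟩

/-- The final parameter, as a point of the parameter interval. -/
def finish (γ : Curve X) : Icc γ.left γ.right := ⟨γ.right, right_mem_Icc.2 γ.left_le_right⟩

/-- The set of points the curve passes through. -/
def trace (γ : Curve X) : Set X := range γ.toMap

/-- The length of a curve: the supremum of `∑ |γ(t_{i+1}) - γ(t_i)|` over finite increasing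
sequences of parameters. -/
def length (γ : Curve X) : ℝ≥0∞ := eVariationOn γ.toMap univ

/-- A curve is rectifiable if it has finite length. -/
def Rectifiable (γ : Curve X) : Prop := γ.length ≠ ∞

/-- The variation function `v_γ(t)`, the length of the part of `γ` up to the parameter `t`
(real-valued; meaningful for rectifiable curves). -/
def variation (γ : Curve X) (t : Icc γ.left γ.right) : ℝ :=
  variationOnFromTo γ.toMap univ γ.start t

/-- The arc-length parametrization `γ_s : [0, l(γ)] → X` of a rectifiable curve, characterized by
`γ_s ∘ v_γ = γ`. Only its values on `[0, l(γ)]` matter. -/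
def arc (γ : Curve X) : ℝ → X := naturalParameterization γ.toMap univ γ.start

theorem arc_variation (γ : Curve X) (hγ : γ.Rectifiable) (t : Icc γ.left γ.right) :
    γ.arc (γ.variation t) = γ.toMap t :=
  edist_eq_zero.1 <| edist_naturalParameterization_eq_zero
    (BoundedVariationOn.locallyBoundedVariationOn hγ) (mem_univ _) (mem_univ _)

/-- The line integral `∫_γ ρ ds = ∫_0^{l(γ)} ρ(γ_s(t)) dt` along a rectifiable curve. -/
def lineIntegral (γ : Curve X) (ρ : X → ℝ≥0∞) : ℝ≥0∞ :=
  ∫⁻ t in Icc 0 γ.length.toReal, ρ (γ.arc t)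

/-- The image curve `f ∘ γ`. -/
def map (f : C(X, Y)) (γ : Curve X) : Curve Y :=
  ⟨γ.left, γ.right, γ.left_le_right, f.comp γ.toMap⟩

end Curve

section Modulus

variable {X : Type*} [MetricSpace X] [MeasurableSpace X]

/-- Admissible functions of a curve family: Borel functions `ρ : X → [0, ∞]` whose integral along
every rectifiable curve of the family is at least `1`. -/
def Admissible (Γ : Set (Curve X)) (ρ : X → ℝ≥0∞) : Prop :=
  Measurable ρ ∧ ∀ γ ∈ Γ, γ.Rectifiable → 1 ≤ γ.lineIntegral ρ

/-- The `p`-modulus of a curve family (`∞` if there are no admissible functions). -/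
def modulus (p : ℝ) (μ : Measure X) (Γ : Set (Curve X)) : ℝ≥0∞ :=
  ⨅ (ρ : X → ℝ≥0∞) (_ : Admissible Γ ρ), ∫⁻ x, ρ x ^ p ∂μ

end Modulus

section Sobolev

variable {X Z : Type*} [MetricSpace X] [MeasurableSpace X] [MetricSpace Z]

/-- The upper gradient inequality `|φ(γ(b)) - φ(γ(a))| ≤ ∫_γ g ds` along the curve `γ`. -/
def UpperGradientAlong (φ : X → Z) (g : X → ℝ≥0∞) (γ : Curve X) : Prop :=
  edist (φ (γ.toMap γ.finish)) (φ (γ.toMap γ.start)) ≤ γ.lineIntegral g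

/-- `g` is an upper gradient of `φ`. -/
def IsUpperGradient (φ : X → Z) (g : X → ℝ≥0∞) : Prop :=
  Measurable g ∧ ∀ γ : Curve X, γ.Rectifiable → UpperGradientAlong φ g γ

/-- `g` is a `p`-weak upper gradient of `φ`: the upper gradient inequality holds along all
rectifiable curves outside a family of `p`-modulus zero. -/
def IsWeakUpperGradient (p : ℝ) (μ : Measure X) (φ : X → Z) (g : X → ℝ≥0∞) : Prop :=
  Measurable g ∧ modulus p μ {γ : Curve X | γ.Rectifiable ∧ ¬ UpperGradientAlong φ g γ} = 0

/-- `g ∈ L^p_loc(X)`: every point has a neighbourhood on which `g ^ p` has finite integral. -/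
def LocLp (p : ℝ) (μ : Measure X) (g : X → ℝ≥0∞) : Prop :=
  ∀ x, ∃ U ∈ 𝓝 x, ∫⁻ x' in U, g x' ^ p ∂μ < ∞

/-- `φ ∈ L^p_loc(X, Z)`: `φ` is Borel, and every point has a neighbourhood of finite measure on
which the distance of `φ` to some (hence to any) point `z` of `Z` is in `L^p`. -/
def LocLpMap [MeasurableSpace Z] (p : ℝ) (μ : Measure X) (φ : X → Z) : Prop :=
  Measurable φ ∧
    ∀ x, ∃ U ∈ 𝓝 x, μ U < ∞ ∧ ∃ z : Z, ∫⁻ x' in U, edist z (φ x') ^ p ∂μ < ∞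

/-- The local Newton-Sobolev class `N^{1,p}_loc(X, Z)`. -/
def NewtonSobolevLoc [MeasurableSpace Z] (p : ℝ) (μ : Measure X) (φ : X → Z) : Prop :=
  LocLpMap p μ φ ∧ ∃ g : X → ℝ≥0∞, IsUpperGradient φ g ∧ LocLp p μ g

/-- `g` is a minimal `p`-weak upper gradient of `φ`: it is the least, up to null sets, among all
`p`-weak upper gradients of `φ` in `L^p_loc(X)`. It is unique up to null sets. -/
def IsMinimalWeakUpperGradient (p : ℝ) (μ : Measure X) (φ : X → Z) (g : X → ℝ≥0∞) : Prop :=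
  IsWeakUpperGradient p μ φ g ∧ LocLp p μ g ∧
    ∀ g' : X → ℝ≥0∞, IsWeakUpperGradient p μ φ g' → LocLp p μ g' → g ≤ᵐ[μ] g'

end Sobolev

section Quasiconformal

variable {X Y : Type*} [MetricSpace X] [MeasurableSpace X] [MetricSpace Y] [MeasurableSpace Y]

/-- The volume derivative `J_f`: the Radon-Nikodym derivative with respect to `μ` of the pullback
measure `A ↦ ν (f A)`, which is the pushforward of `ν` under the inverse of `f`. -/
def volumeDerivative (μ : Measure X) (ν : Measure Y) (f : X ≃ₜ Y) : X → ℝ≥0∞ :=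
  (ν.map f.symm).rnDeriv μ

/-- The analytic condition with constant `K`: `f ∈ N^{1,Q}_loc(X, Y)`, and its minimal `Q`-weak
upper gradient `g_f` satisfies `g_f ^ Q ≤ K J_f` almost everywhere. -/
def AnalyticQC (Q : ℝ) (μ : Measure X) (ν : Measure Y) (f : X ≃ₜ Y) (K : ℝ≥0) : Prop :=
  NewtonSobolevLoc Q μ f ∧
    ∃ g : X → ℝ≥0∞, IsMinimalWeakUpperGradient Q μ f g ∧
      ∀ᵐ x ∂μ, g x ^ Q ≤ K * volumeDerivative μ ν f x

/-- The image family `f(Γ)`. -/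
def imageFamily (f : X ≃ₜ Y) (Γ : Set (Curve X)) : Set (Curve Y) :=
  Curve.map (f : C(X, Y)) '' Γ

/-- The family `f⁻¹(Γ)` of all curves in `X` whose image under `f` is in `Γ`. -/
def preimageFamily (f : X ≃ₜ Y) (Γ : Set (Curve Y)) : Set (Curve X) :=
  Curve.map (f : C(X, Y)) ⁻¹' Γ

/-- The geometric condition with constant `K` (the `K_O`-inequality):
`Mod_Q(Γ) ≤ K Mod_Q(f(Γ))` for every family `Γ` of curves in `X`. -/
def GeometricQC (Q : ℝ) (μ : Measure X) (ν : Measure Y) (f : X ≃ₜ Y) (K : ℝ≥0) : Prop :=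
  ∀ Γ : Set (Curve X), modulus Q μ Γ ≤ K * modulus Q ν (imageFamily f Γ)

/-- The annular condenser `A(z, r, s)`: all curves that intersect both the closed ball `B_r(z)` and
the complement of the closed ball `B_s(z)`. -/
def annularCondenser (z : Y) (r s : ℝ) : Set (Curve Y) :=
  {γ | (γ.trace ∩ Metric.closedBall z r).Nonempty ∧
    (γ.trace ∩ (Metric.closedBall z s)ᶜ).Nonempty}

/-- The annular condition with parameters `lam` and `K'`: for every `y ∈ Y`,
`liminf_{r → 0} r ^ Q Mod_Q(f⁻¹(A(y, r, lam r))) / ν(B_r(y)) ≤ K'`. -/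
def AnnularQC (Q : ℝ) (μ : Measure X) (ν : Measure Y) (f : X ≃ₜ Y) (lam : ℝ) (K' : ℝ≥0) : Prop :=
  ∀ y : Y, liminf (fun r : ℝ => ENNReal.ofReal r ^ Q *
      modulus Q μ (preimageFamily f (annularCondenser y r (lam * r))) /
        ν (Metric.closedBall y r)) (𝓝[>] 0) ≤ K'

/-- `ν` is doubling with constant `C`. -/
def Doubling (ν : Measure Y) (C : ℝ≥0) : Prop :=
  ∀ (y : Y) (r : ℝ), 0 < r → ν (Metric.closedBall y (2 * r)) ≤ C * ν (Metric.closedBall y r)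

/-- `μ` is Ahlfors `Q`-regular with constant `A`: `A⁻¹ r ^ Q ≤ μ(B_r(x)) ≤ A r ^ Q` for all `x` and
all `0 < r ≤ diam X`. -/
def AhlforsRegular (Q : ℝ) (μ : Measure X) (A : ℝ≥0) : Prop :=
  ∀ (x : X) (r : ℝ), 0 < r → ENNReal.ofReal r ≤ Metric.ediam (univ : Set X) →
    ENNReal.ofReal r ^ Q ≤ A * μ (Metric.closedBall x r) ∧
      μ (Metric.closedBall x r) ≤ A * ENNReal.ofReal r ^ Q

/-- `f` is quasisymmetric with distortion function the homeomorphism `η : [0, ∞) → [0, ∞)`. -/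
def Quasisymmetric (f : X → Y) (η : ℝ≥0 ≃ₜ ℝ≥0) : Prop :=
  ∀ x₁ x₂ x₃ : X, x₁ ≠ x₂ → x₂ ≠ x₃ → x₁ ≠ x₃ →
    nndist (f x₃) (f x₂) / nndist (f x₃) (f x₁) ≤ η (nndist x₃ x₂ / nndist x₃ x₁)

end Quasiconformal

end GeomQC

end

open GeomQC

universe u v

/-! Everything is done with test functions for the modulus.

(I) implies (II): if `ρ` is admissible for `f(Γ)`, then `g_f · (ρ ∘ f)` is admissible for `Γ`
outside a family of modulus zero (`lineIntegral_map_le`), and `g_f ^ Q ≤ K J_f` bounds its energy by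
`K ∫ ρ ^ Q dν`. (II) implies (III): the function `1 / ((λ - 1) r)` on `B_{2λr}(y)` tests the
condenser `A(y, r, λr)`, and doubling compares `ν(B_{2λr})` with `ν(B_r)`.

(III) implies (I) is the core. At scale `ε` every `y` has a radius `r < ε` and a nearly optimal test
function for `f⁻¹(A(y, r, λr))`. Select balls by the Vitali covering theorem and take the supremum
of the functions `r_i ρ_i`, each cut off to the preimage of `B_{2λr_i}(y_i)`. The energy of this
supremum over `f⁻¹(F)` is controlled by the measure of a neighbourhood of `F`, because the balls
`B_{r_i/5}` are disjoint. A curve whose image is long compared to `ε` must cross the condensers that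
it meets; a second Vitali selection, among the balls of radius `2λr_i`, makes the contributions
disjoint, so the supremum acts like a sum and is an upper gradient at scale `ε` up to the factor
`20λ` (`AnnularQC.exists_discrete_upperGradient`). As `ε → 0`, uniform convexity of `t ^ Q` yields
convex combinations converging so fast that line integrals converge along almost every curve
(`exists_limit_of_bounded`). The limit `g` satisfies `∫_{f⁻¹(F)} g ^ Q ≤ c ν(F)`, first for closed
bounded and then for all Borel `F`, which is the pointwise bound by `J_f`
(`le_mul_rnDeriv_of_withDensity_le`).

For a quasisymmetric map between regular spaces, preimages of rings lie in round rings of a fixed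
ratio, whose modulus is bounded; this is (III). The inverse map has the same property, hence the
two-sided inequality. -/

noncomputable section

namespace GeomQC

/-! ### Arc length, subcurves and line integrals -/

namespace Curve

section Arc

variable {X : Type*} [MetricSpace X]

theorem Rectifiable.locallyBounded {γ : Curve X} (hγ : γ.Rectifiable) :
    LocallyBoundedVariationOn γ.toMap univ :=
  BoundedVariationOn.locallyBoundedVariationOn hγ

theorem start_le (γ : Curve X) (t : Icc γ.left γ.right) : γ.start ≤ t := t.2.1

theorem le_finish (γ : Curve X) (t : Icc γ.left γ.right) : t ≤ γ.finish := t.2.2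

theorem variation_start (γ : Curve X) : γ.variation γ.start = 0 := variationOnFromTo.self _ _ _

theorem variation_finish (γ : Curve X) : γ.variation γ.finish = γ.length.toReal := by
  rw [variation, variationOnFromTo.eq_of_le _ _ (γ.start_le _), length]
  congr 2
  ext x
  simp [γ.start_le x, γ.le_finish x]

theorem variation_mono {γ : Curve X} (hγ : γ.Rectifiable) : Monotone γ.variation :=
  monotoneOn_univ.1 (variationOnFromTo.monotoneOn hγ.locallyBounded (mem_univ _))

theorem variation_sub {γ : Curve X} (hγ : γ.Rectifiable) {s t : Icc γ.left γ.right} (hst : s ≤ t) :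
    ENNReal.ofReal (γ.variation t - γ.variation s) = eVariationOn γ.toMap (Icc s t) := by
  rw [variation, variation, variationOnFromTo.sub_right hγ.locallyBounded (mem_univ _)
    (mem_univ _) (mem_univ _), variationOnFromTo.eq_of_le _ _ hst,
    ENNReal.ofReal_toReal (hγ.locallyBounded _ _ (mem_univ _) (mem_univ _)), univ_inter]

theorem continuous_variation {γ : Curve X} (hγ : γ.Rectifiable) : Continuous γ.variation := by
  rw [continuous_iff_continuousAt]
  intro x
  have hl : Tendsto (fun y ↦ (eVariationOn γ.toMap (univ ∩ Icc y x)).toReal) (𝓝 x) (𝓝 0) := by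
    have := BoundedVariationOn.tendsto_eVariationOn_Icc_zero_left (s := univ) hγ (x := x)
      γ.toMap.continuous.continuousWithinAt
    rw [nhdsWithin_univ] at this
    exact (ENNReal.tendsto_toReal ENNReal.zero_ne_top).comp this
  have hr : Tendsto (fun y ↦ (eVariationOn γ.toMap (univ ∩ Icc x y)).toReal) (𝓝 x) (𝓝 0) := by
    have := BoundedVariationOn.tendsto_eVariationOn_Icc_zero_right (s := univ) hγ x
      γ.toMap.continuous.continuousWithinAt
    rw [nhdsWithin_univ] at this
    exact (ENNReal.tendsto_toReal ENNReal.zero_ne_top).comp this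
  have hsum := hl.add hr
  rw [add_zero] at hsum
  refine tendsto_iff_dist_tendsto_zero.2 (squeeze_zero (fun _ ↦ dist_nonneg) (fun y ↦ ?_) hsum)
  rw [Real.dist_eq, variation, variation, variationOnFromTo.sub_right hγ.locallyBounded
    (mem_univ _) (mem_univ _) (mem_univ _)]
  rcases le_total x y with h | h
  · rw [variationOnFromTo.eq_of_le _ _ h, abs_of_nonneg ENNReal.toReal_nonneg]
    exact le_add_of_nonneg_left ENNReal.toReal_nonneg
  · rw [variationOnFromTo.eq_of_ge _ _ h, abs_neg, abs_of_nonneg ENNReal.toReal_nonneg]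
    exact le_add_of_nonneg_right ENNReal.toReal_nonneg

theorem variation_mem {γ : Curve X} (hγ : γ.Rectifiable) (t : Icc γ.left γ.right) :
    γ.variation t ∈ Icc 0 γ.length.toReal := by
  rw [← γ.variation_start, ← γ.variation_finish]
  exact ⟨variation_mono hγ (γ.start_le t), variation_mono hγ (γ.le_finish t)⟩

theorem exists_variation_eq {γ : Curve X} (hγ : γ.Rectifiable) {τ : ℝ}
    (hτ : τ ∈ Icc 0 γ.length.toReal) : ∃ t, γ.variation t = τ := by
  rw [← γ.variation_start, ← γ.variation_finish] at hτ
  have : Fact (γ.left ≤ γ.right) := ⟨γ.left_le_right⟩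
  exact mem_range_of_exists_le_of_exists_ge (continuous_variation hγ) ⟨_, hτ.1⟩ ⟨_, hτ.2⟩

theorem exists_le_variation_eq {γ : Curve X} (hγ : γ.Rectifiable) {a b : ℝ} (ha : 0 ≤ a)
    (hab : a ≤ b) (hb : b ≤ γ.length.toReal) :
    ∃ s t, s ≤ t ∧ γ.variation s = a ∧ γ.variation t = b := by
  obtain ⟨s, hs⟩ := exists_variation_eq hγ (τ := a) ⟨ha, hab.trans hb⟩
  obtain ⟨t, ht⟩ := exists_variation_eq hγ (τ := b) ⟨ha.trans hab, hb⟩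
  rcases le_total s t with h | h
  · exact ⟨s, t, h, hs, ht⟩
  -- The chosen parameters can be in the wrong order only if the curve rests between them.
  · have : a = b := le_antisymm hab (by rw [← hs, ← ht]; exact variation_mono hγ h)
    exact ⟨s, s, le_rfl, hs, hs.trans this⟩

theorem edist_arc_le {γ : Curve X} (hγ : γ.Rectifiable) {a b : ℝ} (ha : 0 ≤ a)
    (hab : a ≤ b) (hb : b ≤ γ.length.toReal) :
    edist (γ.arc a) (γ.arc b) ≤ ENNReal.ofReal (b - a) := by
  obtain ⟨s, t, hst, rfl, rfl⟩ := exists_le_variation_eq hγ ha hab hb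
  rw [variation_sub hγ hst, arc_variation γ hγ, arc_variation γ hγ]
  exact eVariationOn.edist_le _ (left_mem_Icc.2 hst) (right_mem_Icc.2 hst)

/-- The arc-length parametrization, extended to `ℝ` by constants. -/
def arcExt (γ : Curve X) (t : ℝ) : X :=
  γ.arc (projIcc 0 γ.length.toReal ENNReal.toReal_nonneg t)

theorem arcExt_of_mem (γ : Curve X) {t : ℝ} (ht : t ∈ Icc 0 γ.length.toReal) :
    γ.arcExt t = γ.arc t := by
  rw [arcExt, projIcc_of_mem _ ht]

theorem arcExt_variation {γ : Curve X} (hγ : γ.Rectifiable) (t : Icc γ.left γ.right) :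
    γ.arcExt (γ.variation t) = γ.toMap t := by
  rw [arcExt_of_mem γ (variation_mem hγ t), arc_variation γ hγ]

theorem continuous_arcExt {γ : Curve X} (hγ : γ.Rectifiable) : Continuous γ.arcExt := by
  have h0 : (0 : ℝ) ≤ γ.length.toReal := ENNReal.toReal_nonneg
  have h : LipschitzWith 1 (fun t : Icc 0 γ.length.toReal ↦ γ.arc t) := by
    intro s t
    rw [ENNReal.coe_one, one_mul]
    rcases le_total s t with hst | hst
    · refine (edist_arc_le hγ s.2.1 hst t.2.2).trans ?_
      rw [Subtype.edist_eq, edist_dist, Real.dist_eq, abs_sub_comm]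
      exact ENNReal.ofReal_le_ofReal (le_abs_self _)
    · rw [edist_comm]
      refine (edist_arc_le hγ t.2.1 hst s.2.2).trans ?_
      rw [Subtype.edist_eq, edist_dist, Real.dist_eq]
      exact ENNReal.ofReal_le_ofReal (le_abs_self _)
  exact h.continuous.comp continuous_projIcc

theorem lineIntegral_eq (γ : Curve X) (ρ : X → ℝ≥0∞) :
    γ.lineIntegral ρ = ∫⁻ t in Icc 0 γ.length.toReal, ρ (γ.arcExt t) :=
  setLIntegral_congr_fun measurableSet_Icc fun t ht ↦ by simp only [arcExt_of_mem γ ht]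

theorem lineIntegral_mono (γ : Curve X) {ρ ρ' : X → ℝ≥0∞} (h : ρ ≤ ρ') :
    γ.lineIntegral ρ ≤ γ.lineIntegral ρ' :=
  lintegral_mono fun _ ↦ h _

theorem lineIntegral_mono_of_trace {γ : Curve X} (hγ : γ.Rectifiable) {ρ ρ' : X → ℝ≥0∞}
    (h : ∀ x ∈ γ.trace, ρ x ≤ ρ' x) : γ.lineIntegral ρ ≤ γ.lineIntegral ρ' := by
  refine setLIntegral_mono' measurableSet_Icc fun t ht ↦ h _ ?_
  obtain ⟨s, rfl⟩ := exists_variation_eq hγ ht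
  exact ⟨s, (arc_variation γ hγ s).symm⟩

/-- The restriction of a curve to a subinterval of its parameter interval. -/
def restrict (γ : Curve X) (s t : Icc γ.left γ.right) (hst : s ≤ t) : Curve X where
  left := s
  right := t
  left_le_right := hst
  toMap := γ.toMap.comp ⟨inclusion (Icc_subset_Icc s.2.1 t.2.2), continuous_inclusion _⟩

theorem restrict_toMap (γ : Curve X) {s t : Icc γ.left γ.right} (hst : s ≤ t)
    (x : Icc (γ.restrict s t hst).left (γ.restrict s t hst).right) :
    (γ.restrict s t hst).toMap x = γ.toMap ⟨x, Icc_subset_Icc s.2.1 t.2.2 x.2⟩ := rfl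

theorem eVariationOn_restrict (γ : Curve X) {s t : Icc γ.left γ.right} (hst : s ≤ t)
    (x y : Icc (γ.restrict s t hst).left (γ.restrict s t hst).right) :
    eVariationOn (γ.restrict s t hst).toMap (Icc x y) =
      eVariationOn γ.toMap (Icc ⟨x, Icc_subset_Icc s.2.1 t.2.2 x.2⟩
        ⟨y, Icc_subset_Icc s.2.1 t.2.2 y.2⟩) := by
  have hsub : Icc (γ.restrict s t hst).left (γ.restrict s t hst).right ⊆ Icc γ.left γ.right :=
    Icc_subset_Icc s.2.1 t.2.2
  have himg : inclusion hsub '' (Icc x y) = Icc (inclusion hsub x) (inclusion hsub y) := by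
    ext z
    constructor
    · rintro ⟨w, hw, rfl⟩
      exact ⟨hw.1, hw.2⟩
    · intro hz
      exact ⟨⟨z, x.2.1.trans hz.1, le_trans (b := (y : ℝ)) hz.2 y.2.2⟩, ⟨hz.1, hz.2⟩, rfl⟩
  have := eVariationOn.comp_eq_of_monotoneOn γ.toMap (t := Icc x y) (inclusion hsub)
    (fun a _ b _ hab ↦ hab)
  rw [himg] at this
  exact this

theorem length_restrict {γ : Curve X} (hγ : γ.Rectifiable) {s t : Icc γ.left γ.right}
    (hst : s ≤ t) :
    (γ.restrict s t hst).length = ENNReal.ofReal (γ.variation t - γ.variation s) := by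
  rw [variation_sub hγ hst, length]
  have := γ.eVariationOn_restrict hst (γ.restrict s t hst).start (γ.restrict s t hst).finish
  refine Eq.trans ?_ this
  congr 1
  ext x
  simp [start_le _ x, le_finish _ x]

theorem Rectifiable.restrict {γ : Curve X} (hγ : γ.Rectifiable) {s t : Icc γ.left γ.right}
    (hst : s ≤ t) : (γ.restrict s t hst).Rectifiable := by
  rw [Rectifiable, length_restrict hγ hst]
  exact ENNReal.ofReal_ne_top

theorem variation_restrict {γ : Curve X} (hγ : γ.Rectifiable) {s t : Icc γ.left γ.right}
    (hst : s ≤ t) (x : Icc (γ.restrict s t hst).left (γ.restrict s t hst).right) :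
    (γ.restrict s t hst).variation x =
      γ.variation ⟨x, Icc_subset_Icc s.2.1 t.2.2 x.2⟩ - γ.variation s := by
  have h1 := variation_sub (hγ.restrict hst) ((γ.restrict s t hst).start_le x)
  rw [variation_start, sub_zero, γ.eVariationOn_restrict hst] at h1
  have hx : s ≤ ⟨x, Icc_subset_Icc s.2.1 t.2.2 x.2⟩ := x.2.1
  rw [show (⟨((γ.restrict s t hst).start : ℝ), _⟩ : Icc γ.left γ.right) = s from rfl,
    ← variation_sub hγ hx] at h1
  exact (ENNReal.ofReal_eq_ofReal_iff (variation_mem (hγ.restrict hst) x).1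
    (sub_nonneg.2 (variation_mono hγ hx))).1 h1

/-- The arc-length parametrization of a subcurve is a translate of that of the curve, so all
integrals over subcurves can be computed on one interval. -/
theorem lineIntegral_restrict {γ : Curve X} (hγ : γ.Rectifiable) {s t : Icc γ.left γ.right}
    (hst : s ≤ t) (ρ : X → ℝ≥0∞) :
    (γ.restrict s t hst).lineIntegral ρ =
      ∫⁻ τ in Icc (γ.variation s) (γ.variation t), ρ (γ.arcExt τ) := by
  have hv := variation_mono hγ hst
  have hL : (γ.restrict s t hst).length.toReal = γ.variation t - γ.variation s := by
    rw [length_restrict hγ hst, ENNReal.toReal_ofReal (sub_nonneg.2 hv)]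
  have key : ∀ τ ∈ Icc 0 (γ.restrict s t hst).length.toReal,
      ρ ((γ.restrict s t hst).arc τ) = ρ (γ.arcExt (γ.variation s + τ)) := by
    intro τ hτ
    obtain ⟨x, rfl⟩ := exists_variation_eq (hγ.restrict hst) hτ
    rw [arc_variation _ (hγ.restrict hst), variation_restrict hγ hst, add_sub_cancel,
      arcExt_variation hγ]
    rfl
  rw [lineIntegral, setLIntegral_congr_fun measurableSet_Icc key, hL,
    ← lintegral_indicator measurableSet_Icc, ← lintegral_indicator measurableSet_Icc,
    ← lintegral_add_left_eq_self
      ((Icc (γ.variation s) (γ.variation t)).indicator fun τ ↦ ρ (γ.arcExt τ)) (γ.variation s)]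
  congr 1
  ext τ
  by_cases h : τ ∈ Icc 0 (γ.variation t - γ.variation s)
  · rw [indicator_of_mem h, indicator_of_mem]
    exact ⟨by linarith [h.1], by linarith [h.2]⟩
  · rw [indicator_of_notMem h, indicator_of_notMem]
    exact fun h' ↦ h ⟨by linarith [h'.1], by linarith [h'.2]⟩

theorem lineIntegral_restrict_le {γ : Curve X} (hγ : γ.Rectifiable) {s t : Icc γ.left γ.right}
    (hst : s ≤ t) (ρ : X → ℝ≥0∞) :
    (γ.restrict s t hst).lineIntegral ρ ≤ γ.lineIntegral ρ := by
  rw [lineIntegral_restrict hγ, lineIntegral_eq]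
  exact lintegral_mono_set (Icc_subset_Icc (variation_mem hγ s).1 (variation_mem hγ t).2)

end Arc

section Integral

variable {X : Type*} [MetricSpace X] [MeasurableSpace X] [BorelSpace X]

theorem measurable_comp_arcExt {γ : Curve X} (hγ : γ.Rectifiable) {ρ : X → ℝ≥0∞}
    (hρ : Measurable ρ) : Measurable fun t ↦ ρ (γ.arcExt t) :=
  hρ.comp (continuous_arcExt hγ).measurable

theorem lineIntegral_add {γ : Curve X} (hγ : γ.Rectifiable) {ρ : X → ℝ≥0∞} (hρ : Measurable ρ)
    (ρ' : X → ℝ≥0∞) :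
    γ.lineIntegral (fun x ↦ ρ x + ρ' x) = γ.lineIntegral ρ + γ.lineIntegral ρ' := by
  simp only [lineIntegral_eq]
  exact lintegral_add_left (measurable_comp_arcExt hγ hρ) _

theorem lineIntegral_const_mul {γ : Curve X} (hγ : γ.Rectifiable) {ρ : X → ℝ≥0∞}
    (hρ : Measurable ρ) (c : ℝ≥0∞) :
    γ.lineIntegral (fun x ↦ c * ρ x) = c * γ.lineIntegral ρ := by
  simp only [lineIntegral_eq]
  exact lintegral_const_mul _ (measurable_comp_arcExt hγ hρ)

theorem lineIntegral_tsum {γ : Curve X} (hγ : γ.Rectifiable) {ι : Type*} [Countable ι]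
    {ρ : ι → X → ℝ≥0∞} (hρ : ∀ i, Measurable (ρ i)) :
    γ.lineIntegral (fun x ↦ ∑' i, ρ i x) = ∑' i, γ.lineIntegral (ρ i) := by
  simp only [lineIntegral_eq]
  exact lintegral_tsum fun i ↦ (measurable_comp_arcExt hγ (hρ i)).aemeasurable

end Integral

end Curve

/-! ### Powers of infinite sums -/

section PowerSums

theorem iSup_rpow {ι : Sort*} {Q : ℝ} (hQ : 0 < Q) (a : ι → ℝ≥0∞) :
    (⨆ i, a i) ^ Q = ⨆ i, a i ^ Q :=
  (ENNReal.orderIsoRpow Q hQ).map_iSup a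

theorem iSup_rpow_le_tsum {ι : Type*} {Q : ℝ} (hQ : 0 < Q) (a : ι → ℝ≥0∞) :
    (⨆ i, a i) ^ Q ≤ ∑' i, a i ^ Q := by
  rw [iSup_rpow hQ]
  exact iSup_le fun i ↦ ENNReal.le_tsum i

/-- The weights `2 ^ -(n + 1)` add up to one, so the sum is at most the supremum of `2 ^ (n + 1) * a
n`. This crude bound replaces Minkowski's inequality. -/
theorem tsum_rpow_le {Q : ℝ} (hQ : 0 < Q) (a : ℕ → ℝ≥0∞) :
    (∑' n, a n) ^ Q ≤ ∑' n, (2 ^ (n + 1) * a n) ^ Q := by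
  refine le_trans (ENNReal.rpow_le_rpow ?_ hQ.le) (iSup_rpow_le_tsum hQ _)
  calc ∑' n, a n ≤ ∑' n, (2⁻¹ : ℝ≥0∞) ^ (n + 1) * ⨆ m, 2 ^ (m + 1) * a m := by
        refine ENNReal.tsum_le_tsum fun n ↦ ?_
        calc a n = (2⁻¹ : ℝ≥0∞) ^ (n + 1) * (2 ^ (n + 1) * a n) := by
              rw [← mul_assoc, ← mul_pow, ENNReal.inv_mul_cancel two_ne_zero ENNReal.ofNat_ne_top,
                one_pow, one_mul]
          _ ≤ _ := by gcongr; exact le_iSup (fun m ↦ 2 ^ (m + 1) * a m) n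
    _ = _ := by
        rw [ENNReal.tsum_mul_right, ENNReal.tsum_geometric_add_one, ENNReal.one_sub_inv_two,
          inv_inv, ENNReal.inv_mul_cancel two_ne_zero ENNReal.ofNat_ne_top, one_mul]

/-- A summable sequence of thresholds for `tsum_rpow_le`. -/
def threshold (Q : ℝ) (n : ℕ) : ℝ≥0∞ := (2 ^ (n + 1))⁻¹ * ((2 ^ (n + 1)) ^ Q)⁻¹

theorem two_pow_rpow_ne_zero (Q : ℝ) (n : ℕ) : ((2 : ℝ≥0∞) ^ (n + 1)) ^ Q ≠ 0 := by
  rw [Ne, ENNReal.rpow_eq_zero_iff]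
  simp

theorem two_pow_rpow_ne_top (Q : ℝ) (n : ℕ) : ((2 : ℝ≥0∞) ^ (n + 1)) ^ Q ≠ ∞ := by
  rw [Ne, ENNReal.rpow_eq_top_iff]
  simp

theorem threshold_pos (Q : ℝ) (n : ℕ) : 0 < threshold Q n :=
  ENNReal.mul_pos (ENNReal.inv_ne_zero.2 (by simp)) (ENNReal.inv_ne_zero.2 (two_pow_rpow_ne_top Q n))

theorem lintegral_tsum_rpow_le_one {α : Type*} [MeasurableSpace α] {μ : Measure α} {Q : ℝ}
    (hQ : 0 < Q) {a : ℕ → α → ℝ≥0∞} (ha : ∀ n, Measurable (a n))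
    (h : ∀ n, ∫⁻ x, a n x ^ Q ∂μ ≤ threshold Q n) : ∫⁻ x, (∑' n, a n x) ^ Q ∂μ ≤ 1 := by
  calc ∫⁻ x, (∑' n, a n x) ^ Q ∂μ ≤ ∫⁻ x, ∑' n, (2 ^ (n + 1) * a n x) ^ Q ∂μ :=
        lintegral_mono fun x ↦ tsum_rpow_le hQ _
    _ = ∑' n, ∫⁻ x, (2 ^ (n + 1) * a n x) ^ Q ∂μ :=
        lintegral_tsum fun n ↦ (((ha n).const_mul _).pow_const Q).aemeasurable
    _ ≤ ∑' n, (2⁻¹ : ℝ≥0∞) ^ (n + 1) := by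
        refine ENNReal.tsum_le_tsum fun n ↦ ?_
        simp_rw [ENNReal.mul_rpow_of_nonneg _ _ hQ.le]
        rw [lintegral_const_mul _ ((ha n).pow_const Q)]
        calc _ ≤ (2 ^ (n + 1)) ^ Q * threshold Q n := by gcongr; exact h n
          _ = _ := by
            rw [threshold, mul_left_comm, ENNReal.mul_inv_cancel (two_pow_rpow_ne_zero Q n)
              (two_pow_rpow_ne_top Q n), mul_one, ENNReal.inv_pow]
    _ = 1 := by
        rw [ENNReal.tsum_geometric_add_one, ENNReal.one_sub_inv_two,
          inv_inv, ENNReal.inv_mul_cancel two_ne_zero ENNReal.ofNat_ne_top]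

end PowerSums

/-! ### Modulus and exceptional families -/

section Modulus

variable {X : Type*} [MetricSpace X] [MeasurableSpace X] {Q : ℝ} {μ : Measure X}

theorem modulus_le_of_admissible {Γ : Set (Curve X)} {ρ : X → ℝ≥0∞} (h : Admissible Γ ρ) :
    modulus Q μ Γ ≤ ∫⁻ x, ρ x ^ Q ∂μ := iInf₂_le ρ h

theorem exists_admissible_lt {Γ : Set (Curve X)} {c : ℝ≥0∞} (h : modulus Q μ Γ < c) :
    ∃ ρ, Admissible Γ ρ ∧ ∫⁻ x, ρ x ^ Q ∂μ < c := by
  simpa [modulus, iInf_lt_iff] using h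

theorem Admissible.mono {Γ Γ' : Set (Curve X)} {ρ : X → ℝ≥0∞} (h : Admissible Γ' ρ)
    (hΓ : ∀ γ ∈ Γ, γ.Rectifiable → γ ∈ Γ') : Admissible Γ ρ :=
  ⟨h.1, fun γ hγ hr ↦ h.2 γ (hΓ γ hγ hr) hr⟩

theorem modulus_mono {Γ Γ' : Set (Curve X)} (hΓ : ∀ γ ∈ Γ, γ.Rectifiable → γ ∈ Γ') :
    modulus Q μ Γ ≤ modulus Q μ Γ' :=
  le_iInf₂ fun _ h ↦ modulus_le_of_admissible (h.mono hΓ)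

theorem modulus_iUnion_eq_zero {ι : Type*} [Countable ι] (hQ : 0 < Q) {Γ : ι → Set (Curve X)}
    (h : ∀ i, modulus Q μ (Γ i) = 0) : modulus Q μ (⋃ i, Γ i) = 0 := by
  refine nonpos_iff_eq_zero.1 (le_of_forall_gt fun c hc ↦ ?_)
  obtain ⟨ε, hε, hs⟩ := ENNReal.exists_pos_sum_of_countable' hc.ne' ι
  have : ∀ i, ∃ ρ, Admissible (Γ i) ρ ∧ ∫⁻ x, ρ x ^ Q ∂μ < ε i := fun i ↦
    exists_admissible_lt (by rw [h i]; exact hε i)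
  choose ρ hρ hi using this
  have hadm : Admissible (⋃ i, Γ i) fun x ↦ ⨆ i, ρ i x := by
    refine ⟨Measurable.iSup fun i ↦ (hρ i).1, fun γ hγ hr ↦ ?_⟩
    obtain ⟨i, hγi⟩ := mem_iUnion.1 hγ
    exact ((hρ i).2 γ hγi hr).trans
      (Curve.lineIntegral_mono _ fun x ↦ le_iSup (fun i ↦ ρ i x) i)
  calc modulus Q μ (⋃ i, Γ i) ≤ ∫⁻ x, (⨆ i, ρ i x) ^ Q ∂μ := modulus_le_of_admissible hadm
    _ ≤ ∫⁻ x, ∑' i, ρ i x ^ Q ∂μ := lintegral_mono fun x ↦ iSup_rpow_le_tsum hQ _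
    _ = ∑' i, ∫⁻ x, ρ i x ^ Q ∂μ :=
        lintegral_tsum fun i ↦ ((hρ i).1.pow_const Q).aemeasurable
    _ ≤ ∑' i, ε i := ENNReal.tsum_le_tsum fun i ↦ (hi i).le
    _ < c := hs

theorem modulus_union_eq_zero (hQ : 0 < Q) {Γ Γ' : Set (Curve X)} (h : modulus Q μ Γ = 0)
    (h' : modulus Q μ Γ' = 0) : modulus Q μ (Γ ∪ Γ') = 0 := by
  rw [union_eq_iUnion]
  exact modulus_iUnion_eq_zero hQ (by rintro (_ | _) <;> assumption)

theorem modulus_union_le (Γ Γ' : Set (Curve X)) :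
    modulus Q μ (Γ ∪ Γ') ≤ modulus Q μ Γ + modulus Q μ Γ' := by
  have key : ∀ ρ, Admissible Γ ρ → ∀ ρ', Admissible Γ' ρ' →
      modulus Q μ (Γ ∪ Γ') ≤ ∫⁻ x, ρ x ^ Q ∂μ + ∫⁻ x, ρ' x ^ Q ∂μ := by
    intro ρ hρ ρ' hρ'
    have hadm : Admissible (Γ ∪ Γ') fun x ↦ max (ρ x) (ρ' x) := by
      refine ⟨hρ.1.max hρ'.1, fun γ hγ hr ↦ ?_⟩
      rcases hγ with hγ | hγ
      · exact (hρ.2 γ hγ hr).trans (Curve.lineIntegral_mono _ fun x ↦ le_max_left _ _)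
      · exact (hρ'.2 γ hγ hr).trans (Curve.lineIntegral_mono _ fun x ↦ le_max_right _ _)
    refine (modulus_le_of_admissible hadm).trans ?_
    rw [← lintegral_add_left (hρ.1.pow_const Q)]
    refine lintegral_mono fun x ↦ ?_
    rcases le_total (ρ x) (ρ' x) with h | h
    · simp only [max_eq_right h]
      exact le_add_self
    · simp only [max_eq_left h]
      exact le_self_add
  have h1 : modulus Q μ Γ = ⨅ (ρ : X → ℝ≥0∞) (_ : Admissible Γ ρ), ∫⁻ x, ρ x ^ Q ∂μ := rfl
  have h2 : modulus Q μ Γ' = ⨅ (ρ : X → ℝ≥0∞) (_ : Admissible Γ' ρ), ∫⁻ x, ρ x ^ Q ∂μ := rfl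
  rw [h1, h2, ENNReal.iInf_add]
  refine le_iInf fun ρ ↦ ?_
  rw [ENNReal.iInf_add]
  refine le_iInf fun hρ ↦ ?_
  rw [ENNReal.add_iInf]
  refine le_iInf fun ρ' ↦ ?_
  rw [ENNReal.add_iInf]
  exact le_iInf fun hρ' ↦ key ρ hρ ρ' hρ'

variable [BorelSpace X]

/-- All multiples `ρ / n` stay admissible, and their energies tend to zero. With
`exists_lineIntegral_eq_top` this is Fuglede's description of the families of modulus zero. -/
theorem modulus_eq_zero_of_lineIntegral_eq_top (hQ : 0 < Q) {Γ : Set (Curve X)} {ρ : X → ℝ≥0∞}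
    (hρ : Measurable ρ) (hfin : ∫⁻ x, ρ x ^ Q ∂μ ≠ ∞)
    (h : ∀ γ ∈ Γ, γ.Rectifiable → γ.lineIntegral ρ = ∞) : modulus Q μ Γ = 0 := by
  have hle : ∀ n : ℕ, modulus Q μ Γ ≤ ((n : ℝ≥0∞)⁻¹) ^ Q * ∫⁻ x, ρ x ^ Q ∂μ := by
    intro n
    rw [← lintegral_const_mul _ (hρ.pow_const Q)]
    simp_rw [← ENNReal.mul_rpow_of_nonneg _ _ hQ.le]
    refine modulus_le_of_admissible ⟨hρ.const_mul _, fun γ hγ hr ↦ ?_⟩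
    rw [Curve.lineIntegral_const_mul hr hρ, h γ hγ hr, ENNReal.mul_top (by simp)]
    exact le_top
  have hlim : Tendsto (fun n : ℕ ↦ ((n : ℝ≥0∞)⁻¹) ^ Q * ∫⁻ x, ρ x ^ Q ∂μ) atTop (𝓝 0) := by
    have h1 : Tendsto (fun n : ℕ ↦ ((n : ℝ≥0∞)⁻¹) ^ Q) atTop (𝓝 0) := by
      have := (ENNReal.continuous_rpow_const (y := Q)).tendsto 0 |>.comp
        ENNReal.tendsto_inv_nat_nhds_zero
      rwa [ENNReal.zero_rpow_of_pos hQ] at this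
    have := ENNReal.Tendsto.mul_const h1 (Or.inr hfin)
    rwa [zero_mul] at this
  exact nonpos_iff_eq_zero.1 (ge_of_tendsto' hlim hle)

/-- Sum admissible functions of rapidly decreasing energy: each contributes at least one to every
line integral. -/
theorem exists_lineIntegral_eq_top (hQ : 0 < Q) {Γ : Set (Curve X)} (h : modulus Q μ Γ = 0) :
    ∃ ρ : X → ℝ≥0∞, Measurable ρ ∧ ∫⁻ x, ρ x ^ Q ∂μ ≠ ∞ ∧
      ∀ γ ∈ Γ, γ.Rectifiable → γ.lineIntegral ρ = ∞ := by
  have : ∀ n, ∃ ρ, Admissible Γ ρ ∧ ∫⁻ x, ρ x ^ Q ∂μ < threshold Q n := fun n ↦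
    exists_admissible_lt (by rw [h]; exact threshold_pos Q n)
  choose ρ hρ hi using this
  refine ⟨fun x ↦ ∑' n, ρ n x, Measurable.tsum fun n ↦ (hρ n).1, ne_top_of_le_ne_top
    ENNReal.one_ne_top (lintegral_tsum_rpow_le_one hQ (fun n ↦ (hρ n).1) fun n ↦ (hi n).le), ?_⟩
  intro γ hγ hr
  rw [Curve.lineIntegral_tsum hr fun n ↦ (hρ n).1]
  refine top_unique ?_
  calc ∞ = ∑' _ : ℕ, (1 : ℝ≥0∞) := (ENNReal.tsum_const_eq_top_of_ne_zero one_ne_zero).symm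
    _ ≤ _ := ENNReal.tsum_le_tsum fun n ↦ (hρ n).2 γ hγ hr

/-- A function with infinite integral over a subcurve has infinite integral over the curve. Hence
almost every curve has no exceptional subcurve. -/
theorem modulus_restrict_eq_zero (hQ : 0 < Q) {Γ : Set (Curve X)} (h : modulus Q μ Γ = 0) :
    modulus Q μ {γ | ∃ s t hst, γ.restrict s t hst ∈ Γ} = 0 := by
  obtain ⟨ρ, hρ, hfin, htop⟩ := exists_lineIntegral_eq_top hQ h
  refine modulus_eq_zero_of_lineIntegral_eq_top hQ hρ hfin ?_
  rintro γ ⟨s, t, hst, hγ⟩ hr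
  refine top_unique ?_
  rw [← htop _ hγ (hr.restrict hst)]
  exact Curve.lineIntegral_restrict_le hr hst ρ

/-- Countably many open sets on which `g` is integrable to the power `Q` cover the space, and
finitely many of them cover the compact trace. So an infinite integral of `g` is infinite already
for the cut-off of `g` to one of them. -/
theorem LocLp.modulus_lineIntegral_eq_top [SecondCountableTopology X] (hQ : 0 < Q)
    {g : X → ℝ≥0∞} (hg : Measurable g) (h : LocLp Q μ g) :
    modulus Q μ {γ | γ.lineIntegral g = ∞} = 0 := by
  choose U hU hfin using h
  obtain ⟨s, hs, hcov⟩ := TopologicalSpace.countable_cover_nhds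
    (f := fun x ↦ interior (U x)) fun x ↦ interior_mem_nhds.2 (hU x)
  have : Countable s := hs.to_subtype
  have hm : ∀ x, Measurable ((interior (U x)).indicator g) := fun x ↦
    hg.indicator isOpen_interior.measurableSet
  have hnull : ∀ x : s, modulus Q μ {γ | γ.lineIntegral ((interior (U x)).indicator g) = ∞} = 0 := by
    intro x
    refine modulus_eq_zero_of_lineIntegral_eq_top hQ (hm x) ?_ fun γ hγ _ ↦ hγ
    refine ne_top_of_le_ne_top (hfin x).ne ?_
    have : (fun y ↦ (interior (U (x : X))).indicator g y ^ Q) =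
        (interior (U (x : X))).indicator fun y ↦ g y ^ Q := by
      ext y
      by_cases hy : y ∈ interior (U (x : X)) <;> simp [hy, hQ]
    rw [this, lintegral_indicator isOpen_interior.measurableSet]
    exact lintegral_mono_set interior_subset
  refine nonpos_iff_eq_zero.1 ((modulus_mono ?_).trans (modulus_iUnion_eq_zero hQ hnull).le)
  intro γ hγ hr
  by_contra hcon
  simp only [mem_iUnion, mem_ofPred_eq, not_exists] at hcon hγ
  have hcomp : IsCompact γ.trace := isCompact_range γ.toMap.continuous
  obtain ⟨t, ht⟩ := hcomp.elim_finite_subcover (fun x : s ↦ interior (U (x : X)))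
    (fun _ ↦ isOpen_interior) (by
      intro y _
      have : y ∈ ⋃ x ∈ s, interior (U x) := hcov ▸ mem_univ y
      simpa using this)
  have hle : γ.lineIntegral g ≤ ∑ x ∈ t, γ.lineIntegral ((interior (U (x : X))).indicator g) := by
    calc γ.lineIntegral g
        ≤ γ.lineIntegral (fun y ↦ ∑ x ∈ t, (interior (U (x : X))).indicator g y) := by
          refine Curve.lineIntegral_mono_of_trace hr fun y hy ↦ ?_
          obtain ⟨x, hx, hyx⟩ := mem_iUnion₂.1 (ht hy)
          calc g y = (interior (U (x : X))).indicator g y := (indicator_of_mem hyx g).symm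
            _ ≤ _ := Finset.single_le_sum (f := fun x : s ↦ (interior (U (x : X))).indicator g y)
              (fun _ _ ↦ zero_le) hx
      _ = _ := by
          simp only [Curve.lineIntegral_eq]
          exact lintegral_finsetSum _ fun x _ ↦ Curve.measurable_comp_arcExt hr (hm x)
  rw [hγ, top_le_iff, ENNReal.sum_eq_top] at hle
  obtain ⟨x, -, hx⟩ := hle
  exact hcon x hx

end Modulus

/-! ### Images of sets under functions of one variable with controlled oscillation -/

section Image

/-- If the oscillation of `φ` on every compact interval is bounded by the measure of the interval,
then the measure of the image of every set is bounded by the measure of the set. -/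
theorem volume_image_le {n : Measure ℝ} [IsFiniteMeasure n] {φ : ℝ → ℝ}
    (h : ∀ s t, s ≤ t → edist (φ s) (φ t) ≤ n (Icc s t)) (E : Set ℝ) :
    volume (φ '' E) ≤ n E := by
  refine le_of_forall_gt fun c hc ↦ ?_
  obtain ⟨U, hEU, hU, hUc⟩ := E.exists_isOpen_lt_of_lt c hc
  refine lt_of_le_of_lt ((measure_mono (image_mono hEU)).trans ?_) hUc
  -- The components of `U` are countably many disjoint intervals, and the image of each has diameter
  -- at most its `n`-measure.
  set C : Set (Set ℝ) := range fun x : U ↦ connectedComponentIn U x with hC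
  have hopen : ∀ I ∈ C, IsOpen I := by
    rintro _ ⟨x, rfl⟩
    exact hU.connectedComponentIn
  have hdisj : C.PairwiseDisjoint id := by
    rintro _ ⟨x, rfl⟩ _ ⟨y, rfl⟩ hne
    refine disjoint_left.2 fun z hx hy ↦ hne ?_
    exact (connectedComponentIn_eq hx).trans (connectedComponentIn_eq hy).symm
  have hcount : C.Countable := hdisj.countable_of_isOpen hopen (by
    rintro _ ⟨x, rfl⟩
    exact ⟨x, mem_connectedComponentIn x.2⟩)
  have hCU : ∀ I ∈ C, I ⊆ U := by
    rintro _ ⟨x, rfl⟩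
    exact connectedComponentIn_subset _ _
  have hI : ∀ I ∈ C, volume (φ '' I) ≤ n I := by
    rintro _ ⟨x, rfl⟩
    refine (Real.volume_le_diam _).trans (Metric.ediam_le ?_)
    have hoc := (isPreconnected_connectedComponentIn (x := (x : ℝ)) (F := U)).ordConnected
    rintro _ ⟨s, hs, rfl⟩ _ ⟨t, ht, rfl⟩
    rcases le_total s t with hst | hst
    · exact (h s t hst).trans (measure_mono (hoc.out hs ht))
    · rw [edist_comm]
      exact (h t s hst).trans (measure_mono (hoc.out ht hs))
  calc volume (φ '' U) ≤ volume (⋃ I ∈ C, φ '' I) := by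
        refine measure_mono ?_
        rintro _ ⟨x, hx, rfl⟩
        exact mem_biUnion (mem_range_self (⟨x, hx⟩ : U)) ⟨x, mem_connectedComponentIn hx, rfl⟩
    _ ≤ ∑' I : C, volume (φ '' I) := measure_biUnion_le _ hcount _
    _ ≤ ∑' I : C, n I := ENNReal.tsum_le_tsum fun I ↦ hI I I.2
    _ = n (⋃ I ∈ C, I) := (measure_biUnion hcount hdisj fun I hI ↦ (hopen I hI).measurableSet).symm
    _ ≤ n U := measure_mono (iUnion₂_subset hCU)

theorem projIcc_eq_or_mem {a b s t : ℝ} (hab : a ≤ b) (hst : s ≤ t) :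
    (projIcc a b hab s : ℝ) = projIcc a b hab t ∨
      s ≤ projIcc a b hab s ∧ (projIcc a b hab t : ℝ) ≤ t := by
  simp only [coe_projIcc]
  grind

/-- This is `volume_image_le` for the measure with density `G` on `[a, b]`, with `φ` extended by
constants. -/
theorem volume_image_le_setLIntegral {φ : ℝ → ℝ}
    {G : ℝ → ℝ≥0∞} {a b : ℝ} (hab : a ≤ b)
    (hφ : ∀ s t, a ≤ s → s ≤ t → t ≤ b → edist (φ s) (φ t) ≤ ∫⁻ τ in Icc s t, G τ)
    (hfin : ∫⁻ τ in Icc a b, G τ ≠ ∞) {E : Set ℝ} (hE : MeasurableSet E) (hEab : E ⊆ Icc a b) :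
    volume (φ '' E) ≤ ∫⁻ τ in E, G τ := by
  set n : Measure ℝ := (volume.restrict (Icc a b)).withDensity G with hn
  have : IsFiniteMeasure n := isFiniteMeasure_withDensity hfin
  have happ : ∀ A, MeasurableSet A → n A = ∫⁻ τ in A ∩ Icc a b, G τ := fun A hA ↦ by
    rw [hn, withDensity_apply _ hA, Measure.restrict_restrict hA]
  have key := volume_image_le (n := n) (φ := fun t ↦ φ (projIcc a b hab t)) (fun s t hst ↦ by
    rw [happ _ measurableSet_Icc]
    rcases projIcc_eq_or_mem hab hst with h | ⟨h1, h2⟩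
    · rw [h, edist_self]
      exact zero_le
    · refine (hφ _ _ (projIcc a b hab s).2.1 (monotone_projIcc hab hst)
        (projIcc a b hab t).2.2).trans (lintegral_mono_set ?_)
      exact subset_inter (Icc_subset_Icc h1 h2)
        (Icc_subset_Icc (projIcc a b hab s).2.1 (projIcc a b hab t).2.2)) E
  rw [happ E hE, inter_eq_self_of_subset_left hEab] at key
  refine le_of_eq_of_le (congrArg _ (image_congr fun t ht ↦ ?_)) key
  simp only [projIcc_of_mem hab (hEab ht)]

/-- The function `φ t = dist (u a) (u t)` takes all values in `[0, φ b]`. Where `G₁ ≤ G₂` the size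
of its image is bounded with `G₁`, elsewhere with `G₂`. No differentiation along the curve is
involved. -/
theorem edist_le_lintegral_min {Z : Type*} [PseudoMetricSpace Z] {u : ℝ → Z} (hu : Continuous u)
    {G₁ G₂ : ℝ → ℝ≥0∞} (hG₁ : Measurable G₁) (hG₂ : Measurable G₂) {a b : ℝ} (hab : a ≤ b)
    (h₁ : ∀ s t, a ≤ s → s ≤ t → t ≤ b → edist (u s) (u t) ≤ ∫⁻ τ in Icc s t, G₁ τ)
    (h₂ : ∀ s t, a ≤ s → s ≤ t → t ≤ b → edist (u s) (u t) ≤ ∫⁻ τ in Icc s t, G₂ τ)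
    (hfin₁ : ∫⁻ τ in Icc a b, G₁ τ ≠ ∞) (hfin₂ : ∫⁻ τ in Icc a b, G₂ τ ≠ ∞) :
    edist (u a) (u b) ≤ ∫⁻ τ in Icc a b, min (G₁ τ) (G₂ τ) := by
  set φ : ℝ → ℝ := fun t ↦ dist (u a) (u t) with hφ
  have hlip : ∀ s t, edist (φ s) (φ t) ≤ edist (u s) (u t) := fun s t ↦ by
    rw [edist_dist, edist_dist, Real.dist_eq]
    refine ENNReal.ofReal_le_ofReal ?_
    simp only [hφ, dist_comm (u a)]
    exact abs_dist_sub_le _ _ _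
  set A : Set ℝ := {t | G₁ t ≤ G₂ t} with hA
  have hAm : MeasurableSet A := measurableSet_le hG₁ hG₂
  have hv₁ := volume_image_le_setLIntegral (φ := φ) hab
    (fun s t hs hst ht ↦ (hlip s t).trans (h₁ s t hs hst ht)) hfin₁
    (measurableSet_Icc.inter hAm) inter_subset_left
  have hv₂ := volume_image_le_setLIntegral (φ := φ) hab
    (fun s t hs hst ht ↦ (hlip s t).trans (h₂ s t hs hst ht)) hfin₂
    (measurableSet_Icc.diff hAm) sdiff_subset
  have hivt : Icc 0 (φ b) ⊆ φ '' (Icc a b) := by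
    have := intermediate_value_Icc hab (f := φ) (by fun_prop)
    rwa [show φ a = 0 from dist_self _] at this
  calc edist (u a) (u b) = volume (Icc 0 (φ b)) := by
        rw [Real.volume_Icc, sub_zero, edist_dist]
    _ ≤ volume (φ '' (Icc a b)) := measure_mono hivt
    _ ≤ volume (φ '' (Icc a b ∩ A)) + volume (φ '' (Icc a b \ A)) := by
        rw [← inter_union_sdiff (Icc a b) A, image_union]
        simp only [inter_union_sdiff]
        exact measure_union_le _ _
    _ ≤ (∫⁻ τ in Icc a b ∩ A, G₁ τ) + ∫⁻ τ in Icc a b \ A, G₂ τ := add_le_add hv₁ hv₂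
    _ = (∫⁻ τ in Icc a b ∩ A, min (G₁ τ) (G₂ τ)) + ∫⁻ τ in Icc a b \ A, min (G₁ τ) (G₂ τ) := by
        congr 1
        · exact setLIntegral_congr_fun (measurableSet_Icc.inter hAm) fun t ht ↦
            (min_eq_left ht.2).symm
        · exact setLIntegral_congr_fun (measurableSet_Icc.diff hAm) fun t ht ↦
            (min_eq_right (not_le.1 ht.2).le).symm
    _ = _ := lintegral_inter_add_sdiff _ _ hAm

end Image

/-! ### Weak upper gradients: lattice properties and the minimal one -/

section UpperGradients

variable {X Z : Type*} [MetricSpace X] [MetricSpace Z]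

/-- The upper gradient inequality holds along all subcurves of a curve. -/
def UpperGradientWithin (φ : X → Z) (g : X → ℝ≥0∞) (γ : Curve X) : Prop :=
  ∀ s t hst, UpperGradientAlong φ g (γ.restrict s t hst)

theorem UpperGradientWithin.edist_le {φ : X → Z} {g : X → ℝ≥0∞} {γ : Curve X}
    (hγ : γ.Rectifiable) (h : UpperGradientWithin φ g γ) {a b : ℝ} (ha : 0 ≤ a) (hab : a ≤ b)
    (hb : b ≤ γ.length.toReal) :
    edist (φ (γ.arcExt a)) (φ (γ.arcExt b)) ≤ ∫⁻ τ in Icc a b, g (γ.arcExt τ) := by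
  obtain ⟨s, t, hst, rfl, rfl⟩ := Curve.exists_le_variation_eq hγ ha hab hb
  rw [Curve.arcExt_variation hγ, Curve.arcExt_variation hγ, edist_comm,
    ← Curve.lineIntegral_restrict hγ hst]
  exact h s t hst

variable [MeasurableSpace X] {Q : ℝ} {μ : Measure X}

theorem LocLp.mono (hQ : 0 < Q) {g g' : X → ℝ≥0∞} (hg : LocLp Q μ g) (h : g' ≤ g) :
    LocLp Q μ g' := fun x ↦ by
  obtain ⟨U, hU, hfin⟩ := hg x
  exact ⟨U, hU, (lintegral_mono fun y ↦ ENNReal.rpow_le_rpow (h y) hQ.le).trans_lt hfin⟩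

theorem IsWeakUpperGradient.of_forall (hQ : 0 < Q) {ι : Type*} [Countable ι] {φ : X → Z}
    {g : X → ℝ≥0∞} (hg : Measurable g) {Γ : ι → Set (Curve X)} (hΓ : ∀ i, modulus Q μ (Γ i) = 0)
    (h : ∀ γ : Curve X, γ.Rectifiable → (∀ i, γ ∉ Γ i) → UpperGradientAlong φ g γ) :
    IsWeakUpperGradient Q μ φ g := by
  refine ⟨hg, nonpos_iff_eq_zero.1
    ((modulus_mono ?_).trans (modulus_iUnion_eq_zero hQ hΓ).le)⟩
  rintro γ ⟨hr, hγ⟩ -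
  by_contra hcon
  simp only [mem_iUnion, not_exists] at hcon
  exact hγ (h γ hr hcon)

variable [BorelSpace X]

theorem IsWeakUpperGradient.modulus_not_within (hQ : 0 < Q) {φ : X → Z} {g : X → ℝ≥0∞}
    (h : IsWeakUpperGradient Q μ φ g) :
    modulus Q μ {γ | γ.Rectifiable ∧ ¬ UpperGradientWithin φ g γ} = 0 := by
  refine nonpos_iff_eq_zero.1 ((modulus_mono ?_).trans (modulus_restrict_eq_zero hQ h.2).le)
  rintro γ ⟨hr, hγ⟩ -
  simp only [UpperGradientWithin, not_forall] at hγ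
  obtain ⟨s, t, hst, hγ⟩ := hγ
  exact ⟨s, t, hst, hr.restrict hst, hγ⟩

theorem IsWeakUpperGradient.modulus_exceptional [SecondCountableTopology X] (hQ : 0 < Q)
    {φ : X → Z} {g : X → ℝ≥0∞} (h : IsWeakUpperGradient Q μ φ g) (hg : LocLp Q μ g) :
    modulus Q μ {γ | γ.Rectifiable ∧ ¬ (UpperGradientWithin φ g γ ∧ γ.lineIntegral g ≠ ∞)} = 0 := by
  refine nonpos_iff_eq_zero.1 ((modulus_mono ?_).trans (modulus_union_eq_zero hQ
    (h.modulus_not_within hQ) (hg.modulus_lineIntegral_eq_top hQ h.1)).le)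
  rintro γ ⟨hr, hγ⟩ -
  by_cases hw : UpperGradientWithin φ g γ
  · exact Or.inr (not_not.1 fun hne ↦ hγ ⟨hw, hne⟩)
  · exact Or.inl ⟨hr, hw⟩

/-- Almost every curve satisfies both inequalities on all its subcurves, with finite integrals;
`edist_le_lintegral_min` then applies in the arc-length parameter. -/
theorem IsWeakUpperGradient.min [SecondCountableTopology X] (hQ : 0 < Q) {φ : X → Z}
    (hφ : Continuous φ) {g₁ g₂ : X → ℝ≥0∞} (h₁ : IsWeakUpperGradient Q μ φ g₁)
    (h₂ : IsWeakUpperGradient Q μ φ g₂) (hg₁ : LocLp Q μ g₁) (hg₂ : LocLp Q μ g₂) :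
    IsWeakUpperGradient Q μ φ fun x ↦ min (g₁ x) (g₂ x) := by
  refine IsWeakUpperGradient.of_forall hQ (h₁.1.min h₂.1)
    (Γ := fun i : Bool ↦ cond i
      {γ | γ.Rectifiable ∧ ¬ (UpperGradientWithin φ g₁ γ ∧ γ.lineIntegral g₁ ≠ ∞)}
      {γ | γ.Rectifiable ∧ ¬ (UpperGradientWithin φ g₂ γ ∧ γ.lineIntegral g₂ ≠ ∞)}) ?_ ?_
  · rintro (_ | _)
    · exact h₂.modulus_exceptional hQ hg₂
    · exact h₁.modulus_exceptional hQ hg₁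
  · intro γ hr hγ
    have hγ₁ : UpperGradientWithin φ g₁ γ ∧ γ.lineIntegral g₁ ≠ ∞ :=
      not_not.1 fun hn ↦ hγ true ⟨hr, hn⟩
    have hγ₂ : UpperGradientWithin φ g₂ γ ∧ γ.lineIntegral g₂ ≠ ∞ :=
      not_not.1 fun hn ↦ hγ false ⟨hr, hn⟩
    rw [Curve.lineIntegral_eq] at hγ₁ hγ₂
    have := edist_le_lintegral_min (hφ.comp (Curve.continuous_arcExt hr))
      (Curve.measurable_comp_arcExt hr h₁.1) (Curve.measurable_comp_arcExt hr h₂.1)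
      ENNReal.toReal_nonneg (fun s t hs hst ht ↦ hγ₁.1.edist_le hr hs hst ht)
      (fun s t hs hst ht ↦ hγ₂.1.edist_le hr hs hst ht) hγ₁.2 hγ₂.2
    rw [UpperGradientAlong, Curve.lineIntegral_eq, edist_comm]
    simp only [Function.comp_apply] at this
    rwa [← γ.variation_finish, ← γ.variation_start, Curve.arcExt_variation hr,
      Curve.arcExt_variation hr, γ.variation_finish, γ.variation_start] at this

/-- Monotone convergence for decreasing sequences holds along every curve on which `g 0` has finite
integral, that is, along almost every curve. -/
theorem IsWeakUpperGradient.iInf [SecondCountableTopology X] (hQ : 0 < Q) {φ : X → Z}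
    {g : ℕ → X → ℝ≥0∞} (hanti : Antitone g) (h : ∀ n, IsWeakUpperGradient Q μ φ (g n))
    (hg : LocLp Q μ (g 0)) : IsWeakUpperGradient Q μ φ fun x ↦ ⨅ n, g n x := by
  refine IsWeakUpperGradient.of_forall hQ (Measurable.iInf fun n ↦ (h n).1)
    (Γ := fun i : Option ℕ ↦ i.elim {γ | γ.lineIntegral (g 0) = ∞}
      fun n ↦ {γ | γ.Rectifiable ∧ ¬ UpperGradientAlong φ (g n) γ}) ?_ ?_
  · rintro (_ | n)
    · exact hg.modulus_lineIntegral_eq_top hQ (h 0).1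
    · exact (h n).2
  · intro γ hr hγ
    have hfin : γ.lineIntegral (g 0) ≠ ∞ := hγ none
    have hn : ∀ n, UpperGradientAlong φ (g n) γ := fun n ↦
      not_not.1 fun hn ↦ hγ (some n) ⟨hr, hn⟩
    simp only [UpperGradientAlong, Curve.lineIntegral_eq] at hn hfin ⊢
    rw [lintegral_iInf (fun n ↦ Curve.measurable_comp_arcExt hr (h n).1)
      (fun m n hmn t ↦ hanti hmn _) hfin]
    exact le_iInf hn

/-- Maximize `F g = ∫ (1 + g)⁻¹ dP`, where `P` is a finite measure with the same null sets as `μ`.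
Running minima of a maximizing sequence decrease to a maximizer `g`. Replacing `g` by `min g g'`
cannot increase `F`, so it changes `g` only on a null set. -/
theorem exists_isMinimalWeakUpperGradient [SecondCountableTopology X] [SFinite μ] (hQ : 0 < Q)
    {φ : X → Z} (hφ : Continuous φ) {g₀ : X → ℝ≥0∞} (h₀ : IsWeakUpperGradient Q μ φ g₀)
    (hg₀ : LocLp Q μ g₀) : ∃ g, IsMinimalWeakUpperGradient Q μ φ g := by
  set P := μ.toFinite with hP
  set F : (X → ℝ≥0∞) → ℝ≥0∞ := fun g ↦ ∫⁻ x, (1 + g x)⁻¹ ∂P with hF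
  set W : Set (X → ℝ≥0∞) := {g | IsWeakUpperGradient Q μ φ g ∧ LocLp Q μ g} with hW
  have hmin : ∀ g ∈ W, ∀ g' ∈ W, (fun x ↦ min (g x) (g' x)) ∈ W := fun g hg g' hg' ↦
    ⟨hg.1.min hQ hφ hg'.1 hg.2 hg'.2, hg.2.mono hQ fun x ↦ min_le_left _ _⟩
  have hFanti : ∀ g g' : X → ℝ≥0∞, g ≤ g' → F g' ≤ F g := fun g g' h ↦
    lintegral_mono fun x ↦ ENNReal.inv_le_inv.2 (by gcongr; exact h x)
  have hFfin : ∀ g, F g ≠ ∞ := fun g ↦ by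
    refine ne_top_of_le_ne_top (measure_ne_top P univ) ?_
    rw [← lintegral_one]
    exact lintegral_mono fun x ↦ ENNReal.inv_le_one.2 le_self_add
  obtain ⟨w, hw, hlim, hwW⟩ := exists_seq_tendsto_sSup (S := F '' W) ⟨_, g₀, ⟨h₀, hg₀⟩, rfl⟩
    (OrderTop.bddAbove _)
  choose u hu huw using hwW
  set v : ℕ → X → ℝ≥0∞ := fun n ↦ Nat.rec (u 0) (fun n v x ↦ min (v x) (u (n + 1) x)) n with hv
  have hvs : ∀ n, v (n + 1) = fun x ↦ min (v n x) (u (n + 1) x) := fun n ↦ rfl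
  have hvW : ∀ n, v n ∈ W := by
    intro n
    induction n with
    | zero => exact hu 0
    | succ n ih => exact hvs n ▸ hmin _ ih _ (hu _)
  have hanti : Antitone v := antitone_nat_of_succ_le fun n x ↦ by
    rw [hvs]
    exact min_le_left _ _
  have hvu : ∀ n, v n ≤ u n := by
    rintro (_ | n) x
    · exact le_rfl
    · rw [hvs]
      exact min_le_right _ _
  set g : X → ℝ≥0∞ := fun x ↦ ⨅ n, v n x with hg
  have hgW : g ∈ W := ⟨IsWeakUpperGradient.iInf hQ hanti (fun n ↦ (hvW n).1) (hvW 0).2,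
    (hvW 0).2.mono hQ fun x ↦ iInf_le _ 0⟩
  have hsup : sSup (F '' W) ≤ F g := le_of_tendsto' hlim fun n ↦ by
    rw [← huw n]
    exact hFanti _ _ fun x ↦ (iInf_le _ n).trans (hvu n x)
  refine ⟨g, hgW.1, hgW.2, fun g' h' hl' ↦ ?_⟩
  have hk := hmin g hgW g' ⟨h', hl'⟩
  have hae := ae_eq_of_ae_le_of_lintegral_le (μ := P) (f := fun x ↦ (1 + g x)⁻¹)
    (g := fun x ↦ (1 + min (g x) (g' x))⁻¹)
    (ae_of_all _ fun x ↦ ENNReal.inv_le_inv.2 (by gcongr; exact min_le_left _ _)) (hFfin g)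
    (measurable_const.add hk.1.1).inv.aemeasurable
    ((le_sSup (mem_image_of_mem F hk)).trans hsup)
  filter_upwards [(absolutelyContinuous_toFinite μ).ae_le hae] with x hx
  have := (ENNReal.add_right_inj ENNReal.one_ne_top).1 (inv_injective hx)
  rw [this]
  exact min_le_right _ _

end UpperGradients

/-! ### Line integrals along image curves; (I) implies (II) -/

section ImageCurves

theorem sum_lintegral_Icc_le (G : ℝ → ℝ≥0∞) {a : ℕ → ℝ} (ha : Monotone a) (n : ℕ) :
    ∑ i ∈ Finset.range n, ∫⁻ τ in Icc (a i) (a (i + 1)), G τ ≤ ∫⁻ τ in Icc (a 0) (a n), G τ := by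
  -- Half-open intervals are disjoint and carry the same integrals.
  simp only [← setLIntegral_congr (μ := volume) (f := G) Ioc_ae_eq_Icc]
  induction n with
  | zero => simp
  | succ n ih =>
    rw [Finset.sum_range_succ, ← Ioc_union_Ioc_eq_Ioc (ha n.zero_le) (ha n.le_succ),
      lintegral_union measurableSet_Ioc]
    · gcongr
    · exact Ioc_disjoint_Ioc_of_le le_rfl

variable {X Y : Type*} [MetricSpace X] [MetricSpace Y]

theorem eVariationOn_map_le {f : C(X, Y)} {g : X → ℝ≥0∞} {γ : Curve X} (hγ : γ.Rectifiable)
    (h : UpperGradientWithin f g γ) (x y : Icc γ.left γ.right) :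
    eVariationOn (γ.map f).toMap (Icc x y) ≤
      ∫⁻ τ in Icc (γ.variation x) (γ.variation y), g (γ.arcExt τ) := by
  refine iSup_le ?_
  rintro ⟨n, u : ℕ → Icc γ.left γ.right, hu, hus⟩
  calc ∑ i ∈ Finset.range n, edist ((γ.map f).toMap (u (i + 1))) ((γ.map f).toMap (u i))
      ≤ ∑ i ∈ Finset.range n,
          ∫⁻ τ in Icc (γ.variation (u i)) (γ.variation (u (i + 1))), g (γ.arcExt τ) := by
        refine Finset.sum_le_sum fun i _ ↦ ?_
        have := h _ _ (hu i.le_succ)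
        rw [UpperGradientAlong, Curve.lineIntegral_restrict hγ] at this
        exact this
    _ ≤ ∫⁻ τ in Icc (γ.variation (u 0)) (γ.variation (u n)), g (γ.arcExt τ) :=
        sum_lintegral_Icc_le (fun τ ↦ g (γ.arcExt τ))
          (fun i j hij ↦ Curve.variation_mono hγ (hu hij)) n
    _ ≤ _ := lintegral_mono_set (Icc_subset_Icc (Curve.variation_mono hγ (hus 0).1)
        (Curve.variation_mono hγ (hus n).2))

theorem Curve.Rectifiable.map {f : C(X, Y)} {g : X → ℝ≥0∞} {γ : Curve X} (hγ : γ.Rectifiable)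
    (h : UpperGradientWithin f g γ) (hfin : γ.lineIntegral g ≠ ∞) : (γ.map f).Rectifiable := by
  have := eVariationOn_map_le hγ h γ.start γ.finish
  rw [γ.variation_start, γ.variation_finish, ← Curve.lineIntegral_eq] at this
  refine ne_top_of_le_ne_top hfin (le_of_eq_of_le ?_ this)
  rw [Curve.length]
  congr 1
  ext x
  exact ⟨fun _ ↦ ⟨γ.start_le x, γ.le_finish x⟩, fun _ ↦ mem_univ _⟩

variable [MeasurableSpace X] [BorelSpace X] [MeasurableSpace Y] [BorelSpace Y]

/-- Let `φ` express the arc length of `f ∘ γ` through that of `γ`. Its increments are bounded by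
integrals of `g`, so Lebesgue measure on the parameter interval of `f ∘ γ` is at most the image
under `φ` of the measure with density `g`. This is a change of variables that needs no derivative of
`φ`. -/
theorem lineIntegral_map_le {f : C(X, Y)} {g : X → ℝ≥0∞} (hg : Measurable g) {γ : Curve X}
    (hγ : γ.Rectifiable) (h : UpperGradientWithin f g γ) (hfin : γ.lineIntegral g ≠ ∞)
    {ρ : Y → ℝ≥0∞} (hρ : Measurable ρ) :
    (γ.map f).lineIntegral ρ ≤ γ.lineIntegral fun x ↦ g x * ρ (f x) := by
  have hfγ := hγ.map h hfin
  have hL : 0 ≤ γ.length.toReal := ENNReal.toReal_nonneg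
  set V : Icc γ.left γ.right → ℝ := (γ.map f).variation with hV
  have hVmono : Monotone V := Curve.variation_mono hfγ
  have hVle : ∀ x y, x ≤ y → ENNReal.ofReal (V y - V x) ≤
      ∫⁻ τ in Icc (γ.variation x) (γ.variation y), g (γ.arcExt τ) := fun x y hxy ↦
    (Curve.variation_sub hfγ hxy).trans_le (eVariationOn_map_le hγ h x y)
  -- A section of the variation function, monotone because the variation is.
  choose σ hσ using fun τ : Icc 0 γ.length.toReal ↦ Curve.exists_variation_eq hγ τ.2
  have hσmono : Monotone σ := by
    intro τ τ' hττ
    rcases hττ.eq_or_lt with rfl | hlt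
    · exact le_rfl
    · by_contra hcon
      have := Curve.variation_mono hγ (not_le.1 hcon).le
      rw [hσ, hσ] at this
      exact absurd this (not_le.2 hlt)
  set φ : ℝ → ℝ := fun τ ↦ V (σ (projIcc _ _ hL τ)) with hφ
  have hφmono : Monotone φ := fun s t hst ↦ hVmono (hσmono (monotone_projIcc _ hst))
  have hφle : ∀ s t, 0 ≤ s → s ≤ t → t ≤ γ.length.toReal →
      edist (φ s) (φ t) ≤ ∫⁻ τ in Icc s t, g (γ.arcExt τ) := by
    intro s t hs hst ht
    rw [edist_comm, edist_dist, Real.dist_eq, abs_of_nonneg (sub_nonneg.2 (hφmono hst))]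
    refine (hVle _ _ (hσmono (monotone_projIcc _ hst))).trans_eq ?_
    rw [hσ, hσ, projIcc_of_mem _ ⟨hs, hst.trans ht⟩, projIcc_of_mem _ ⟨hs.trans hst, ht⟩]
  -- Where `γ` rests, so does `f ∘ γ`; hence `φ` does not depend on the section.
  have hVeq : ∀ x y, γ.variation x = γ.variation y → V x = V y := by
    have : ∀ x y, x ≤ y → γ.variation x = γ.variation y → V x = V y := by
      intro x y hxy hv
      refine le_antisymm (hVmono hxy) ?_
      have := hVle x y hxy
      rw [hv, Icc_self, Measure.restrict_singleton, Real.volume_singleton, zero_smul,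
        lintegral_zero_measure, nonpos_iff_eq_zero, ENNReal.ofReal_eq_zero] at this
      linarith
    intro x y hv
    rcases le_total x y with hxy | hxy
    · exact this x y hxy hv
    · exact (this y x hxy hv.symm).symm
  have hφV : ∀ x, φ (γ.variation x) = V x := fun x ↦ hVeq _ _ (by
    rw [hσ, projIcc_of_mem _ (Curve.variation_mem hγ x)])
  rw [Curve.lineIntegral_eq] at hfin
  set n : Measure ℝ := (volume.restrict (Icc 0 γ.length.toReal)).withDensity
    (fun τ ↦ g (γ.arcExt τ)) with hn
  have hle : volume.restrict (Icc 0 (γ.map f).length.toReal) ≤ n.map φ := by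
    refine Measure.le_iff.2 fun B hB ↦ ?_
    have hpre : MeasurableSet (φ ⁻¹' B) := hφmono.measurable hB
    rw [Measure.restrict_apply hB, Measure.map_apply hφmono.measurable hB,
      hn, withDensity_apply _ hpre, Measure.restrict_restrict hpre]
    refine le_trans (measure_mono ?_) (volume_image_le_setLIntegral hL hφle hfin
      (hpre.inter measurableSet_Icc) inter_subset_right)
    rintro θ ⟨hθB, hθ⟩
    obtain ⟨x, hx⟩ := Curve.exists_variation_eq hfγ hθ
    have hx' : φ (γ.variation x) = θ := (hφV x).trans hx
    exact ⟨γ.variation x, ⟨by rwa [mem_preimage, hx'], Curve.variation_mem hγ x⟩, hx'⟩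
  have harc : ∀ τ, (γ.map f).arcExt (φ τ) = f (γ.arcExt τ) := by
    intro τ
    have h1 : (γ.map f).arcExt (φ τ) = f (γ.toMap (σ (projIcc _ _ hL τ))) :=
      Curve.arcExt_variation hfγ _
    rw [h1, ← Curve.arcExt_variation hγ, hσ, Curve.arcExt, projIcc_val, Curve.arcExt]
  calc (γ.map f).lineIntegral ρ
      = ∫⁻ θ in Icc 0 (γ.map f).length.toReal, ρ ((γ.map f).arcExt θ) := Curve.lineIntegral_eq _ _
    _ ≤ ∫⁻ θ, ρ ((γ.map f).arcExt θ) ∂(n.map φ) := lintegral_mono' hle le_rfl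
    _ = ∫⁻ τ, ρ (f (γ.arcExt τ)) ∂n := by
        rw [lintegral_map (Curve.measurable_comp_arcExt hfγ hρ) hφmono.measurable]
        simp only [harc]
    _ = ∫⁻ τ in Icc 0 γ.length.toReal, g (γ.arcExt τ) * ρ (f (γ.arcExt τ)) := by
        have hρf : Measurable fun τ ↦ ρ (f (γ.arcExt τ)) :=
          Curve.measurable_comp_arcExt hγ (hρ.comp f.continuous.measurable)
        rw [hn, lintegral_withDensity_eq_lintegral_mul _ (Curve.measurable_comp_arcExt hγ hg) hρf]
        rfl
    _ = _ := (Curve.lineIntegral_eq γ fun x ↦ g x * ρ (f x)).symm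

/-- The constant must be positive: a family containing a constant curve has modulus `∞`, as does its
image, while `0 * ∞ = 0`. -/
theorem AnalyticQC.geometricQC [SecondCountableTopology X] {Q : ℝ} (hQ : 0 < Q) {μ : Measure X}
    {ν : Measure Y} {f : X ≃ₜ Y} {K : ℝ≥0} (h : AnalyticQC Q μ ν f K) :
    GeometricQC Q μ ν f (max K 1) := by
  obtain ⟨-, g, ⟨hw, hl, -⟩, hgK⟩ := h
  intro Γ
  rw [modulus.eq_1 Q ν, ENNReal.mul_iInf_of_ne (by simp [ne_of_gt]) (by simp)]
  refine le_iInf fun ρ ↦ ?_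
  rw [ENNReal.mul_iInf_of_ne (by simp [ne_of_gt]) (by simp)]
  refine le_iInf fun hρ ↦ ?_
  set N : Set (Curve X) := {γ | γ.Rectifiable ∧
    ¬ (UpperGradientWithin f g γ ∧ γ.lineIntegral g ≠ ∞)} with hN
  have hN0 : modulus Q μ N = 0 := hw.modulus_exceptional hQ hl
  have hfm : Measurable f := f.continuous.measurable
  have hadm : Admissible (Γ \ N) fun x ↦ g x * ρ (f x) := by
    refine ⟨hw.1.mul (hρ.1.comp hfm), fun γ hγ hr ↦ ?_⟩
    have hgood : UpperGradientWithin f g γ ∧ γ.lineIntegral g ≠ ∞ :=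
      not_not.1 fun hn ↦ hγ.2 ⟨hr, hn⟩
    exact (hρ.2 _ (mem_image_of_mem _ hγ.1) (hr.map (f := (f : C(X, Y))) hgood.1 hgood.2)).trans
      (lineIntegral_map_le (f := (f : C(X, Y))) hw.1 hr hgood.1 hgood.2 hρ.1)
  calc modulus Q μ Γ ≤ modulus Q μ ((Γ \ N) ∪ N) := modulus_mono fun γ hγ _ ↦ by
        by_cases hγN : γ ∈ N
        · exact Or.inr hγN
        · exact Or.inl ⟨hγ, hγN⟩
    _ ≤ modulus Q μ (Γ \ N) + modulus Q μ N := modulus_union_le _ _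
    _ ≤ ∫⁻ x, (g x * ρ (f x)) ^ Q ∂μ := by
        rw [hN0, add_zero]
        exact modulus_le_of_admissible hadm
    _ ≤ ∫⁻ x, K * (volumeDerivative μ ν f x * ρ (f x) ^ Q) ∂μ := by
        refine lintegral_mono_ae ?_
        filter_upwards [hgK] with x hx
        rw [ENNReal.mul_rpow_of_nonneg _ _ hQ.le, ← mul_assoc]
        gcongr
    _ = K * ∫⁻ x, ρ (f x) ^ Q ∂(μ.withDensity (volumeDerivative μ ν f)) := by
        have hJ : Measurable (volumeDerivative μ ν f) := Measure.measurable_rnDeriv _ _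
        have hρf : Measurable fun x ↦ ρ (f x) ^ Q := (hρ.1.comp hfm).pow_const Q
        have hmul : Measurable fun x ↦ volumeDerivative μ ν f x * ρ (f x) ^ Q := hJ.mul hρf
        rw [lintegral_const_mul _ hmul, lintegral_withDensity_eq_lintegral_mul _ hJ hρf]
        rfl
    _ ≤ K * ∫⁻ x, ρ (f x) ^ Q ∂(ν.map f.symm) := by
        gcongr
        exact Measure.withDensity_rnDeriv_le _ _
    _ = K * ∫⁻ y, ρ y ^ Q ∂ν := by
        have hρf : Measurable fun x ↦ ρ (f x) ^ Q := (hρ.1.comp hfm).pow_const Q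
        rw [lintegral_map hρf f.symm.continuous.measurable]
        simp
    _ ≤ _ := by
        gcongr
        exact le_max_left _ _

end ImageCurves

/-! ### Curves crossing a ring -/

section Crossing

/-- Stop at the point nearest to `t₁` where the level `m = min (H t₂) c` is reached. The level lies
strictly above `b` because the outer set of a condenser is the complement of a closed ball. -/
theorem exists_crossing {H : ℝ → ℝ} (hH : Continuous H) {a b c t₁ t₂ : ℝ} (hab : a ≤ b)
    (hbc : b < c) (h₁ : H t₁ ≤ a) (h₂ : b < H t₂) :
    ∃ t ∈ uIcc t₁ t₂, b < H t ∧ ∀ τ ∈ uIcc t₁ t, H τ ≤ c := by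
  set m := min (H t₂) c with hm
  have hbm : b < m := lt_min h₂ hbc
  have hT : IsCompact (uIcc t₁ t₂ ∩ {t | m ≤ H t}) :=
    isCompact_uIcc.inter_right (isClosed_le continuous_const hH)
  obtain ⟨t, ⟨htu, htm⟩, hmin⟩ := hT.exists_isMinOn ⟨t₂, right_mem_uIcc, min_le_left (H t₂) c⟩
    (f := fun t ↦ |t - t₁|) (by fun_prop)
  have hclose : ∀ τ ∈ uIcc t₁ t, m ≤ H τ → τ = t := by
    intro τ hτ hmτ
    have h : |t - t₁| ≤ |τ - t₁| := hmin ⟨uIcc_subset_uIcc_left htu hτ, hmτ⟩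
    rcases le_total t₁ t with htt | htt
    · rw [uIcc_of_le htt] at hτ
      rw [abs_of_nonneg (by linarith), abs_of_nonneg (by linarith [hτ.1])] at h
      linarith [hτ.2]
    · rw [uIcc_of_ge htt] at hτ
      rw [abs_of_nonpos (by linarith), abs_of_nonpos (by linarith [hτ.2])] at h
      linarith [hτ.1]
  have hHt : H t = m := by
    obtain ⟨τ, hτ, hτm⟩ : m ∈ H '' uIcc t₁ t := intermediate_value_uIcc hH.continuousOn
      (Icc_subset_uIcc ⟨h₁.trans (hab.trans hbm.le), htm⟩)
    rw [← hclose τ hτ hτm.ge, hτm]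
  refine ⟨t, htu, hHt ▸ hbm, fun τ hτ ↦ ?_⟩
  by_contra hcon
  have hmτ : m ≤ H τ := (min_le_right _ _).trans (not_le.1 hcon).le
  rw [hclose τ hτ hmτ, hHt] at hcon
  exact hcon (min_le_right _ _)

variable {X : Type*} [MetricSpace X]

theorem Curve.exists_restrict_crossing {h : X → ℝ} (hh : Continuous h) {a b c : ℝ} (hab : a ≤ b)
    (hbc : b < c) (γ : Curve X) (h₁ : ∃ x ∈ γ.trace, h x ≤ a) (h₂ : ∃ x ∈ γ.trace, b < h x) :
    ∃ s t hst, (∀ x ∈ (γ.restrict s t hst).trace, h x ≤ c) ∧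
      (∃ x ∈ (γ.restrict s t hst).trace, h x ≤ a) ∧
      (∃ x ∈ (γ.restrict s t hst).trace, b < h x) := by
  obtain ⟨_, ⟨t₁, rfl⟩, h₁⟩ := h₁
  obtain ⟨_, ⟨t₂, rfl⟩, h₂⟩ := h₂
  set H : ℝ → ℝ := fun t ↦ h (γ.toMap (projIcc _ _ γ.left_le_right t)) with hH
  have hHc : Continuous H := hh.comp (γ.toMap.continuous.comp continuous_projIcc)
  have hHt : ∀ t : Icc γ.left γ.right, H t = h (γ.toMap t) := fun t ↦ by
    simp only [hH, projIcc_val]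
  obtain ⟨t, ht, hbt, hle⟩ := exists_crossing hHc hab hbc ((hHt t₁).trans_le h₁)
    (h₂.trans_eq (hHt t₂).symm)
  have htm : t ∈ Icc γ.left γ.right := (uIcc_subset_Icc t₁.2 t₂.2) ht
  lift t to Icc γ.left γ.right using htm
  rw [hHt] at hbt
  refine ⟨min t₁ t, max t₁ t, min_le_max, ?_, ⟨_, ⟨⟨t₁, ?_⟩, rfl⟩, h₁⟩, ⟨_, ⟨⟨t, ?_⟩, rfl⟩, hbt⟩⟩
  · rintro _ ⟨x, rfl⟩
    rw [Curve.restrict_toMap, ← hHt]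
    refine hle _ ?_
    have hmin : ((min t₁ t : Icc γ.left γ.right) : ℝ) = min (t₁ : ℝ) t :=
      (Subtype.mono_coe _).map_min
    have hmax : ((max t₁ t : Icc γ.left γ.right) : ℝ) = max (t₁ : ℝ) t :=
      (Subtype.mono_coe _).map_max
    exact ⟨hmin.ge.trans x.2.1, le_trans x.2.2 hmax.le⟩
  · exact ⟨min_le_left t₁ t, le_max_left t₁ t⟩
  · exact ⟨min_le_right t₁ t, le_max_right t₁ t⟩

theorem Curve.edist_le_length {γ : Curve X} {x y : X} (hx : x ∈ γ.trace) (hy : y ∈ γ.trace) :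
    edist x y ≤ γ.length := by
  obtain ⟨s, rfl⟩ := hx
  obtain ⟨t, rfl⟩ := hy
  exact eVariationOn.edist_le _ (mem_univ _) (mem_univ _)

theorem Curve.lineIntegral_const_of_trace {γ : Curve X} (hγ : γ.Rectifiable) {S : Set X}
    (hS : γ.trace ⊆ S) (c : ℝ≥0∞) :
    c * γ.length ≤ γ.lineIntegral (S.indicator fun _ ↦ c) := by
  calc c * γ.length = γ.lineIntegral fun _ ↦ c := by
        rw [Curve.lineIntegral, lintegral_const, Measure.restrict_apply_univ, Real.volume_Icc,
          sub_zero, ENNReal.ofReal_toReal hγ]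
    _ ≤ _ := Curve.lineIntegral_mono_of_trace hγ fun x hx ↦ (indicator_of_mem (hS hx) fun _ ↦ c).ge

variable [MeasurableSpace X] [BorelSpace X]

/-- The test function is `1 / (b - a)` on the ball of radius `c`. Some subcurve stays in that ball
and has length at least `b - a`. -/
theorem modulus_annularCondenser_le {Q : ℝ} (hQ : 0 < Q) {μ : Measure X} (x : X) {a b c : ℝ}
    (hab : a < b) (hbc : b < c) :
    modulus Q μ (annularCondenser x a b) ≤
      (ENNReal.ofReal (b - a))⁻¹ ^ Q * μ (Metric.closedBall x c) := by
  have hball : MeasurableSet (Metric.closedBall x c) := Metric.isClosed_closedBall.measurableSet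
  set k := (ENNReal.ofReal (b - a))⁻¹ with hk
  have hadm : Admissible (annularCondenser x a b)
      ((Metric.closedBall x c).indicator fun _ ↦ k) := by
    refine ⟨measurable_const.indicator hball, ?_⟩
    rintro γ ⟨⟨y, hy, hya⟩, ⟨z, hz, hzb⟩⟩ hr
    obtain ⟨s, t, hst, hc, ⟨y, hy, hya⟩, ⟨z, hz, hzb⟩⟩ := γ.exists_restrict_crossing
      (h := fun z ↦ dist z x) (by fun_prop) hab.le hbc ⟨y, hy, hya⟩
      ⟨z, hz, by simpa using hzb⟩
    refine le_trans ?_ (Curve.lineIntegral_restrict_le hr hst _)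
    refine le_trans ?_ (Curve.lineIntegral_const_of_trace (hr.restrict hst) hc k)
    calc 1 = k * ENNReal.ofReal (b - a) := (ENNReal.inv_mul_cancel
          (ENNReal.ofReal_pos.2 (sub_pos.2 hab)).ne' ENNReal.ofReal_ne_top).symm
      _ ≤ k * edist y z := by
          rw [edist_dist]
          gcongr
          have := dist_triangle_left z x y
          linarith
      _ ≤ _ := by
          gcongr
          exact Curve.edist_le_length hy hz
  refine (modulus_le_of_admissible hadm).trans_eq ?_
  rw [← lintegral_indicator_const hball]
  congr 1
  ext y
  by_cases hy : y ∈ Metric.closedBall x c <;> simp [hy, hQ]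

end Crossing

/-! ### Doubling measures; (II) implies (III) -/

section Doubling

variable {X Y : Type*} [MetricSpace X] [MeasurableSpace X] [MetricSpace Y] [MeasurableSpace Y]
  {ν : Measure Y} {C : ℝ≥0}

theorem Doubling.closedBall_two_pow_le (h : Doubling ν C) (y : Y) {r : ℝ} (hr : 0 < r) (n : ℕ) :
    ν (Metric.closedBall y (2 ^ n * r)) ≤ C ^ n * ν (Metric.closedBall y r) := by
  induction n with
  | zero => simp
  | succ n ih =>
    calc ν (Metric.closedBall y (2 ^ (n + 1) * r))
        = ν (Metric.closedBall y (2 * (2 ^ n * r))) := by ring_nf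
      _ ≤ C * ν (Metric.closedBall y (2 ^ n * r)) := h y _ (by positivity)
      _ ≤ C * (C ^ n * ν (Metric.closedBall y r)) := by gcongr
      _ = _ := by rw [pow_succ', mul_assoc]

theorem Doubling.measure_closedBall_lt_top [IsLocallyFiniteMeasure ν] (h : Doubling ν C) (y : Y)
    (r : ℝ) : ν (Metric.closedBall y r) < ∞ := by
  obtain ⟨U, hU, hfin⟩ := ν.finiteAt_nhds y
  obtain ⟨ε, hε, hεU⟩ := Metric.nhds_basis_closedBall.mem_iff.1 hU
  obtain ⟨n, hn⟩ := pow_unbounded_of_one_lt (r / ε) (one_lt_two)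
  calc ν (Metric.closedBall y r) ≤ ν (Metric.closedBall y (2 ^ n * ε)) :=
        measure_mono (Metric.closedBall_subset_closedBall ((div_lt_iff₀ hε).1 hn).le)
    _ ≤ C ^ n * ν (Metric.closedBall y ε) := h.closedBall_two_pow_le y hε n
    _ < ∞ := ENNReal.mul_lt_top (by simp) ((measure_mono hεU).trans_lt hfin)

variable [BorelSpace Y]

/-- The bound holds for every `r > 0`, not only along a sequence. The test function lives on
`B_{2λr}`, which lies in `B_{2 ^ n r}`; this costs `C ^ n`. -/
theorem GeometricQC.annularQC {Q : ℝ} (hQ : 0 < Q) {μ : Measure X} {f : X ≃ₜ Y} {K K' : ℝ≥0}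
    {lam : ℝ} (hlam : 1 < lam) {n : ℕ} (hn : 2 * lam ≤ 2 ^ n)
    (hK' : K * ((ENNReal.ofReal (lam - 1))⁻¹ ^ Q * C ^ n) ≤ K') (hν : Doubling ν C)
    (h : GeometricQC Q μ ν f K) : AnnularQC Q μ ν f lam K' := by
  intro y
  refine liminf_le_of_frequently_le' (Eventually.frequently ?_)
  filter_upwards [self_mem_nhdsWithin] with r (hr : 0 < r)
  refine ENNReal.div_le_of_le_mul ?_
  have himg : imageFamily f (preimageFamily f (annularCondenser y r (lam * r))) ⊆
      annularCondenser y r (lam * r) := image_preimage_subset _ _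
  have hr0 : ENNReal.ofReal r ≠ 0 := (ENNReal.ofReal_pos.2 hr).ne'
  calc ENNReal.ofReal r ^ Q * modulus Q μ (preimageFamily f (annularCondenser y r (lam * r)))
      ≤ ENNReal.ofReal r ^ Q * (K * modulus Q ν (annularCondenser y r (lam * r))) := by
        gcongr
        exact (h _).trans (by gcongr; exact modulus_mono fun γ hγ _ ↦ himg hγ)
    _ ≤ ENNReal.ofReal r ^ Q * (K * ((ENNReal.ofReal (lam * r - r))⁻¹ ^ Q *
          ν (Metric.closedBall y (2 ^ n * r)))) := by
        gcongr
        refine (modulus_annularCondenser_le hQ y (c := 2 * lam * r) (by nlinarith)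
          (by nlinarith)).trans ?_
        gcongr
    _ ≤ ENNReal.ofReal r ^ Q * (K * ((ENNReal.ofReal (lam - 1) * ENNReal.ofReal r)⁻¹ ^ Q *
          (C ^ n * ν (Metric.closedBall y r)))) := by
        rw [← ENNReal.ofReal_mul (by linarith), sub_one_mul]
        gcongr
        exact hν.closedBall_two_pow_le y hr n
    _ = (ENNReal.ofReal r ^ Q * (ENNReal.ofReal r)⁻¹ ^ Q) *
          (K * ((ENNReal.ofReal (lam - 1))⁻¹ ^ Q * C ^ n)) * ν (Metric.closedBall y r) := by
        rw [ENNReal.mul_inv (Or.inr ENNReal.ofReal_ne_top) (Or.inr hr0),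
          ENNReal.mul_rpow_of_nonneg _ _ hQ.le]
        ring
    _ ≤ K' * ν (Metric.closedBall y r) := by
        rw [← ENNReal.mul_rpow_of_nonneg _ _ hQ.le, ENNReal.mul_inv_cancel hr0
          ENNReal.ofReal_ne_top, ENNReal.one_rpow, one_mul]
        gcongr

end Doubling

/-! ### Uniform convexity and convergent convex combinations -/

section Convexity

/-- Nothing is needed where `(1 - t) ^ Q ≤ δ`. The set where `(1 - t) ^ Q ≥ δ` is compact and avoids
`t = 1`, so the convexity deficit `D` has a positive minimum there, and `C` is its inverse. -/
theorem exists_uniform_convexity_unit {Q : ℝ} (hQ : 1 < Q) {δ : ℝ} (hδ : 0 < δ) :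
    ∃ C : ℝ, 0 ≤ C ∧ ∀ t ∈ Icc (0 : ℝ) 1,
      (1 - t) ^ Q + C * ((1 + t) / 2) ^ Q ≤ δ * (1 + t ^ Q) + C * ((1 + t ^ Q) / 2) := by
  have hQ0 : 0 < Q := by linarith
  set D : ℝ → ℝ := fun t ↦ (1 + t ^ Q) / 2 - ((1 + t) / 2) ^ Q with hD
  have hpow : Continuous fun t : ℝ ↦ t ^ Q := Real.continuous_rpow_const hQ0.le
  have hDc : Continuous D :=
    ((continuous_const.add hpow).div_const 2).sub
      (hpow.comp ((continuous_const.add continuous_id).div_const 2))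
  have hDnn : ∀ t ∈ Icc (0 : ℝ) 1, 0 ≤ D t := by
    intro t ht
    have := (convexOn_rpow hQ.le).2 (mem_Ici.2 zero_le_one) (mem_Ici.2 ht.1)
      (one_half_pos (α := ℝ)).le one_half_pos.le (add_halves 1)
    simp only [smul_eq_mul, Real.one_rpow] at this
    rw [show (1 / 2 * 1 + 1 / 2 * t : ℝ) = (1 + t) / 2 by ring] at this
    simp only [hD]
    linarith
  have hDpos : ∀ t ∈ Icc (0 : ℝ) 1, t ≠ 1 → 0 < D t := by
    intro t ht hne
    have := (strictConvexOn_rpow hQ).2 (mem_Ici.2 zero_le_one) (mem_Ici.2 ht.1) hne.symm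
      (one_half_pos (α := ℝ)) one_half_pos (add_halves 1)
    simp only [smul_eq_mul, Real.one_rpow] at this
    rw [show (1 / 2 * 1 + 1 / 2 * t : ℝ) = (1 + t) / 2 by ring] at this
    simp only [hD]
    linarith
  have hS : IsCompact (Icc (0 : ℝ) 1 ∩ {t | δ ≤ (1 - t) ^ Q}) :=
    isCompact_Icc.inter_right (isClosed_le continuous_const
      (hpow.comp (continuous_const.sub continuous_id)))
  obtain ⟨C, hC, hCS⟩ : ∃ C : ℝ, 0 ≤ C ∧ ∀ t ∈ Icc (0 : ℝ) 1, δ ≤ (1 - t) ^ Q → 1 ≤ C * D t := by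
    rcases (Icc (0 : ℝ) 1 ∩ {t | δ ≤ (1 - t) ^ Q}).eq_empty_or_nonempty with he | hne
    · exact ⟨0, le_rfl, fun t ht htδ ↦ absurd (he ▸ ⟨ht, htδ⟩ : t ∈ (∅ : Set ℝ)) (by simp)⟩
    · obtain ⟨t₀, ⟨ht₀, ht₀δ⟩, hmin⟩ := hS.exists_isMinOn hne hDc.continuousOn
      have hpos : 0 < D t₀ := hDpos t₀ ht₀ (by
        rintro rfl
        have : δ ≤ (1 - 1 : ℝ) ^ Q := ht₀δ
        rw [sub_self, Real.zero_rpow hQ0.ne'] at this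
        linarith)
      refine ⟨(D t₀)⁻¹, by positivity, fun t ht htδ ↦ ?_⟩
      rw [inv_mul_eq_div, one_le_div hpos]
      exact hmin ⟨ht, htδ⟩
  refine ⟨C, hC, fun t ht ↦ ?_⟩
  have h1 : C * ((1 + t ^ Q) / 2) = C * D t + C * ((1 + t) / 2) ^ Q := by
    simp only [hD]
    ring
  have ht0 : 0 ≤ t ^ Q := Real.rpow_nonneg ht.1 _
  rw [h1, ← add_assoc]
  gcongr
  rcases le_total δ ((1 - t) ^ Q) with h | h
  · have h2 : (1 - t) ^ Q ≤ 1 :=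
      Real.rpow_le_one (by linarith [ht.2]) (by linarith [ht.1]) hQ0.le
    have := hCS t ht h
    have : 0 ≤ δ * (1 + t ^ Q) := by positivity
    linarith
  · have : 0 ≤ C * D t := mul_nonneg hC (hDnn t ht)
    nlinarith

/-- The distance of two extended nonnegative numbers, in the form `(a - b) + (b - a)`. -/
def gap (a b : ℝ≥0∞) : ℝ≥0∞ := (a - b) + (b - a)

theorem gap_comm (a b : ℝ≥0∞) : gap a b = gap b a := add_comm _ _

theorem le_add_gap (a b : ℝ≥0∞) : a ≤ b + gap a b :=
  le_add_tsub.trans (add_le_add_right le_self_add _)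

/-- By homogeneity, division by the larger number reduces to the unit interval; an infinite value is
absorbed by the term with `δ > 0`. -/
theorem exists_uniform_convexity {Q : ℝ} (hQ : 1 < Q) {δ : ℝ≥0} (hδ : 0 < δ) :
    ∃ C : ℝ≥0, ∀ a b : ℝ≥0∞, gap a b ^ Q + C * (2⁻¹ * a + 2⁻¹ * b) ^ Q ≤
      δ * (a ^ Q + b ^ Q) + C * (2⁻¹ * (a ^ Q + b ^ Q)) := by
  have hQ0 : 0 < Q := by linarith
  obtain ⟨C, hC, h⟩ := exists_uniform_convexity_unit hQ (NNReal.coe_pos.2 hδ)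
  lift C to ℝ≥0 using hC
  refine ⟨C, ?_⟩
  have key : ∀ a b : ℝ≥0∞, a ≤ b → gap a b ^ Q + C * (2⁻¹ * a + 2⁻¹ * b) ^ Q ≤
      δ * (a ^ Q + b ^ Q) + C * (2⁻¹ * (a ^ Q + b ^ Q)) := by
    intro a b hab
    rcases eq_or_ne b ∞ with rfl | hb
    · have hδ' : (δ : ℝ≥0∞) ≠ 0 := by exact_mod_cast hδ.ne'
      rw [ENNReal.top_rpow_of_pos hQ0, add_top, ENNReal.mul_top hδ', top_add]
      exact le_top
    rcases eq_or_ne b 0 with rfl | hb0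
    · have : a = 0 := nonpos_iff_eq_zero.1 hab
      subst this
      simp [gap, hQ0]
    lift b to ℝ≥0 using hb
    lift a to ℝ≥0 using ne_top_of_le_ne_top ENNReal.coe_ne_top hab
    have hab' : a ≤ b := by exact_mod_cast hab
    have hb0' : b ≠ 0 := by exact_mod_cast hb0
    have hbpos : (0 : ℝ) < b := by exact_mod_cast pos_iff_ne_zero.2 hb0'
    have h2 : (2⁻¹ : ℝ≥0∞) = ((2⁻¹ : ℝ≥0) : ℝ≥0∞) := by simp
    have hgap : gap (a : ℝ≥0∞) b = ((b - a : ℝ≥0) : ℝ≥0∞) := by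
      rw [gap, tsub_eq_zero_of_le hab, zero_add, ENNReal.coe_sub]
    rw [hgap, h2]
    simp only [← ENNReal.coe_mul, ← ENNReal.coe_add, ← ENNReal.coe_rpow_of_nonneg _ hQ0.le]
    rw [ENNReal.coe_le_coe, ← NNReal.coe_le_coe]
    push_cast [NNReal.coe_sub hab']
    have hab'' : (a : ℝ) ≤ b := by exact_mod_cast hab'
    set t : ℝ := a / b with ht
    have hta : (a : ℝ) = b * t := by rw [ht, mul_div_cancel₀ _ hbpos.ne']
    have ht0 : 0 ≤ t := by positivity
    have ht1 : t ≤ 1 := (div_le_one hbpos).2 hab''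
    have hbQ : 0 < (b : ℝ) ^ Q := Real.rpow_pos_of_pos hbpos _
    have e1 : ((b : ℝ) - a) ^ Q = b ^ Q * (1 - t) ^ Q := by
      rw [hta, ← Real.mul_rpow hbpos.le (by linarith)]
      ring_nf
    have e2 : (2⁻¹ * (a : ℝ) + 2⁻¹ * b) ^ Q = b ^ Q * ((1 + t) / 2) ^ Q := by
      rw [hta, ← Real.mul_rpow hbpos.le (by positivity)]
      ring_nf
    have e3 : (a : ℝ) ^ Q = b ^ Q * t ^ Q := by rw [hta, Real.mul_rpow hbpos.le ht0]
    rw [e1, e2, e3]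
    have := mul_le_mul_of_nonneg_left (h t ⟨ht0, ht1⟩) hbQ.le
    linarith
  intro a b
  rcases le_total a b with hab | hab
  · exact key a b hab
  · rw [gap_comm, add_comm (2⁻¹ * a), add_comm (a ^ Q)]
    exact key b a hab

variable {X : Type*}

/-- Finite convex combinations of the functions `ρ n`, `ρ (n + 1)`, ... -/
def tailHull (ρ : ℕ → X → ℝ≥0∞) (n : ℕ) : Set (X → ℝ≥0∞) := convexHull ℝ≥0 (ρ '' Ici n)

theorem tailHull_anti (ρ : ℕ → X → ℝ≥0∞) : Antitone (tailHull ρ) := fun _ _ hmn ↦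
  convexHull_mono (image_mono (Ici_subset_Ici.2 hmn))

theorem mem_tailHull (ρ : ℕ → X → ℝ≥0∞) (n : ℕ) : ρ n ∈ tailHull ρ n :=
  subset_convexHull _ _ ⟨n, self_mem_Ici, rfl⟩

theorem midpoint_mem_tailHull {ρ : ℕ → X → ℝ≥0∞} {n : ℕ} {h h' : X → ℝ≥0∞}
    (hh : h ∈ tailHull ρ n) (hh' : h' ∈ tailHull ρ n) :
    (fun x ↦ 2⁻¹ * h x + 2⁻¹ * h' x) ∈ tailHull ρ n := by
  have := (convex_convexHull ℝ≥0 (ρ '' Ici n)) hh hh' (a := 2⁻¹) (b := 2⁻¹) (by positivity)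
    (by positivity) (by rw [← two_mul, mul_inv_cancel₀ two_ne_zero])
  refine (congrArg (· ∈ convexHull ℝ≥0 (ρ '' Ici n)) (funext fun x ↦ ?_)).mpr this
  simp only [Pi.add_apply, Pi.smul_apply, ENNReal.smul_def, smul_eq_mul]
  simp

theorem tailHull_subset {ρ : ℕ → X → ℝ≥0∞} {n : ℕ} {S : Set (X → ℝ≥0∞)}
    (hS : ∀ h ∈ S, ∀ h' ∈ S, ∀ a b : ℝ≥0, a + b = 1 → (fun x ↦ a * h x + b * h' x) ∈ S)
    (hρ : ∀ k, n ≤ k → ρ k ∈ S) : tailHull ρ n ⊆ S := by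
  refine convexHull_min (image_subset_iff.2 fun k hk ↦ hρ k hk) ?_
  intro h hh h' hh' a b _ _ hab
  exact hS h hh h' hh' a b hab

variable [MeasurableSpace X] {Q : ℝ}

theorem measurable_of_mem_tailHull {ρ : ℕ → X → ℝ≥0∞} (hρ : ∀ n, Measurable (ρ n)) {n : ℕ}
    {h : X → ℝ≥0∞} (hh : h ∈ tailHull ρ n) : Measurable h :=
  tailHull_subset (S := {h | Measurable h})
    (fun _ hh _ hh' _ _ _ ↦ (Measurable.const_mul hh _).add (Measurable.const_mul hh' _))
    (fun k _ ↦ hρ k) hh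

theorem lintegral_rpow_le_of_mem_tailHull (hQ : 1 ≤ Q) {μ : Measure X} {ρ : ℕ → X → ℝ≥0∞}
    (hρ : ∀ n, Measurable (ρ n)) {n : ℕ} {M : ℝ≥0∞} (hM : ∀ k, n ≤ k → ∫⁻ x, ρ k x ^ Q ∂μ ≤ M)
    {h : X → ℝ≥0∞} (hh : h ∈ tailHull ρ n) : ∫⁻ x, h x ^ Q ∂μ ≤ M := by
  refine (tailHull_subset (S := {h | Measurable h ∧ ∫⁻ x, h x ^ Q ∂μ ≤ M}) ?_
    (fun k hk ↦ ⟨hρ k, hM k hk⟩) hh).2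
  rintro h ⟨hm, hh⟩ h' ⟨hm', hh'⟩ a b hab
  refine ⟨(Measurable.const_mul hm _).add (Measurable.const_mul hm' _), ?_⟩
  have hab' : (a : ℝ≥0∞) + b = 1 := by exact_mod_cast hab
  calc ∫⁻ x, (a * h x + b * h' x) ^ Q ∂μ ≤ ∫⁻ x, a * h x ^ Q + b * h' x ^ Q ∂μ :=
        lintegral_mono fun x ↦ ENNReal.rpow_arith_mean_le_arith_mean2_rpow _ _ _ _ hab' hQ
    _ = a * ∫⁻ x, h x ^ Q ∂μ + b * ∫⁻ x, h' x ^ Q ∂μ := by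
        rw [lintegral_add_left ((hm.pow_const Q).const_mul _), lintegral_const_mul _
          (hm.pow_const Q), lintegral_const_mul _ (hm'.pow_const Q)]
    _ ≤ a * M + b * M := by gcongr
    _ = M := by rw [← add_mul, hab', one_mul]

/-- The least energies `m n` over the tail hulls increase to some `s ≤ M`. The midpoint of two
functions in a hull has energy at least `m n`, so two functions with energy close to `s` must be
close to each other by uniform convexity. This takes the place of weak compactness and Mazur's
lemma. -/
theorem exists_tailHull_gap_le (hQ : 1 < Q) {P : Measure X} {ρ : ℕ → X → ℝ≥0∞}
    (hρ : ∀ n, Measurable (ρ n)) {M : ℝ≥0∞} (hMtop : M ≠ ∞) (hM : ∀ n, ∫⁻ x, ρ n x ^ Q ∂P ≤ M)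
    (τ : ℕ → ℝ≥0∞) (hτ : ∀ n, 0 < τ n) :
    ∃ h : ℕ → X → ℝ≥0∞, (∀ n, h n ∈ tailHull ρ n) ∧
      ∀ n, ∫⁻ x, gap (h n x) (h (n + 1) x) ^ Q ∂P ≤ τ n := by
  set I : (X → ℝ≥0∞) → ℝ≥0∞ := fun h ↦ ∫⁻ x, h x ^ Q ∂P with hI
  set m : ℕ → ℝ≥0∞ := fun n ↦ ⨅ h ∈ tailHull ρ n, I h with hm
  have hmM : ∀ n, m n ≤ M := fun n ↦ (iInf₂_le _ (mem_tailHull ρ n)).trans (hM n)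
  set s : ℝ≥0∞ := ⨆ n, m n with hs
  have hsM : s ≤ M := iSup_le hmM
  have hsfin : s ≠ ∞ := ne_top_of_le_ne_top hMtop hsM
  have hnear : ∀ η, 0 < η → ∃ N, s ≤ m N + η := by
    intro η hη
    by_contra! hcon
    have : s + η ≤ s := by
      rw [hs, ENNReal.iSup_add]
      exact iSup_le fun n ↦ (hcon n).le
    exact (ENNReal.lt_add_right hsfin hη.ne').not_ge this
  have step : ∀ t, 0 < t → ∃ η, 0 < η ∧ ∃ N, ∀ h ∈ tailHull ρ N, ∀ h' ∈ tailHull ρ N,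
      I h ≤ s + η → I h' ≤ s + η → ∫⁻ x, gap (h x) (h' x) ^ Q ∂P ≤ t := by
    intro t ht
    have ht2 : t / 2 ≠ 0 := (ENNReal.half_pos ht.ne').ne'
    -- Both energies are at most `M + 1`, which determines `δ`. The loss `η` enters twice, from the
    -- energies exceeding `s` and from `m N` falling short of it, hence the factor `C * 2` below.
    obtain ⟨δ, hδ, hδt⟩ := ENNReal.exists_nnreal_pos_mul_lt (a := 2 * (M + 1)) (b := t / 2)
      (ENNReal.mul_ne_top (by simp) (by simp [hMtop])) ht2
    obtain ⟨C, hC⟩ := exists_uniform_convexity hQ hδ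
    obtain ⟨η₀, hη₀, hη₀t⟩ := ENNReal.exists_nnreal_pos_mul_lt (a := C * 2) (b := t / 2)
      (ENNReal.mul_ne_top (by simp) (by simp)) ht2
    set η : ℝ≥0∞ := min η₀ 1 with hη
    have hηpos : 0 < η := lt_min (by exact_mod_cast hη₀) one_pos
    obtain ⟨N, hN⟩ := hnear η hηpos
    refine ⟨η, hηpos, N, fun h hh h' hh' hIh hIh' ↦ ?_⟩
    have hhm := measurable_of_mem_tailHull hρ hh
    have hhm' := measurable_of_mem_tailHull hρ hh'
    have hgm : Measurable fun x ↦ gap (h x) (h' x) ^ Q :=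
      ((hhm.sub hhm').add (hhm'.sub hhm)).pow_const Q
    have hmid : m N ≤ ∫⁻ x, (2⁻¹ * h x + 2⁻¹ * h' x) ^ Q ∂P :=
      iInf₂_le _ (midpoint_mem_tailHull hh hh')
    have hCm : C * m N ≠ ∞ :=
      ENNReal.mul_ne_top ENNReal.coe_ne_top (ne_top_of_le_ne_top hMtop (hmM N))
    have hsum : I h + I h' ≤ 2 * (s + η) := by
      rw [two_mul]
      exact add_le_add hIh hIh'
    have hle : ∫⁻ x, gap (h x) (h' x) ^ Q ∂P + C * m N ≤ t + C * m N := by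
      calc ∫⁻ x, gap (h x) (h' x) ^ Q ∂P + C * m N
          ≤ ∫⁻ x, gap (h x) (h' x) ^ Q ∂P + C * ∫⁻ x, (2⁻¹ * h x + 2⁻¹ * h' x) ^ Q ∂P := by
            gcongr
        _ = ∫⁻ x, gap (h x) (h' x) ^ Q + C * (2⁻¹ * h x + 2⁻¹ * h' x) ^ Q ∂P := by
            have hmid : Measurable fun x ↦ (2⁻¹ * h x + 2⁻¹ * h' x) ^ Q :=
              ((hhm.const_mul _).add (hhm'.const_mul _)).pow_const Q
            rw [lintegral_add_left hgm, lintegral_const_mul _ hmid]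
        _ ≤ ∫⁻ x, δ * (h x ^ Q + h' x ^ Q) + C * (2⁻¹ * (h x ^ Q + h' x ^ Q)) ∂P :=
            lintegral_mono fun x ↦ hC _ _
        _ = δ * (I h + I h') + C * (2⁻¹ * (I h + I h')) := by
            have hadd : Measurable fun x ↦ h x ^ Q + h' x ^ Q :=
              (hhm.pow_const Q).add (hhm'.pow_const Q)
            rw [lintegral_add_left (hadd.const_mul _), lintegral_const_mul _ hadd,
              lintegral_const_mul _ (hadd.const_mul _), lintegral_const_mul _ hadd,
              lintegral_add_left (hhm.pow_const Q)]
        _ ≤ δ * (2 * (s + η)) + C * (2⁻¹ * (2 * (s + η))) := by gcongr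
        _ ≤ δ * (2 * (M + 1)) + C * (m N + η + η) := by
            rw [← mul_assoc 2⁻¹, ENNReal.inv_mul_cancel two_ne_zero ENNReal.ofNat_ne_top, one_mul]
            gcongr
            exact min_le_right _ _
        _ ≤ t / 2 + (C * m N + η₀ * (C * 2)) := by
            refine add_le_add hδt.le ?_
            rw [add_assoc, mul_add, ← two_mul, mul_left_comm (η₀ : ℝ≥0∞), mul_comm 2 η]
            gcongr
            exact min_le_left _ _
        _ ≤ t / 2 + (C * m N + t / 2) := by gcongr
        _ = t + C * m N := by rw [add_left_comm, ENNReal.add_halves, add_comm]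
    exact (ENNReal.add_le_add_iff_right hCm).1 hle
  choose η hη N hN using fun n ↦ step (τ n) (hτ n)
  -- Running minima, and below running maxima of `N`, so that `h (n + 1)` also meets the
  -- requirements of stage `n`.
  set η' : ℕ → ℝ≥0∞ := fun n ↦ (Finset.range (n + 1)).inf η with hη'
  have hη'pos : ∀ n, 0 < η' n := fun n ↦ (Finset.lt_inf_iff (by simp)).2 fun i _ ↦ hη i
  have hη'le : ∀ i n, i ≤ n → η' n ≤ η i := fun i n hin ↦
    Finset.inf_le (Finset.mem_range.2 (Nat.lt_succ_of_le hin))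
  set N' : ℕ → ℕ := fun n ↦ max n ((Finset.range (n + 1)).sup N) with hN'
  have hN'le : ∀ i n, i ≤ n → N i ≤ N' n := fun i n hin ↦
    le_max_of_le_right (Finset.le_sup (Finset.mem_range.2 (Nat.lt_succ_of_le hin)))
  have hex : ∀ n, ∃ h ∈ tailHull ρ (N' n), I h ≤ s + η' n := by
    intro n
    have : m (N' n) < s + η' n :=
      (le_iSup m _).trans_lt (ENNReal.lt_add_right hsfin (hη'pos n).ne')
    obtain ⟨h, hh, hlt⟩ := by simpa only [hm, iInf_lt_iff, exists_prop] using this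
    exact ⟨h, hh, hlt.le⟩
  choose h hh hIh using hex
  refine ⟨h, fun n ↦ tailHull_anti ρ (le_max_left _ _) (hh n), fun n ↦ hN n _ ?_ _ ?_ ?_ ?_⟩
  · exact tailHull_anti ρ (hN'le n n le_rfl) (hh n)
  · exact tailHull_anti ρ (hN'le n _ n.le_succ) (hh _)
  · exact (hIh n).trans (by gcongr; exact hη'le n n le_rfl)
  · exact (hIh _).trans (by gcongr; exact hη'le n _ n.le_succ)

end Convexity

/-! ### Limits along almost every curve -/

section Limit

variable {X : Type*}

/-- Telescoping, in a form that remains valid for infinite values. -/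
theorem le_liminf_add_tsum_gap (h : ℕ → ℝ≥0∞) (k : ℕ) :
    h k ≤ liminf h atTop + ∑' j, gap (h (j + k)) (h (j + k + 1)) := by
  have hfin : ∀ j, h k ≤ h (j + k) + ∑ i ∈ Finset.range j, gap (h (i + k)) (h (i + k + 1)) := by
    intro j
    induction j with
    | zero => simp
    | succ j ih =>
      rw [Finset.sum_range_succ]
      calc h k ≤ h (j + k) + ∑ i ∈ Finset.range j, gap (h (i + k)) (h (i + k + 1)) := ih
        _ ≤ h (j + k + 1) + gap (h (j + k)) (h (j + k + 1)) +
            ∑ i ∈ Finset.range j, gap (h (i + k)) (h (i + k + 1)) := by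
          gcongr
          exact le_add_gap _ _
        _ = _ := by rw [add_assoc, add_comm (gap _ _), show j + 1 + k = j + k + 1 by ring]
  rw [← tsub_le_iff_right]
  refine le_liminf_of_le (by isBoundedDefault) ?_
  filter_upwards [eventually_ge_atTop k] with n hn
  obtain ⟨j, rfl⟩ := Nat.exists_eq_add_of_le' hn
  rw [tsub_le_iff_right]
  exact (hfin j).trans (by gcongr; exact ENNReal.sum_le_tsum _)

variable [MetricSpace X] [MeasurableSpace X] [BorelSpace X] {Q : ℝ}

theorem le_lineIntegral_of_mem_tailHull {γ : Curve X} (hγ : γ.Rectifiable) {ρ : ℕ → X → ℝ≥0∞}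
    (hρ : ∀ n, Measurable (ρ n)) {n : ℕ} {c : ℝ≥0∞} (hc : ∀ k, n ≤ k → c ≤ γ.lineIntegral (ρ k))
    {h : X → ℝ≥0∞} (hh : h ∈ tailHull ρ n) : c ≤ γ.lineIntegral h := by
  refine (tailHull_subset (S := {h | Measurable h ∧ c ≤ γ.lineIntegral h}) ?_
    (fun k hk ↦ ⟨hρ k, hc k hk⟩) hh).2
  rintro h ⟨hm, hh⟩ h' ⟨hm', hh'⟩ a b hab
  refine ⟨(Measurable.const_mul hm _).add (Measurable.const_mul hm' _), ?_⟩
  have hab' : (a : ℝ≥0∞) + b = 1 := by exact_mod_cast hab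
  rw [Curve.lineIntegral_add hγ (hm.const_mul _), Curve.lineIntegral_const_mul hγ hm,
    Curve.lineIntegral_const_mul hγ hm']
  calc c = a * c + b * c := by rw [← add_mul, hab', one_mul]
    _ ≤ _ := by gcongr

/-- A bounded sequence in `L^Q` has a limit `g` along convex combinations which inherits upper
bounds for `L^Q`-norms, and lower bounds for integrals along most curves. -/
theorem exists_limit_of_bounded (hQ : 1 < Q) {P : Measure X} {ρ : ℕ → X → ℝ≥0∞}
    (hρ : ∀ n, Measurable (ρ n)) {M : ℝ≥0∞} (hMtop : M ≠ ∞)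
    (hM : ∀ n, ∫⁻ x, ρ n x ^ Q ∂P ≤ M) :
    ∃ g ψ : X → ℝ≥0∞, Measurable g ∧ Measurable ψ ∧ ∫⁻ x, ψ x ^ Q ∂P ≤ 1 ∧
      (∀ (μ : Measure X) (N : ℝ≥0∞) (k : ℕ), (∀ n, k ≤ n → ∫⁻ x, ρ n x ^ Q ∂μ ≤ N) →
        ∫⁻ x, g x ^ Q ∂μ ≤ N) ∧
      ∀ γ : Curve X, γ.Rectifiable → γ.lineIntegral ψ ≠ ∞ → ∀ (c : ℝ≥0∞) (k : ℕ),
        (∀ n, k ≤ n → c ≤ γ.lineIntegral (ρ n)) → c ≤ γ.lineIntegral g := by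
  have hQ0 : 0 < Q := by linarith
  obtain ⟨h, hh, hgap⟩ := exists_tailHull_gap_le hQ hρ hMtop hM (threshold Q) (threshold_pos Q)
  have hhm : ∀ n, Measurable (h n) := fun n ↦ measurable_of_mem_tailHull hρ (hh n)
  have hgm : ∀ n, Measurable fun x ↦ gap (h n x) (h (n + 1) x) := fun n ↦
    ((hhm n).sub (hhm _)).add ((hhm _).sub (hhm n))
  -- The limit is a pointwise lower limit, defined everywhere. Fatou's lemma therefore applies to
  -- every measure `μ`, not only to `P`, and line integrals of the limit make sense.
  refine ⟨fun x ↦ liminf (fun n ↦ h n x) atTop, fun x ↦ ∑' n, gap (h n x) (h (n + 1) x),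
    Measurable.liminf hhm, Measurable.tsum hgm, lintegral_tsum_rpow_le_one hQ0 hgm hgap,
    fun μ N k hN ↦ ?_, fun γ hγ hψ c k hc ↦ ?_⟩
  · have hpow : ∀ x, liminf (fun n ↦ h n x) atTop ^ Q = liminf (fun n ↦ h n x ^ Q) atTop :=
      fun x ↦ (ENNReal.orderIsoRpow Q hQ0).liminf_apply (u := fun n ↦ h n x)
        (by isBoundedDefault) (by isBoundedDefault) (by isBoundedDefault) (by isBoundedDefault)
    simp only [hpow]
    refine (lintegral_liminf_le fun n ↦ (hhm n).pow_const Q).trans ?_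
    refine liminf_le_of_frequently_le' (Eventually.frequently ?_)
    filter_upwards [eventually_ge_atTop k] with n hn
    exact lintegral_rpow_le_of_mem_tailHull hQ.le hρ (fun m hm ↦ hN m (hn.trans hm)) (hh n)
  · rw [Curve.lineIntegral_tsum hγ hgm] at hψ
    -- Along `γ` the tails of the series of gaps tend to zero, so the error in passing from `h n` to
    -- the limit vanishes.
    have hlim := (ENNReal.tendsto_sum_nat_add _ hψ).const_add
      (γ.lineIntegral fun x ↦ liminf (fun n ↦ h n x) atTop)
    rw [add_zero] at hlim
    refine ge_of_tendsto hlim ?_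
    filter_upwards [eventually_ge_atTop k] with n hn
    calc c ≤ γ.lineIntegral (h n) :=
          le_lineIntegral_of_mem_tailHull hγ hρ (fun m hm ↦ hc m (hn.trans hm)) (hh n)
      _ ≤ γ.lineIntegral fun x ↦ liminf (fun n ↦ h n x) atTop +
            ∑' j, gap (h (j + n) x) (h (j + n + 1) x) :=
          Curve.lineIntegral_mono _ fun x ↦ le_liminf_add_tsum_gap (fun n ↦ h n x) n
      _ = _ := by
          rw [Curve.lineIntegral_add hγ (Measurable.liminf hhm),
            Curve.lineIntegral_tsum hγ fun j ↦ hgm (j + n)]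

end Limit

/-! ### Discrete upper gradients from the annular condition -/

section Discretization

theorem Doubling.measure_ne_top_of_isBounded {Y : Type*} [MetricSpace Y] [MeasurableSpace Y]
    {ν : Measure Y} {C : ℝ≥0} [IsLocallyFiniteMeasure ν] (h : Doubling ν C) (y : Y) {A : Set Y}
    (hA : Bornology.IsBounded A) : ν A ≠ ∞ := by
  obtain ⟨R, hR⟩ := hA.subset_closedBall y
  exact ((measure_mono hR).trans_lt (h.measure_closedBall_lt_top y R)).ne

variable {X Y : Type*} [MetricSpace X] [MeasurableSpace X] [MetricSpace Y] {Q : ℝ}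
  {μ : Measure X} {f : X ≃ₜ Y} {C K' : ℝ≥0} {lam : ℝ}

/-- The bound `K' + 1` leaves room for the strict inequality that picks a radius and a test
function; this requires `ν (B_r)` to be positive and finite. -/
theorem AnnularQC.exists_admissible [MeasurableSpace Y] {ν : Measure Y}
    [IsLocallyFiniteMeasure ν] [ν.IsOpenPosMeasure] (hQ : 0 < Q) (hν : Doubling ν C) (h : AnnularQC Q μ ν f lam K') {ε : ℝ} (hε : 0 < ε) (y : Y) :
    ∃ r, 0 < r ∧ r < ε ∧ ∃ ρ : X → ℝ≥0∞,
      Admissible (preimageFamily f (annularCondenser y r (lam * r))) ρ ∧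
      ENNReal.ofReal r ^ Q * ∫⁻ x, ρ x ^ Q ∂μ ≤ (K' + 1) * ν (Metric.closedBall y r) := by
  have hlt : (K' : ℝ≥0∞) < K' + 1 := ENNReal.lt_add_right ENNReal.coe_ne_top one_ne_zero
  obtain ⟨r, hr, hr0, hrε⟩ := ((frequently_lt_of_liminf_lt (by isBoundedDefault)
    ((h y).trans_lt hlt)).and_eventually (Ioo_mem_nhdsGT hε)).exists
  have hν0 : ν (Metric.closedBall y r) ≠ 0 := (Metric.measure_closedBall_pos ν y hr0).ne'
  have hνt : ν (Metric.closedBall y r) ≠ ∞ := (hν.measure_closedBall_lt_top y r).ne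
  have hrQ0 : ENNReal.ofReal r ^ Q ≠ 0 :=
    (ENNReal.rpow_pos (ENNReal.ofReal_pos.2 hr0) ENNReal.ofReal_ne_top).ne'
  have hrQt : ENNReal.ofReal r ^ Q ≠ ∞ := ENNReal.rpow_ne_top_of_nonneg hQ.le ENNReal.ofReal_ne_top
  rw [ENNReal.div_lt_iff (Or.inl hν0) (Or.inl hνt), mul_comm,
    ← ENNReal.lt_div_iff_mul_lt (Or.inl hrQ0) (Or.inl hrQt)] at hr
  obtain ⟨ρ, hρ, hlt⟩ := exists_admissible_lt hr
  rw [ENNReal.lt_div_iff_mul_lt (Or.inl hrQ0) (Or.inl hrQt), mul_comm] at hlt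
  exact ⟨r, hr0, hrε, ρ, hρ, hlt.le⟩

variable [BorelSpace X]

/-- Cutting `ρ` off to the preimage of `B_{2λr}` costs nothing: the curve has a subcurve that
crosses the condenser inside that set. -/
theorem lineIntegral_indicator_ge {γ : Curve X} (hγ : γ.Rectifiable) (hlam : 1 < lam) {y : Y}
    {r : ℝ} (hr : 0 < r) {ρ : X → ℝ≥0∞}
    (hρ : Admissible (preimageFamily f (annularCondenser y r (lam * r))) ρ)
    (h₁ : ∃ x ∈ γ.trace, dist (f x) y ≤ r) (h₂ : ∃ x ∈ γ.trace, lam * r < dist (f x) y) :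
    ENNReal.ofReal r ≤ γ.lineIntegral ((f ⁻¹' Metric.closedBall y (2 * lam * r)).indicator
      fun x ↦ ENNReal.ofReal r * ρ x) := by
  have hh : Continuous fun x ↦ dist (f x) y := f.continuous.dist continuous_const
  obtain ⟨s, t, hst, hc, ⟨x₁, ⟨t₁, ht₁⟩, hx₁⟩, ⟨x₂, ⟨t₂, ht₂⟩, hx₂⟩⟩ :=
    γ.exists_restrict_crossing hh (a := r) (b := lam * r) (c := 2 * lam * r)
      (by nlinarith) (by nlinarith) h₁ h₂
  have hmem : γ.restrict s t hst ∈ preimageFamily f (annularCondenser y r (lam * r)) :=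
    ⟨⟨f x₁, ⟨t₁, congrArg f ht₁⟩, hx₁⟩, ⟨f x₂, ⟨t₂, congrArg f ht₂⟩, by simpa using hx₂⟩⟩
  calc ENNReal.ofReal r = ENNReal.ofReal r * 1 := (mul_one _).symm
    _ ≤ ENNReal.ofReal r * (γ.restrict s t hst).lineIntegral ρ := by
        gcongr
        exact hρ.2 _ hmem (hγ.restrict hst)
    _ = (γ.restrict s t hst).lineIntegral fun x ↦ ENNReal.ofReal r * ρ x :=
        (Curve.lineIntegral_const_mul (hγ.restrict hst) hρ.1 _).symm
    _ ≤ (γ.restrict s t hst).lineIntegral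
          ((f ⁻¹' Metric.closedBall y (2 * lam * r)).indicator
            fun x ↦ ENNReal.ofReal r * ρ x) :=
        Curve.lineIntegral_mono_of_trace (hγ.restrict hst) fun x hx ↦
          (indicator_of_mem (show x ∈ f ⁻¹' Metric.closedBall y (2 * lam * r) from hc x hx)
            fun x ↦ ENNReal.ofReal r * ρ x).ge
    _ ≤ _ := Curve.lineIntegral_restrict_le hγ hst _

variable [MeasurableSpace Y] {ν : Measure Y}

variable [BorelSpace Y]

/-- A discrete upper gradient of `f` at scale `ε`. -/
theorem AnnularQC.exists_discrete_upperGradient [SecondCountableTopology Y]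
    [IsLocallyFiniteMeasure ν] [ν.IsOpenPosMeasure] (hQ : 0 < Q) (hlam : 1 < lam)
    (hν : Doubling ν C) (h : AnnularQC Q μ ν f lam K') {ε : ℝ} (hε : 0 < ε) :
    ∃ ρ : X → ℝ≥0∞, Measurable ρ ∧
      (∀ F : Set Y, MeasurableSet F → ∫⁻ x in f ⁻¹' F, ρ x ^ Q ∂μ ≤
        (K' + 1) * C ^ 3 * ν (Metric.cthickening (3 * lam * ε) F)) ∧
      ∀ γ : Curve X, γ.Rectifiable →
        4 * lam * ε < dist (f (γ.toMap γ.finish)) (f (γ.toMap γ.start)) →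
        edist (f (γ.toMap γ.finish)) (f (γ.toMap γ.start)) ≤
          ENNReal.ofReal (20 * lam) * γ.lineIntegral ρ := by
  choose r hr hrε ρ hρ hρr using fun y ↦ h.exists_admissible hQ hν hε y
  -- Disjoint balls of radius `r / 5`, whose fivefold enlargements cover `Y`.
  obtain ⟨u, -, hdisj, hcov⟩ := Vitali.exists_disjoint_subfamily_covering_enlargement_closedBall
    (univ : Set Y) id (fun y ↦ r y / 5) ε (fun y _ ↦ by linarith [hr y, hrε y]) 5 (by norm_num)
  have hcov' : ∀ y, ∃ b ∈ u, dist y b ≤ r b := fun y ↦ by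
    obtain ⟨b, hb, hsub⟩ := hcov y (mem_univ y)
    have := hsub (Metric.mem_closedBall_self (by linarith [hr y]))
    rw [Metric.mem_closedBall] at this
    exact ⟨b, hb, this.trans_eq (by ring)⟩
  have hucount : u.Countable :=
    (hdisj.mono fun y ↦ Metric.ball_subset_closedBall).countable_of_isOpen
      (fun y _ ↦ Metric.isOpen_ball) fun y _ ↦ ⟨y, Metric.mem_ball_self (by linarith [hr y])⟩
  have : Countable u := hucount.to_subtype
  set σ : u → X → ℝ≥0∞ := fun i ↦
    (f ⁻¹' Metric.closedBall (i : Y) (2 * lam * r i)).indicator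
      fun x ↦ ENNReal.ofReal (r i) * ρ i x with hσ
  have hpre : ∀ y R, MeasurableSet (f ⁻¹' Metric.closedBall y R) := fun y R ↦
    f.continuous.measurable Metric.isClosed_closedBall.measurableSet
  have hσm : ∀ i, Measurable (σ i) := fun i ↦ ((hρ i).1.const_mul _).indicator (hpre _ _)
  refine ⟨fun x ↦ ⨆ i, σ i x, Measurable.iSup hσm, fun F hF ↦ ?_, fun γ hγ hD ↦ ?_⟩
  · set T := Metric.cthickening (3 * lam * ε) F with hT
    have hball : ∀ i : u, MeasurableSet (Metric.closedBall (i : Y) (r i / 5)) := fun i ↦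
      Metric.isClosed_closedBall.measurableSet
    have hTm : MeasurableSet T := Metric.isClosed_cthickening.measurableSet
    have hterm : ∀ i : u, ∫⁻ x in f ⁻¹' F, σ i x ^ Q ∂μ ≤
        (K' + 1) * C ^ 3 * ν (Metric.closedBall (i : Y) (r i / 5) ∩ T) := by
      intro i
      by_cases hne : (Metric.closedBall (i : Y) (2 * lam * r i) ∩ F).Nonempty
      · obtain ⟨w, hw, hwF⟩ := hne
        -- If the support of `σ i` meets `f⁻¹(F)`, every point of the small ball is within `r_i / 5
        -- + 2λ r_i < 3λε` of `F`.
        have hsub : Metric.closedBall (i : Y) (r i / 5) ⊆ T := fun z hz ↦ by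
          refine Metric.mem_cthickening_of_dist_le z w _ F hwF ?_
          have h1 := dist_triangle_right z w i
          have h2 : dist z i ≤ r i / 5 := hz
          have h3 : dist w i ≤ 2 * lam * r i := hw
          nlinarith [hr i, hrε i]
        rw [inter_eq_self_of_subset_left hsub]
        calc ∫⁻ x in f ⁻¹' F, σ i x ^ Q ∂μ ≤ ∫⁻ x, σ i x ^ Q ∂μ := setLIntegral_le_lintegral _ _
          _ ≤ ∫⁻ x, ENNReal.ofReal (r i) ^ Q * ρ i x ^ Q ∂μ := by
              refine lintegral_mono fun x ↦ ?_
              rw [← ENNReal.mul_rpow_of_nonneg _ _ hQ.le]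
              exact ENNReal.rpow_le_rpow (indicator_le_self _ _ x) hQ.le
          _ = ENNReal.ofReal (r i) ^ Q * ∫⁻ x, ρ i x ^ Q ∂μ :=
              lintegral_const_mul _ ((hρ i).1.pow_const Q)
          _ ≤ (K' + 1) * ν (Metric.closedBall (i : Y) (r i)) := hρr i
          -- Three doublings suffice because `5 ≤ 2 ^ 3`.
          _ ≤ (K' + 1) * (C ^ 3 * ν (Metric.closedBall (i : Y) (r i / 5))) := by
              gcongr
              refine le_trans (measure_mono (Metric.closedBall_subset_closedBall ?_))
                (hν.closedBall_two_pow_le (i : Y) (by linarith [hr i] : 0 < r i / 5) 3)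
              linarith [hr i]
          _ = _ := (mul_assoc _ _ _).symm
      · have hzero : ∀ x ∈ f ⁻¹' F, σ i x ^ Q = 0 := fun x hx ↦ by
          have : x ∉ f ⁻¹' Metric.closedBall (i : Y) (2 * lam * r i) := fun hx' ↦
            hne ⟨f x, hx', hx⟩
          simp only [hσ, indicator_of_notMem this, ENNReal.zero_rpow_of_pos hQ]
        rw [setLIntegral_congr_fun (f.continuous.measurable hF) hzero, lintegral_zero]
        exact zero_le
    calc ∫⁻ x in f ⁻¹' F, (⨆ i, σ i x) ^ Q ∂μ ≤ ∫⁻ x in f ⁻¹' F, ∑' i, σ i x ^ Q ∂μ :=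
          lintegral_mono fun x ↦ iSup_rpow_le_tsum hQ _
      _ = ∑' i, ∫⁻ x in f ⁻¹' F, σ i x ^ Q ∂μ :=
          lintegral_tsum fun i ↦ ((hσm i).pow_const Q).aemeasurable
      _ ≤ ∑' i : u, (K' + 1) * C ^ 3 * ν (Metric.closedBall (i : Y) (r i / 5) ∩ T) :=
          ENNReal.tsum_le_tsum hterm
      _ = (K' + 1) * C ^ 3 * ν (⋃ i : u, Metric.closedBall (i : Y) (r i / 5) ∩ T) := by
          rw [ENNReal.tsum_mul_left, measure_iUnion]
          · exact fun i j hij ↦ (hdisj i.2 j.2 (Subtype.coe_injective.ne hij)).mono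
              inter_subset_left inter_subset_left
          · exact fun i ↦ (hball i).inter hTm
      _ ≤ _ := by
          gcongr
          exact iUnion_subset fun i ↦ inter_subset_right
  · set p := f (γ.toMap γ.start) with hp
    set q := f (γ.toMap γ.finish) with hq
    -- From the balls `B_{r_i}` that the image curve meets, select those whose enlargements
    -- `B_{2λr_i}` are disjoint. The supports of the corresponding `σ i` are then disjoint.
    set S : Set u := {i | ∃ x ∈ γ.trace, dist (f x) i ≤ r i} with hS
    obtain ⟨v, hvS, hvdisj, hvcov⟩ :=
      Vitali.exists_disjoint_subfamily_covering_enlargement_closedBall S (fun i : u ↦ (i : Y))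
        (fun i ↦ 2 * lam * r i) (2 * lam * ε)
        (fun i _ ↦ mul_le_mul_of_nonneg_left (hrε i).le (by linarith)) 5 (by norm_num)
    -- A curve that stays in `B_{λr_i}` has endpoints at distance at most `2λε`, which `hD`
    -- excludes.
    have hcross : ∀ i : v, ENNReal.ofReal (r (i : u)) ≤ γ.lineIntegral (σ i) := by
      intro i
      refine lineIntegral_indicator_ge hγ hlam (hr _) (hρ _) (hvS i.2) ?_
      by_contra! hcon
      have h1 := hcon _ ⟨γ.start, rfl⟩
      have h2 := hcon _ ⟨γ.finish, rfl⟩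
      have h3 := dist_triangle_right q p (i : u)
      nlinarith [hr (i : u), hrε (i : u)]
    -- The distance from `p` takes every value in `[0, dist q p]` along the image curve. The
    -- selected balls enlarged by `5` have radius `10λ r_i`, so they cover this interval by
    -- intervals of length `20λ r_i`.
    have hcovD : Icc 0 (dist q p) ⊆ ⋃ i : v,
        Icc (dist ((i : u) : Y) p - 10 * lam * r (i : u))
          (dist ((i : u) : Y) p + 10 * lam * r (i : u)) := by
      intro s hs
      have : Fact (γ.left ≤ γ.right) := ⟨γ.left_le_right⟩
      have hc : Continuous fun t ↦ dist (f (γ.toMap t)) p := by fun_prop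
      obtain ⟨t, ht⟩ : ∃ t, dist (f (γ.toMap t)) p = s :=
        mem_range_of_exists_le_of_exists_ge hc
          ⟨γ.start, (dist_self p).trans_le hs.1⟩ ⟨γ.finish, hs.2⟩
      obtain ⟨b, hb, hbr⟩ := hcov' (f (γ.toMap t))
      obtain ⟨i, hi, hsub⟩ := hvcov ⟨b, hb⟩ ⟨γ.toMap t, ⟨t, rfl⟩, hbr⟩
      have h1 : dist (f (γ.toMap t)) (i : Y) ≤ 5 * (2 * lam * r i) :=
        hsub (hbr.trans (by nlinarith [hr b]))
      have h2 := abs_le.1 (abs_dist_sub_le (f (γ.toMap t)) (i : Y) p)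
      refine mem_iUnion.2 ⟨⟨i, hi⟩, ?_⟩
      constructor <;> simp only [← ht] <;> linarith [h2.1, h2.2]
    have hsum : ∀ x, ∑' i : v, σ i x ≤ ⨆ i, σ i x := by
      intro x
      by_cases hx : ∃ i : v, x ∈ f ⁻¹' Metric.closedBall ((i : u) : Y) (2 * lam * r (i : u))
      · obtain ⟨i, hi⟩ := hx
        rw [tsum_eq_single i]
        · exact le_iSup (fun i ↦ σ i x) (i : u)
        · intro j hj
          refine indicator_of_notMem (fun hxj ↦ ?_) _
          exact disjoint_left.1 (hvdisj j.2 i.2 (Subtype.coe_injective.ne hj)) hxj hi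
      · have : ∀ i : v, σ i x = 0 := fun i ↦ indicator_of_notMem (fun hi ↦ hx ⟨i, hi⟩) _
        simp [this]
    calc edist q p = volume (Icc 0 (dist q p)) := by rw [Real.volume_Icc, sub_zero, edist_dist]
      _ ≤ ∑' i : v, volume (Icc (dist ((i : u) : Y) p - 10 * lam * r (i : u))
          (dist ((i : u) : Y) p + 10 * lam * r (i : u))) :=
          (measure_mono hcovD).trans (measure_iUnion_le _)
      _ = ∑' i : v, ENNReal.ofReal (20 * lam) * ENNReal.ofReal (r (i : u)) := by
          congr 1
          ext i
          rw [Real.volume_Icc, ← ENNReal.ofReal_mul (by linarith)]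
          ring_nf
      _ ≤ ENNReal.ofReal (20 * lam) * ∑' i : v, γ.lineIntegral (σ i) := by
          rw [ENNReal.tsum_mul_left]
          gcongr with i
          exact hcross i
      _ = ENNReal.ofReal (20 * lam) * γ.lineIntegral fun x ↦ ∑' i : v, σ i x := by
          rw [Curve.lineIntegral_tsum hγ fun i : v ↦ hσm i]
      _ ≤ _ := by
          gcongr
          exact Curve.lineIntegral_mono _ hsum

end Discretization

/-! ### Comparison of measures and densities -/

section RadonNikodym

/-- The singular part of `κ` lives on a `μ`-null set, which can be removed from `A` without changing
the left-hand side. -/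
theorem le_mul_rnDeriv_of_withDensity_le {X : Type*} [MeasurableSpace X] {μ κ : Measure X}
    [SigmaFinite μ] [SFinite κ] {G : X → ℝ≥0∞} (hG : Measurable G) {c : ℝ≥0∞}
    (h : ∀ A, MeasurableSet A → ∫⁻ x in A, G x ∂μ ≤ c * κ A) :
    ∀ᵐ x ∂μ, G x ≤ c * κ.rnDeriv μ x := by
  refine ae_le_of_forall_setLIntegral_le_of_sigmaFinite hG fun A hA _ ↦ ?_
  obtain ⟨N, hN, hN0, hμN⟩ := Measure.mutuallySingular_singularPart κ μ
  calc ∫⁻ x in A, G x ∂μ = ∫⁻ x in A ∩ N, G x ∂μ := by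
        rw [← lintegral_inter_add_sdiff G A hN,
          setLIntegral_measure_zero (A \ N) G (measure_mono_null (fun x hx ↦ hx.2) hμN), add_zero]
    _ ≤ c * κ (A ∩ N) := h _ (hA.inter hN)
    _ = c * ∫⁻ x in A ∩ N, κ.rnDeriv μ x ∂μ := by
        conv_lhs => rw [κ.haveLebesgueDecomposition_add μ]
        rw [Measure.add_apply, measure_mono_null inter_subset_right hN0, zero_add,
          withDensity_apply _ (hA.inter hN)]
    _ ≤ c * ∫⁻ x in A, κ.rnDeriv μ x ∂μ := by
        gcongr
        exact inter_subset_left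
    _ = _ := (lintegral_const_mul _ (Measure.measurable_rnDeriv _ _)).symm

/-- Finite Borel measures on metric spaces are inner regular for closed sets; exhaust `A` by balls.
-/
theorem measure_le_of_isClosed {Y : Type*} [MetricSpace Y] [MeasurableSpace Y] [BorelSpace Y]
    {m ν : Measure Y} {c : ℝ≥0∞} (y : Y)
    (hfin : ∀ R, m (Metric.closedBall y R) ≠ ∞)
    (h : ∀ F, IsClosed F → Bornology.IsBounded F → m F ≤ c * ν F) {A : Set Y}
    (hA : MeasurableSet A) : m A ≤ c * ν A := by
  have hball : ∀ n : ℕ, MeasurableSet (Metric.closedBall y n) := fun n ↦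
    Metric.isClosed_closedBall.measurableSet
  have hn : ∀ n : ℕ, m (A ∩ Metric.closedBall y n) ≤ c * ν A := by
    intro n
    have : IsFiniteMeasure (m.restrict (Metric.closedBall y n)) :=
      ⟨by rw [Measure.restrict_apply_univ]; exact (hfin n).lt_top⟩
    have hmeas := hA.inter (hball n)
    have hAr : m (A ∩ Metric.closedBall y n) =
        m.restrict (Metric.closedBall y n) (A ∩ Metric.closedBall y n) := by
      rw [Measure.restrict_apply hmeas, inter_assoc, inter_self]
    rw [hAr, hmeas.measure_eq_iSup_isClosed_of_ne_top (measure_ne_top _ _)]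
    refine iSup₂_le fun F hF ↦ iSup_le fun hFc ↦ ?_
    calc m.restrict (Metric.closedBall y n) F ≤ m F := Measure.restrict_apply_le _ _
      _ ≤ c * ν F := h F hFc (Metric.isBounded_closedBall.subset (hF.trans inter_subset_right))
      _ ≤ c * ν A := by
          gcongr
          exact hF.trans inter_subset_left
  have hU : A = ⋃ n : ℕ, A ∩ Metric.closedBall y n := by
    rw [← inter_iUnion, Metric.iUnion_closedBall_nat, inter_univ]
  have hmono : Monotone fun n : ℕ ↦ A ∩ Metric.closedBall y n := fun i j hij ↦
    inter_subset_inter_right _ (Metric.closedBall_subset_closedBall (by exact_mod_cast hij))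
  calc m A = ⨆ n : ℕ, m (A ∩ Metric.closedBall y n) := by
        conv_lhs => rw [hU]
        exact hmono.measure_iUnion
    _ ≤ _ := iSup_le hn

end RadonNikodym

/-! ### Passage to the limit; (III) implies (I) -/

section Sobolev

variable {X Y : Type*} [MetricSpace X] [MeasurableSpace X] [BorelSpace X] [MetricSpace Y]
  [MeasurableSpace Y] [BorelSpace Y] {Q : ℝ} {μ : Measure X} {ν : Measure Y} {f : X ≃ₜ Y}
  {C K' : ℝ≥0} {lam : ℝ}

/-- Closedness of `F` is what makes the measures of its shrinking neighbourhoods tend to `ν F`, and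
boundedness makes them finite. -/
theorem AnnularQC.exists_weakUpperGradient [SecondCountableTopology X] [SecondCountableTopology Y]
    [IsLocallyFiniteMeasure ν] [ν.IsOpenPosMeasure] (hQ : 1 < Q) (hlam : 1 < lam)
    (hν : Doubling ν C) (h : AnnularQC Q μ ν f lam K') (y₀ : Y) :
    ∃ g : X → ℝ≥0∞, IsWeakUpperGradient Q μ f (fun x ↦ ENNReal.ofReal (20 * lam) * g x) ∧
      Measurable g ∧ ∀ F : Set Y, IsClosed F → Bornology.IsBounded F →
        ∫⁻ x in f ⁻¹' F, g x ^ Q ∂μ ≤ (K' + 1) * C ^ 3 * ν F := by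
  have hQ0 : 0 < Q := by linarith
  have hεpos : ∀ n : ℕ, (0 : ℝ) < 1 / (n + 1) := fun n ↦ Nat.one_div_pos_of_nat
  choose ρ hρm hρF hργ using fun n ↦ h.exists_discrete_upperGradient hQ0 hlam hν (hεpos n)
  set c : ℝ≥0∞ := (K' + 1) * C ^ 3 with hc
  have hctop : c ≠ ∞ := ENNReal.mul_ne_top (by simp) (by simp)
  set B : ℕ → Set Y := fun j ↦ Metric.closedBall y₀ j with hB
  have hBm : ∀ j, MeasurableSet (B j) := fun j ↦ Metric.isClosed_closedBall.measurableSet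
  have hle1 : ∀ n k : ℕ, k ≤ n → 3 * lam * (1 / ((n : ℝ) + 1)) ≤ 3 * lam * (1 / ((k : ℝ) + 1)) :=
    fun n k hkn ↦ mul_le_mul_of_nonneg_left (Nat.one_div_le_one_div hkn) (by linarith)
  set N : ℕ → ℝ≥0∞ := fun j ↦ c * ν (Metric.cthickening (3 * lam) (B j)) with hN
  have hNtop : ∀ j, N j ≠ ∞ := fun j ↦ ENNReal.mul_ne_top hctop
    (hν.measure_ne_top_of_isBounded y₀ Metric.isBounded_closedBall.cthickening)
  have hρN : ∀ n j, ∫⁻ x in f ⁻¹' B j, ρ n x ^ Q ∂μ ≤ N j := fun n j ↦ by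
    refine (hρF n (B j) (hBm j)).trans ?_
    simp only [hN]
    gcongr
    refine Metric.cthickening_mono ((hle1 n 0 n.zero_le).trans_eq (by simp)) _
  set w : ℕ → ℝ≥0∞ := fun j ↦ 2⁻¹ ^ (j + 1) * (N j + 1)⁻¹ with hw
  have hw0 : ∀ j, w j ≠ 0 := fun j ↦ mul_ne_zero (by simp)
    (ENNReal.inv_ne_zero.2 (ENNReal.add_ne_top.2 ⟨hNtop j, ENNReal.one_ne_top⟩))
  -- The discrete upper gradients are bounded only in `L^Q` of each `f⁻¹(B j)`. The weights combine
  -- these bounds into one bound in `L^Q(P)`; as they are positive, `L^Q(P)` functions are still in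
  -- `L^Q_loc(μ)`.
  set P : Measure X := Measure.sum fun j ↦ w j • μ.restrict (f ⁻¹' B j) with hP
  have hPint : ∀ G : X → ℝ≥0∞, ∫⁻ x, G x ∂P = ∑' j, w j * ∫⁻ x in f ⁻¹' B j, G x ∂μ := fun G ↦ by
    rw [hP, lintegral_sum_measure]
    simp only [lintegral_smul_measure, smul_eq_mul]
  have hρP : ∀ n, ∫⁻ x, ρ n x ^ Q ∂P ≤ 1 := by
    intro n
    rw [hPint]
    calc ∑' j, w j * ∫⁻ x in f ⁻¹' B j, ρ n x ^ Q ∂μ ≤ ∑' j : ℕ, (2⁻¹ : ℝ≥0∞) ^ (j + 1) := by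
          refine ENNReal.tsum_le_tsum fun j ↦ ?_
          calc w j * ∫⁻ x in f ⁻¹' B j, ρ n x ^ Q ∂μ
              ≤ 2⁻¹ ^ (j + 1) * (N j + 1)⁻¹ * (N j + 1) := by
                gcongr
                exact (hρN n j).trans le_self_add
            _ ≤ 2⁻¹ ^ (j + 1) * 1 := by
                rw [mul_assoc]
                gcongr
                exact ENNReal.inv_mul_le_one _
            _ = _ := mul_one _
      _ = 1 := by
          rw [ENNReal.tsum_geometric_add_one, ENNReal.one_sub_inv_two,
            inv_inv, ENNReal.inv_mul_cancel two_ne_zero ENNReal.ofNat_ne_top]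
  obtain ⟨g, ψ, hgm, hψm, hψP, hgint, hgline⟩ :=
    exists_limit_of_bounded hQ hρm ENNReal.one_ne_top hρP
  have hψloc : LocLp Q μ ψ := by
    intro x
    obtain ⟨j, hj⟩ := exists_nat_ge (dist (f x) y₀ + 1)
    refine ⟨f ⁻¹' Metric.ball (f x) 1,
      f.continuous.continuousAt.preimage_mem_nhds (Metric.ball_mem_nhds _ one_pos), ?_⟩
    have hsub : f ⁻¹' Metric.ball (f x) 1 ⊆ f ⁻¹' B j := preimage_mono
      (Metric.ball_subset_closedBall.trans (Metric.closedBall_subset_closedBall' (by linarith)))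
    refine (lintegral_mono_set hsub).trans_lt (lt_top_iff_ne_top.2 fun htop ↦ ?_)
    have := (ENNReal.le_tsum (f := fun j ↦ w j * ∫⁻ x in f ⁻¹' B j, ψ x ^ Q ∂μ) j).trans
      ((hPint _).symm.trans_le hψP)
    simp only [htop, ENNReal.mul_top (hw0 j)] at this
    exact absurd this (by simp)
  have hlam0 : ENNReal.ofReal (20 * lam) ≠ 0 := (ENNReal.ofReal_pos.2 (by linarith)).ne'
  refine ⟨g, IsWeakUpperGradient.of_forall hQ0 (hgm.const_mul _)
    (Γ := fun _ : Unit ↦ {γ | γ.lineIntegral ψ = ∞})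
    (fun _ ↦ hψloc.modulus_lineIntegral_eq_top hQ0 hψm) ?_, hgm, ?_⟩
  · intro γ hγ hψγ
    rw [UpperGradientAlong, Curve.lineIntegral_const_mul hγ hgm]
    rcases (dist_nonneg (x := f (γ.toMap γ.finish)) (y := f (γ.toMap γ.start))).eq_or_lt with h0 | hD
    · rw [edist_dist, ← h0, ENNReal.ofReal_zero]
      exact zero_le
    · obtain ⟨k, hk⟩ := exists_nat_one_div_lt
        (div_pos hD (by linarith : 0 < 4 * lam))
      rw [lt_div_iff₀ (by linarith)] at hk
      rw [mul_comm, ← ENNReal.div_le_iff_le_mul (Or.inl hlam0) (Or.inl ENNReal.ofReal_ne_top)]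
      refine hgline γ hγ (hψγ ()) _ k fun n hn ↦ ?_
      rw [ENNReal.div_le_iff_le_mul (Or.inl hlam0) (Or.inl ENNReal.ofReal_ne_top), mul_comm]
      refine hργ n γ hγ (lt_of_le_of_lt ?_ hk)
      rw [mul_comm]
      exact mul_le_mul_of_nonneg_right (Nat.one_div_le_one_div hn) (by linarith)
  · intro F hF hFb
    have hlim0 : Tendsto (fun k : ℕ ↦ 3 * lam * (1 / ((k : ℝ) + 1))) atTop (𝓝 0) := by
      have := tendsto_one_div_add_atTop_nhds_zero_nat (𝕜 := ℝ).const_mul (3 * lam)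
      rwa [mul_zero] at this
    have hlim := ENNReal.Tendsto.const_mul (a := c)
      ((tendsto_measure_cthickening_of_isClosed (μ := ν)
        ⟨1, one_pos, hν.measure_ne_top_of_isBounded y₀ hFb.cthickening⟩ hF).comp hlim0)
      (Or.inr hctop)
    refine ge_of_tendsto' hlim fun k ↦ hgint (μ.restrict (f ⁻¹' F)) _ k fun n hn ↦ ?_
    refine (hρF n F hF.measurableSet).trans ?_
    simp only [Function.comp_apply]
    gcongr
    exact Metric.cthickening_mono (hle1 n k hn) F

/-- The measure `f_*(g ^ Q μ)` is at most `c ν` on closed bounded sets, hence on Borel sets; pulled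
back to `X` this is a density bound. -/
theorem AnnularQC.exists_weakUpperGradient_rpow_le [SecondCountableTopology X]
    [SecondCountableTopology Y] [IsLocallyFiniteMeasure μ] [IsLocallyFiniteMeasure ν]
    [ν.IsOpenPosMeasure] (hQ : 1 < Q) (hlam : 1 < lam)
    (hν : Doubling ν C) (h : AnnularQC Q μ ν f lam K') :
    ∃ g : X → ℝ≥0∞, IsWeakUpperGradient Q μ f g ∧ LocLp Q μ g ∧
      ∀ᵐ x ∂μ, g x ^ Q ≤
        ENNReal.ofReal (20 * lam) ^ Q * ((K' + 1) * C ^ 3) * volumeDerivative μ ν f x := by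
  have hQ0 : 0 < Q := by linarith
  rcases isEmpty_or_nonempty Y with hY | ⟨⟨y₀⟩⟩
  · have hX : IsEmpty X := f.toEquiv.isEmpty
    refine ⟨0, ⟨measurable_const, ?_⟩, fun x ↦ (hX.false x).elim,
      ae_of_all _ fun x ↦ (hX.false x).elim⟩
    exact nonpos_iff_eq_zero.1 ((modulus_le_of_admissible (ρ := 0)
      ⟨measurable_const, fun γ _ _ ↦ (hX.false (γ.toMap γ.start)).elim⟩).trans
        (by simp [hQ0]))
  obtain ⟨g, hw, hgm, hgF⟩ := h.exists_weakUpperGradient hQ hlam hν y₀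
  set c : ℝ≥0∞ := (K' + 1) * C ^ 3 with hc
  have hctop : c ≠ ∞ := ENNReal.mul_ne_top (by simp) (by simp)
  set L := ENNReal.ofReal (20 * lam) with hL
  have hLtop : L ^ Q ≠ ∞ := ENNReal.rpow_ne_top_of_nonneg hQ0.le ENNReal.ofReal_ne_top
  have hfm : Measurable f := f.continuous.measurable
  set m : Measure Y := (μ.withDensity fun x ↦ g x ^ Q).map f with hm
  have hmapp : ∀ A, MeasurableSet A → m A = ∫⁻ x in f ⁻¹' A, g x ^ Q ∂μ := fun A hA ↦ by
    rw [hm, Measure.map_apply hfm hA, withDensity_apply _ (hfm hA)]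
  have hmF : ∀ F, IsClosed F → Bornology.IsBounded F → m F ≤ c * ν F := fun F hF hFb ↦
    (hmapp F hF.measurableSet).trans_le (hgF F hF hFb)
  have hmfin : ∀ R, m (Metric.closedBall y₀ R) ≠ ∞ := fun R ↦
    ne_top_of_le_ne_top
      (ENNReal.mul_ne_top hctop (hν.measure_closedBall_lt_top y₀ R).ne)
      (hmF _ Metric.isClosed_closedBall Metric.isBounded_closedBall)
  have hae := le_mul_rnDeriv_of_withDensity_le (μ := μ) (κ := ν.map f.symm) (hgm.pow_const Q)
    (c := c) (fun A hA ↦ by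
      have hA' : MeasurableSet (f.symm ⁻¹' A) := f.symm.continuous.measurable hA
      have := measure_le_of_isClosed y₀ hmfin hmF hA'
      rwa [hmapp _ hA', ← preimage_comp, f.symm_comp_self, preimage_id,
        ← Measure.map_apply f.symm.continuous.measurable hA] at this)
  refine ⟨_, hw, fun x ↦ ⟨f ⁻¹' Metric.ball (f x) 1,
    f.continuous.continuousAt.preimage_mem_nhds (Metric.ball_mem_nhds _ one_pos), ?_⟩, ?_⟩
  · simp_rw [ENNReal.mul_rpow_of_nonneg _ _ hQ0.le]
    rw [lintegral_const_mul _ (hgm.pow_const Q)]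
    refine ENNReal.mul_lt_top hLtop.lt_top ?_
    refine (lintegral_mono_set (preimage_mono Metric.ball_subset_closedBall)).trans_lt ?_
    refine (hgF _ Metric.isClosed_closedBall Metric.isBounded_closedBall).trans_lt ?_
    exact ENNReal.mul_lt_top hctop.lt_top (hν.measure_closedBall_lt_top _ _)
  · filter_upwards [hae] with x hx
    rw [ENNReal.mul_rpow_of_nonneg _ _ hQ0.le, mul_assoc]
    gcongr
    exact hx

/-- Take the maximum with a function in `L^Q` whose integral is infinite along every exceptional
curve. -/
theorem IsWeakUpperGradient.exists_isUpperGradient (hQ : 0 < Q) {Z : Type*} [MetricSpace Z]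
    {φ : X → Z} {g : X → ℝ≥0∞} (h : IsWeakUpperGradient Q μ φ g) (hg : LocLp Q μ g) :
    ∃ g', IsUpperGradient φ g' ∧ LocLp Q μ g' := by
  obtain ⟨ρ, hρ, hfin, htop⟩ := exists_lineIntegral_eq_top hQ h.2
  refine ⟨fun x ↦ max (g x) (ρ x), ⟨h.1.max hρ, fun γ hγ ↦ ?_⟩, fun x ↦ ?_⟩
  · by_cases hu : UpperGradientAlong φ g γ
    · exact hu.trans (Curve.lineIntegral_mono _ fun x ↦ le_max_left _ _)
    · have : γ.lineIntegral (fun x ↦ max (g x) (ρ x)) = ∞ := top_unique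
        ((htop γ ⟨hγ, hu⟩ hγ).symm.trans_le
          (Curve.lineIntegral_mono _ fun x ↦ le_max_right _ _))
      rw [UpperGradientAlong, this]
      exact le_top
  · obtain ⟨U, hU, hUfin⟩ := hg x
    refine ⟨U, hU, ?_⟩
    calc ∫⁻ x in U, max (g x) (ρ x) ^ Q ∂μ ≤ ∫⁻ x in U, g x ^ Q + ρ x ^ Q ∂μ := by
          refine lintegral_mono fun x ↦ ?_
          rcases le_total (g x) (ρ x) with h | h
          · simp only [max_eq_right h]
            exact le_add_self
          · simp only [max_eq_left h]
            exact le_self_add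
      _ = ∫⁻ x in U, g x ^ Q ∂μ + ∫⁻ x in U, ρ x ^ Q ∂μ := lintegral_add_left (h.1.pow_const Q) _
      _ < ∞ := ENNReal.add_lt_top.2
          ⟨hUfin, (setLIntegral_le_lintegral _ _).trans_lt hfin.lt_top⟩

theorem AnnularQC.analyticQC [SecondCountableTopology X]
    [SecondCountableTopology Y] [IsLocallyFiniteMeasure μ] [IsLocallyFiniteMeasure ν]
    [ν.IsOpenPosMeasure] (hQ : 1 < Q) (hlam : 1 < lam)
    (hν : Doubling ν C) {K : ℝ≥0} (hK : ENNReal.ofReal (20 * lam) ^ Q * ((K' + 1) * C ^ 3) ≤ K)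
    (h : AnnularQC Q μ ν f lam K') : AnalyticQC Q μ ν f K := by
  have hQ0 : 0 < Q := by linarith
  obtain ⟨g, hw, hl, hae⟩ := h.exists_weakUpperGradient_rpow_le hQ hlam hν
  obtain ⟨g₀, hmin⟩ := exists_isMinimalWeakUpperGradient hQ0 f.continuous hw hl
  refine ⟨⟨⟨f.continuous.measurable, fun x ↦ ?_⟩, hw.exists_isUpperGradient hQ0 hl⟩, g₀, hmin, ?_⟩
  · obtain ⟨V, hV, hVfin⟩ := μ.finiteAt_nhds x
    have hV' : V ∩ f ⁻¹' Metric.ball (f x) 1 ∈ 𝓝 x := inter_mem hV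
      (f.continuous.continuousAt.preimage_mem_nhds (Metric.ball_mem_nhds _ one_pos))
    obtain ⟨U, hUV, hU, hxU⟩ := mem_nhds_iff.1 hV'
    have hUfin : μ U < ∞ := (measure_mono (hUV.trans inter_subset_left)).trans_lt hVfin
    refine ⟨U, hU.mem_nhds hxU, hUfin, f x, ?_⟩
    calc ∫⁻ x' in U, edist (f x) (f x') ^ Q ∂μ ≤ ∫⁻ _ in U, 1 ∂μ := by
          refine setLIntegral_mono' hU.measurableSet fun x' hx' ↦ ?_
          have h1 : dist (f x') (f x) < 1 := (hUV hx').2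
          refine ENNReal.rpow_le_one ?_ hQ0.le
          rw [edist_comm, edist_dist]
          exact ENNReal.ofReal_le_one.2 h1.le
      _ < ∞ := by rwa [setLIntegral_one]
  · filter_upwards [hae, hmin.2.2 g hw hl] with x hx hgx
    calc g₀ x ^ Q ≤ g x ^ Q := ENNReal.rpow_le_rpow hgx hQ0.le
      _ ≤ _ := hx
      _ ≤ _ := by gcongr

end Sobolev

/-! ### Regular spaces and quasisymmetric maps -/

section Quasisymmetric

/-- Regularity is assumed only for radii up to the diameter. Beyond it balls are the whole space, so
a larger radius can be replaced by the diameter, and `C ≥ 1` handles the case where both balls are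
the whole space. -/
theorem AhlforsRegular.doubling {Y : Type*} [MetricSpace Y] [MeasurableSpace Y] {Q : ℝ}
    (hQ : 0 < Q) {ν : Measure Y} {A C : ℝ≥0} (h : AhlforsRegular Q ν A)
    (hC : A * (2 ^ Q * A) ≤ (C : ℝ≥0∞)) (hC1 : 1 ≤ C) : Doubling ν C := by
  intro y r hr
  have hr2 : ENNReal.ofReal (2 * r) = 2 * ENNReal.ofReal r := by
    rw [ENNReal.ofReal_mul zero_le_two, ENNReal.ofReal_ofNat]
  have hball : ∀ s : ℝ, Metric.ediam (univ : Set Y) ≤ ENNReal.ofReal s → 0 ≤ s →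
      Metric.closedBall y s = univ := fun s hs hs0 ↦ eq_univ_of_forall fun z ↦ by
    rw [Metric.mem_closedBall, ← ENNReal.ofReal_le_ofReal_iff hs0, ← edist_dist]
    exact (Metric.edist_le_ediam_of_mem (mem_univ _) (mem_univ _)).trans hs
  rcases le_or_gt (ENNReal.ofReal r) (Metric.ediam (univ : Set Y)) with hrd | hrd
  · have key : ν (Metric.closedBall y (2 * r)) ≤ A * ENNReal.ofReal (2 * r) ^ Q := by
      rcases le_or_gt (ENNReal.ofReal (2 * r)) (Metric.ediam (univ : Set Y)) with h2 | h2
      · exact (h y (2 * r) (by linarith) h2).2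
      · have htop : Metric.ediam (univ : Set Y) ≠ ∞ := ne_top_of_lt h2
        set D := (Metric.ediam (univ : Set Y)).toReal with hD
        have hDe : ENNReal.ofReal D = Metric.ediam (univ : Set Y) := ENNReal.ofReal_toReal htop
        have hD0 : 0 < D := ENNReal.toReal_pos ((ENNReal.ofReal_pos.2 hr).trans_le hrd).ne' htop
        rw [hball (2 * r) h2.le (by linarith), ← hball D hDe.ge hD0.le]
        refine (h y D hD0 hDe.le).2.trans ?_
        rw [hDe]
        gcongr
    calc ν (Metric.closedBall y (2 * r)) ≤ A * ENNReal.ofReal (2 * r) ^ Q := key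
      _ = A * (2 ^ Q * ENNReal.ofReal r ^ Q) := by
          rw [hr2, ENNReal.mul_rpow_of_nonneg _ _ hQ.le]
      _ ≤ A * (2 ^ Q * (A * ν (Metric.closedBall y r))) := by
          gcongr
          exact (h y r hr hrd).1
      _ = A * (2 ^ Q * A) * ν (Metric.closedBall y r) := by ring
      _ ≤ _ := by gcongr
  · rw [hball r hrd.le hr.le, hball (2 * r) (hrd.le.trans
      (ENNReal.ofReal_le_ofReal (by linarith))) (by linarith)]
    exact le_mul_of_one_le_left' (by exact_mod_cast hC1)

variable {X Y : Type*} [MetricSpace X] [MetricSpace Y]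

/-- By the contrapositive of `hf`, a point mapped outside `B_{λr}` is at least twice as far from `x`
as any point mapped into `B_r`. So `a` can be the supremum of the distances of the latter. -/
theorem exists_separating_radius {f : X ≃ₜ Y} {lam : ℝ}
    (hf : ∀ x x₁ x₂, dist x x₁ < 2 * dist x x₂ → dist (f x) (f x₁) ≤ lam * dist (f x) (f x₂))
    (hlam : 1 < lam) (x x₁ : X) {r : ℝ} (hr : 0 < r) (hx₁ : lam * r < dist (f x) (f x₁)) :
    ∃ a, 0 < a ∧ (∀ z, dist (f x) (f z) ≤ r → dist x z ≤ a) ∧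
      ∀ z, lam * r < dist (f x) (f z) → 2 * a ≤ dist x z := by
  have hsep : ∀ z w, dist (f x) (f z) ≤ r → lam * r < dist (f x) (f w) →
      2 * dist x z ≤ dist x w := by
    intro z w hz hw
    by_contra! hcon
    have := hf x w z hcon
    nlinarith
  set S : Set ℝ := {d | ∃ z, dist (f x) (f z) ≤ r ∧ d = dist x z} with hS
  have hbdd : BddAbove S := ⟨dist x x₁ / 2, by
    rintro _ ⟨z, hz, rfl⟩
    linarith [hsep z x₁ hz hx₁]⟩
  have hmem : ∀ z, dist (f x) (f z) ≤ r → dist x z ≤ sSup S := fun z hz ↦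
    le_csSup hbdd ⟨z, hz, rfl⟩
  have h0 : 0 ≤ sSup S := dist_nonneg.trans (hmem x (by simpa using hr.le))
  rcases h0.eq_or_lt with h0 | h0
  -- If the supremum is zero, `x` alone is mapped into `B_r`, and any small positive `a` works.
  · have hnhds : f ⁻¹' Metric.ball (f x) r ∈ 𝓝 x :=
      f.continuous.continuousAt.preimage_mem_nhds (Metric.ball_mem_nhds _ hr)
    obtain ⟨e, he, hsub⟩ := Metric.mem_nhds_iff.1 hnhds
    refine ⟨e / 2, by positivity, fun z hz ↦ ((hmem z hz).trans_eq h0.symm).trans (by positivity),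
      fun z hz ↦ ?_⟩
    by_contra! hcon
    have hze : z ∈ Metric.ball x e := by
      rw [Metric.mem_ball']
      linarith
    have : dist (f x) (f z) < r := Metric.mem_ball'.1 (hsub hze)
    nlinarith
  · refine ⟨sSup S, h0, hmem, fun z hz ↦ ?_⟩
    have : sSup S ≤ dist x z / 2 := csSup_le ⟨_, x, by simpa using hr.le, rfl⟩ (by
      rintro _ ⟨w, hw, rfl⟩
      linarith [hsep w z hw hz])
    linarith

/-- The preimage family lies in the condenser of radii `a` and `3a/2`, tested on the ball of radius
`2a`, which gives `(a/2) ^ -Q * (2a) ^ Q = 4 ^ Q`. A point mapped outside `B_{λr}` shows that `2a`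
and `r` do not exceed the diameters; without such a point the family is empty. -/
theorem annularQC_of_weaklyQuasisymmetric [MeasurableSpace X] [BorelSpace X] [MeasurableSpace Y]
    {Q : ℝ} (hQ : 0 < Q) {μ : Measure X} {ν : Measure Y} {A₁ A₂ : ℝ≥0}
    (hμ : AhlforsRegular Q μ A₁) (hν : AhlforsRegular Q ν A₂) {f : X ≃ₜ Y} {lam : ℝ}
    (hf : ∀ x x₁ x₂, dist x x₁ < 2 * dist x x₂ → dist (f x) (f x₁) ≤ lam * dist (f x) (f x₂))
    (hlam : 1 < lam) {K' : ℝ≥0} (hK' : A₂ * (4 ^ Q * A₁) ≤ (K' : ℝ≥0∞)) :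
    AnnularQC Q μ ν f lam K' := by
  intro y
  refine liminf_le_of_frequently_le' (Eventually.frequently ?_)
  filter_upwards [self_mem_nhdsWithin] with r (hr : 0 < r)
  refine ENNReal.div_le_of_le_mul ?_
  obtain ⟨x, rfl⟩ := f.surjective y
  by_cases hex : ∃ x₁, lam * r < dist (f x) (f x₁)
  · obtain ⟨x₁, hx₁⟩ := hex
    obtain ⟨a, ha, hin, hout⟩ := exists_separating_radius hf hlam x x₁ hr hx₁
    have hsub : preimageFamily f (annularCondenser (f x) r (lam * r)) ⊆
        annularCondenser x a (3 / 2 * a) := by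
      rintro γ ⟨⟨_, ⟨s, rfl⟩, hs⟩, ⟨_, ⟨t, rfl⟩, ht⟩⟩
      rw [Metric.mem_closedBall'] at hs
      rw [mem_compl_iff, Metric.mem_closedBall', not_le] at ht
      refine ⟨⟨_, ⟨s, rfl⟩, Metric.mem_closedBall'.2 (hin _ hs)⟩, ⟨_, ⟨t, rfl⟩, ?_⟩⟩
      rw [mem_compl_iff, Metric.mem_closedBall', not_le]
      linarith [hout _ ht]
    have ha2 : ENNReal.ofReal (a / 2) ≠ 0 := (ENNReal.ofReal_pos.2 (by linarith)).ne'
    have hmod : modulus Q μ (preimageFamily f (annularCondenser (f x) r (lam * r))) ≤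
        4 ^ Q * A₁ := by
      calc modulus Q μ (preimageFamily f (annularCondenser (f x) r (lam * r)))
          ≤ modulus Q μ (annularCondenser x a (3 / 2 * a)) := modulus_mono fun γ hγ _ ↦ hsub hγ
        _ ≤ (ENNReal.ofReal (3 / 2 * a - a))⁻¹ ^ Q * μ (Metric.closedBall x (2 * a)) :=
            modulus_annularCondenser_le hQ x (by linarith) (by linarith)
        _ ≤ (ENNReal.ofReal (a / 2))⁻¹ ^ Q * (A₁ * ENNReal.ofReal (2 * a) ^ Q) := by
            rw [show 3 / 2 * a - a = a / 2 by ring]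
            gcongr
            exact (hμ x (2 * a) (by linarith)
              ((ENNReal.ofReal_le_ofReal (hout _ hx₁)).trans ((edist_dist x x₁).ge.trans
                (Metric.edist_le_ediam_of_mem (mem_univ _) (mem_univ _))))).2
        _ = ((ENNReal.ofReal (a / 2))⁻¹ * ENNReal.ofReal (a / 2)) ^ Q * (4 ^ Q * A₁) := by
            rw [show 2 * a = 4 * (a / 2) by ring, ENNReal.ofReal_mul (by norm_num),
              ENNReal.ofReal_ofNat, ENNReal.mul_rpow_of_nonneg _ _ hQ.le,
              ENNReal.mul_rpow_of_nonneg _ _ hQ.le]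
            ring
        _ = 4 ^ Q * A₁ := by
            rw [ENNReal.inv_mul_cancel ha2 ENNReal.ofReal_ne_top, ENNReal.one_rpow, one_mul]
    have hrd : ENNReal.ofReal r ≤ Metric.ediam (univ : Set Y) :=
      (ENNReal.ofReal_le_ofReal (by nlinarith)).trans ((edist_dist (f x) (f x₁)).ge.trans
        (Metric.edist_le_ediam_of_mem (mem_univ _) (mem_univ _)))
    calc ENNReal.ofReal r ^ Q * modulus Q μ (preimageFamily f (annularCondenser (f x) r (lam * r)))
        ≤ A₂ * ν (Metric.closedBall (f x) r) * (4 ^ Q * A₁) :=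
          mul_le_mul' (hν (f x) r hr hrd).1 hmod
      _ = A₂ * (4 ^ Q * A₁) * ν (Metric.closedBall (f x) r) := by ring
      _ ≤ _ := by gcongr
  · have hempty : modulus Q μ (preimageFamily f (annularCondenser (f x) r (lam * r))) ≤ 0 := by
      refine (modulus_le_of_admissible (ρ := 0) ⟨measurable_const, ?_⟩).trans (by simp [hQ])
      rintro γ ⟨-, ⟨_, ⟨t, rfl⟩, ht⟩⟩
      rw [mem_compl_iff, Metric.mem_closedBall', not_le] at ht
      exact absurd ⟨_, ht⟩ hex
    rw [nonpos_iff_eq_zero.1 hempty, mul_zero]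
    exact zero_le

/-- A decreasing map would be bounded by `η 0` and not surjective. -/
theorem strictMono_of_homeomorph (η : ℝ≥0 ≃ₜ ℝ≥0) : StrictMono η ∧ η 0 = 0 := by
  have hmono : StrictMono η := by
    rcases η.continuous.strictMono_of_inj η.injective with h | h
    · exact h
    · obtain ⟨t, ht⟩ := η.surjective (η 0 + 1)
      have := h.antitone (zero_le (a := t))
      rw [ht] at this
      exact absurd this (not_le.2 (lt_add_one _))
  obtain ⟨t, ht⟩ := η.surjective 0
  exact ⟨hmono, nonpos_iff_eq_zero.1 ((hmono.monotone (zero_le (a := t))).trans_eq ht)⟩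

theorem Quasisymmetric.weak {f : X ≃ₜ Y} {η : ℝ≥0 ≃ₜ ℝ≥0} (h : Quasisymmetric f η) {lam : ℝ}
    (hlam : 1 < lam) (hη : η 2 ≤ lam) (x x₁ x₂ : X) (hx : dist x x₁ < 2 * dist x x₂) :
    dist (f x) (f x₁) ≤ lam * dist (f x) (f x₂) := by
  have hx₂ : x₂ ≠ x := by
    rintro rfl
    rw [dist_self, mul_zero] at hx
    exact absurd hx (not_lt.2 dist_nonneg)
  rcases eq_or_ne x₁ x with rfl | hx₁
  · rw [dist_self]
    positivity
  rcases eq_or_ne x₂ x₁ with rfl | hne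
  · exact le_mul_of_one_le_left dist_nonneg hlam.le
  have hq := h x₂ x₁ x hne hx₁ hx₂
  have hpos : 0 < nndist x x₂ := pos_iff_ne_zero.2 (nndist_eq_zero.not.2 hx₂.symm)
  have hfpos : 0 < nndist (f x) (f x₂) :=
    pos_iff_ne_zero.2 (nndist_eq_zero.not.2 (f.injective.ne hx₂.symm))
  have hratio : nndist x x₁ / nndist x x₂ ≤ 2 := by
    rw [div_le_iff₀ hpos]
    exact_mod_cast hx.le
  have := hq.trans ((strictMono_of_homeomorph η).1.monotone hratio)
  rw [div_le_iff₀ hfpos] at this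
  have h' : dist (f x) (f x₁) ≤ η 2 * dist (f x) (f x₂) := by exact_mod_cast this
  exact h'.trans (by gcongr)

/-- If the preimage distances had ratio above `λ`, the reciprocal ratio would be at most `η⁻¹(1/2)`,
and quasisymmetry would give image distances with ratio at most `1/2`, against `hy`. -/
theorem Quasisymmetric.weak_symm {f : X ≃ₜ Y} {η : ℝ≥0 ≃ₜ ℝ≥0} (h : Quasisymmetric f η)
    {lam : ℝ} (hlam : 1 < lam) (hη : lam⁻¹ ≤ η.symm 2⁻¹) (y y₁ y₂ : Y)
    (hy : dist y y₁ < 2 * dist y y₂) :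
    dist (f.symm y) (f.symm y₁) ≤ lam * dist (f.symm y) (f.symm y₂) := by
  obtain ⟨x, rfl⟩ := f.surjective y
  obtain ⟨x₁, rfl⟩ := f.surjective y₁
  obtain ⟨x₂, rfl⟩ := f.surjective y₂
  simp only [Homeomorph.symm_apply_apply]
  have hx₂ : x₂ ≠ x := by
    rintro rfl
    rw [dist_self, mul_zero] at hy
    exact absurd hy (not_lt.2 dist_nonneg)
  rcases eq_or_ne x₁ x with rfl | hx₁
  · rw [dist_self]
    positivity
  rcases eq_or_ne x₁ x₂ with rfl | hne
  · exact le_mul_of_one_le_left dist_nonneg hlam.le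
  by_contra! hcon
  have hq := h x₁ x₂ x hne hx₂ hx₁
  have hpos : 0 < nndist x x₁ := pos_iff_ne_zero.2 (nndist_eq_zero.not.2 hx₁.symm)
  have hfpos : 0 < nndist (f x) (f x₁) :=
    pos_iff_ne_zero.2 (nndist_eq_zero.not.2 (f.injective.ne hx₁.symm))
  have hratio : nndist x x₂ / nndist x x₁ ≤ η.symm 2⁻¹ := by
    rw [← NNReal.coe_le_coe]
    refine le_trans ?_ hη
    push_cast
    rw [div_le_iff₀ (by exact_mod_cast hpos), inv_mul_eq_div, le_div_iff₀ (by linarith), mul_comm]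
    exact hcon.le
  have := hq.trans ((strictMono_of_homeomorph η).1.monotone hratio)
  rw [Homeomorph.apply_symm_apply, div_le_iff₀ hfpos] at this
  have h' : dist (f x) (f x₂) ≤ 2⁻¹ * dist (f x) (f x₁) := by exact_mod_cast this
  linarith

theorem imageFamily_symm_imageFamily (f : X ≃ₜ Y) (Γ : Set (Curve X)) :
    imageFamily f.symm (imageFamily f Γ) = Γ := by
  have : ∀ γ : Curve X, Curve.map (f.symm : C(Y, X)) (Curve.map (f : C(X, Y)) γ) = γ := by
    rintro ⟨l, r, h, φ⟩
    simp only [Curve.map]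
    congr 1
    ext t
    exact f.symm_apply_apply _
  rw [imageFamily, imageFamily, image_image]
  simp only [this, image_id']

end Quasisymmetric

/-! ### Constants chosen before the spaces -/

section Constants

theorem exists_coe_ge {e : ℝ≥0∞} (h : e ≠ ∞) : ∃ K : ℝ≥0, e ≤ K :=
  ⟨e.toNNReal, (ENNReal.coe_toNNReal h).ge⟩

theorem exists_analyticQC_geometricQC {Q : ℝ} (hQ : 1 < Q) (C : ℝ≥0) {lam : ℝ} (hlam : 1 < lam)
    (K' : ℝ≥0) : ∃ K : ℝ≥0,
      ∀ (X : Type u) [MetricSpace X] [SecondCountableTopology X] [MeasurableSpace X]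
        [BorelSpace X] (Y : Type v) [MetricSpace Y] [SecondCountableTopology Y]
        [MeasurableSpace Y] [BorelSpace Y] (μ : Measure X) [IsLocallyFiniteMeasure μ]
        (ν : Measure Y) [IsLocallyFiniteMeasure ν] [ν.IsOpenPosMeasure] (f : X ≃ₜ Y),
        Doubling ν C → AnnularQC Q μ ν f lam K' →
          AnalyticQC Q μ ν f K ∧ GeometricQC Q μ ν f K := by
  have hQ0 : 0 < Q := by linarith
  obtain ⟨K, hK⟩ := exists_coe_ge (e := ENNReal.ofReal (20 * lam) ^ Q * ((K' + 1) * C ^ 3))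
    (ENNReal.mul_ne_top (ENNReal.rpow_ne_top_of_nonneg hQ0.le ENNReal.ofReal_ne_top)
      (ENNReal.mul_ne_top (by simp) (by simp)))
  refine ⟨max K 1, ?_⟩
  intro X _ _ _ _ Y _ _ _ _ μ _ ν _ _ f hν h
  have ha := h.analyticQC (K := max K 1) hQ hlam hν
    (hK.trans (by exact_mod_cast le_max_left K 1))
  refine ⟨ha, ?_⟩
  have := ha.geometricQC hQ0
  rwa [max_eq_left (le_max_right K 1)] at this

theorem exists_geometricQC_of_weaklyQuasisymmetric {Q : ℝ} (hQ : 1 < Q) (A₁ A₂ : ℝ≥0) {lam : ℝ}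
    (hlam : 1 < lam) : ∃ K : ℝ≥0,
      ∀ (X : Type u) [MetricSpace X] [SecondCountableTopology X] [MeasurableSpace X]
        [BorelSpace X] (Y : Type v) [MetricSpace Y] [SecondCountableTopology Y]
        [MeasurableSpace Y] [BorelSpace Y] (μ : Measure X) [IsLocallyFiniteMeasure μ]
        (ν : Measure Y) [IsLocallyFiniteMeasure ν] [ν.IsOpenPosMeasure] (f : X ≃ₜ Y),
        AhlforsRegular Q μ A₁ → AhlforsRegular Q ν A₂ →
        (∀ x x₁ x₂, dist x x₁ < 2 * dist x x₂ → dist (f x) (f x₁) ≤ lam * dist (f x) (f x₂)) →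
          GeometricQC Q μ ν f K := by
  have hQ0 : 0 < Q := by linarith
  obtain ⟨C, hC⟩ := exists_coe_ge (e := A₂ * (2 ^ Q * A₂)) (ENNReal.mul_ne_top (by simp)
    (ENNReal.mul_ne_top (ENNReal.rpow_ne_top_of_nonneg hQ0.le (by simp)) (by simp)))
  obtain ⟨K', hK'⟩ := exists_coe_ge (e := A₂ * (4 ^ Q * A₁)) (ENNReal.mul_ne_top (by simp)
    (ENNReal.mul_ne_top (ENNReal.rpow_ne_top_of_nonneg hQ0.le (by simp)) (by simp)))
  obtain ⟨K, hK⟩ := exists_analyticQC_geometricQC.{u, v} hQ (max C 1) hlam K'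
  refine ⟨K, ?_⟩
  intro X _ _ _ _ Y _ _ _ _ μ _ ν _ _ f hμ hν hf
  exact (hK X Y μ ν f
    (hν.doubling hQ0 (hC.trans (by exact_mod_cast le_max_left C 1)) (le_max_right C 1))
    (annularQC_of_weaklyQuasisymmetric hQ0 hμ hν hf hlam hK')).2

end Constants

end GeomQC

end

theorem theorem1p2 (Q : ℝ) (hQ : 1 < Q) :
    -- (I) implies (III), and (II) implies (III), for every `lam > 1`, quantitatively
    (∀ (C K : ℝ≥0) (lam : ℝ), 1 < lam → ∃ K' : ℝ≥0, 1 ≤ K' ∧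
      ∀ (X : Type u) [MetricSpace X] [TopologicalSpace.SeparableSpace X] [MeasurableSpace X]
        [BorelSpace X] (Y : Type v) [MetricSpace Y] [TopologicalSpace.SeparableSpace Y]
        [MeasurableSpace Y] [BorelSpace Y]
        (μ : Measure X) [IsLocallyFiniteMeasure μ] [μ.IsOpenPosMeasure]
        (ν : Measure Y) [IsLocallyFiniteMeasure ν] [ν.IsOpenPosMeasure] (f : X ≃ₜ Y),
        Doubling ν C →
          (AnalyticQC Q μ ν f K → AnnularQC Q μ ν f lam K') ∧
          (GeometricQC Q μ ν f K → AnnularQC Q μ ν f lam K')) ∧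
    -- (III) for some `lam > 1` and `K' ≥ 1` implies (I) and (II), quantitatively
    (∀ (C : ℝ≥0) (lam : ℝ) (K' : ℝ≥0), 1 < lam → 1 ≤ K' → ∃ K : ℝ≥0,
      ∀ (X : Type u) [MetricSpace X] [TopologicalSpace.SeparableSpace X] [MeasurableSpace X]
        [BorelSpace X] (Y : Type v) [MetricSpace Y] [TopologicalSpace.SeparableSpace Y]
        [MeasurableSpace Y] [BorelSpace Y]
        (μ : Measure X) [IsLocallyFiniteMeasure μ] [μ.IsOpenPosMeasure]
        (ν : Measure Y) [IsLocallyFiniteMeasure ν] [ν.IsOpenPosMeasure] (f : X ≃ₜ Y),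
        Doubling ν C → AnnularQC Q μ ν f lam K' →
          AnalyticQC Q μ ν f K ∧ GeometricQC Q μ ν f K) ∧
    -- Quasisymmetric maps between `Q`-regular spaces are geometrically quasiconformal
    (∀ (A₁ A₂ : ℝ≥0) (η : ℝ≥0 ≃ₜ ℝ≥0), ∃ K : ℝ≥0,
      ∀ (X : Type u) [MetricSpace X] [TopologicalSpace.SeparableSpace X] [MeasurableSpace X]
        [BorelSpace X] (Y : Type v) [MetricSpace Y] [TopologicalSpace.SeparableSpace Y]
        [MeasurableSpace Y] [BorelSpace Y]
        (μ : Measure X) [IsLocallyFiniteMeasure μ] [μ.IsOpenPosMeasure]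
        (ν : Measure Y) [IsLocallyFiniteMeasure ν] [ν.IsOpenPosMeasure] (f : X ≃ₜ Y),
        AhlforsRegular Q μ A₁ → AhlforsRegular Q ν A₂ → Quasisymmetric f η →
          ∀ Γ : Set (Curve X),
            modulus Q μ Γ ≤ K * modulus Q ν (imageFamily f Γ) ∧
            modulus Q ν (imageFamily f Γ) ≤ K * modulus Q μ Γ) := by
  have hQ0 : 0 < Q := by linarith
  refine ⟨fun C K lam hlam ↦ ?_, fun C lam K' hlam _ ↦ ?_, fun A₁ A₂ η ↦ ?_⟩
  · obtain ⟨n, hn⟩ := pow_unbounded_of_one_lt (2 * lam) one_lt_two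
    obtain ⟨K', hK'⟩ := exists_coe_ge
      (e := (max K 1 : ℝ≥0) * ((ENNReal.ofReal (lam - 1))⁻¹ ^ Q * C ^ n))
      (ENNReal.mul_ne_top (by simp) (ENNReal.mul_ne_top (ENNReal.rpow_ne_top_of_nonneg hQ0.le
        (ENNReal.inv_ne_top.2 (ENNReal.ofReal_pos.2 (by linarith)).ne')) (by simp)))
    refine ⟨max K' 1, le_max_right _ _, ?_⟩
    intro X _ _ _ _ Y _ _ _ _ μ _ _ ν _ _ f hν
    have := UniformSpace.secondCountable_of_separable X
    have hK'' := hK'.trans (by exact_mod_cast le_max_left K' 1 :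
      (K' : ℝ≥0∞) ≤ (max K' 1 : ℝ≥0))
    refine ⟨fun h ↦ (h.geometricQC hQ0).annularQC hQ0 hlam hn.le hK'' hν,
      fun h ↦ h.annularQC hQ0 hlam hn.le (le_trans ?_ hK'') hν⟩
    gcongr
    exact le_max_left _ _
  · obtain ⟨K, hK⟩ := exists_analyticQC_geometricQC.{u, v} hQ C hlam K'
    refine ⟨K, ?_⟩
    intro X _ _ _ _ Y _ _ _ _ μ _ _ ν _ _ f hν h
    have := UniformSpace.secondCountable_of_separable X
    have := UniformSpace.secondCountable_of_separable Y
    exact hK X Y μ ν f hν h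
  · have hη0 : 0 < η.symm 2⁻¹ := by
      refine pos_iff_ne_zero.2 fun h0 ↦ ?_
      have h := η.apply_symm_apply 2⁻¹
      rw [h0, (strictMono_of_homeomorph η).2] at h
      exact absurd h (by simp)
    -- One `λ` that serves both `f` (through `η 2`) and its inverse (through `η⁻¹(1/2)`).
    obtain ⟨lam, hlam⟩ := exists_gt (max (1 : ℝ) (max (η 2) (η.symm 2⁻¹ : ℝ)⁻¹))
    obtain ⟨hlam₁, hlam₂₃⟩ := max_lt_iff.1 hlam
    obtain ⟨hlam₂, hlam₃⟩ := max_lt_iff.1 hlam₂₃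
    obtain ⟨K₁, hK₁⟩ := exists_geometricQC_of_weaklyQuasisymmetric.{u, v} hQ A₁ A₂ hlam₁
    -- For the inverse map the two spaces, and hence the universes and the regularity constants,
    -- change places.
    obtain ⟨K₂, hK₂⟩ := exists_geometricQC_of_weaklyQuasisymmetric.{v, u} hQ A₂ A₁ hlam₁
    refine ⟨max K₁ K₂, ?_⟩
    intro X _ _ _ _ Y _ _ _ _ μ _ _ ν _ _ f hμ hν hf Γ
    have := UniformSpace.secondCountable_of_separable X
    have := UniformSpace.secondCountable_of_separable Y
    have h₁ := hK₁ X Y μ ν f hμ hν (hf.weak hlam₁ hlam₂.le) Γ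
    have h₂ := hK₂ Y X ν μ f.symm hν hμ
      (hf.weak_symm hlam₁ (inv_le_of_inv_le₀ (by exact_mod_cast hη0) hlam₃.le)) (imageFamily f Γ)
    rw [imageFamily_symm_imageFamily] at h₂
    exact ⟨h₁.trans (by gcongr; exact le_max_left _ _),
      h₂.trans (by gcongr; exact le_max_right _ _)⟩
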